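/- Let $\mathfrak g=\mathfrak g_{\bar 0}\oplus\mathfrak g_{\bar 1}$ be a basic simple finite-dimensional complex Lie superalgebra: $\mathfrak g$ is simple, $\mathfrak g_{\bar 0}$ is reductive, and $\mathfrak g$ carries an even, supersymmetric, invariant, non-degenerate bilinear form $(\cdot|\cdot)$. Let $e,x,f\in\mathfrak g_{\bar 0}$ satisfy $[e,f]=x$, $[x,e]=e$, $[x,f]=-f$, put $\mathfrak s=\mathrm{span}\{e,x,f\}$, let $\mathfrak g^\natural$ be the centralizer of $\mathfrak s$ in $\mathfrak g$, and let $\mathfrak g_j$ be the eigenspace of $\mathrm{ad}\,x$ in $\mathfrak g$ with eigenvalue $j$. Assume that - $\mathfrak g_{\bar 0}=\mathfrak s\oplus\mathfrak g^\natural$ and $\mathfrak g^\natural$ is not abelian; - the grading is minimal: $\mathfrak g_j=0$ for $j\in\frac12\mathbb Z$ with $|j|>1$, and $\mathfrak g_{-1}=\mathbb C f$; - the form is normalized by $(x|x)=\frac12$, and $(\alpha|\beta)\in\mathbb R$ for all roots $\alpha,\beta$ of $\mathfrak g$ (with respect to a Cartan subalgebra of $\mathfrak g_{\bar 0}$). A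 conjugate linear involution $\phi$ of $\mathfrak g$ (parity preserving, $\phi^2=\mathrm{id}$, $\phi([a,b])=[\phi(a),\phi(b)]$) is called almost compact if it fixes $e,x,f$ and its fixed point set in $\mathfrak g^\natural$ is a compact real Lie algebra, i.e. carries a positive definite symmetric bilinear form invariant under its adjoint action. Write $\mathfrak g^{ac}$ for the fixed point set of $\phi$ in $\mathfrak g$. Put $$\langle u,v\rangle=(e|[u,v])\quad(u,v\in\mathfrak g_{-1/2}),\qquad \langle u,v\rangle_{ne}=(f|[u,v])\quad(u,v\in\mathfrak g_{1/2}).$$ Then there is an almost compact involution $\phi$ of $\mathfrak g$ such that $\langle\cdot,\cdot\rangle$ is real-valued and positive definite on the real vector space $\mathfrak g^{ac}\cap\mathfrak g_{-1/2}$. Moreover, for every such $\phi$, the form $(u,v)\mapsto\langle\phi(u),v\rangle$ is Hermitian and positive definite on $\mathfrak g_{-1/2}$, and the form $(u,v)\mapsto\langle\phi(u),v\rangle_{ne}$ is Hermitian and negative definite on $\mathfrak g_{1/2}$. -/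

import Mathlib

open scoped ComplexConjugate

/-- The sign `(-1)^(p q)` of two parities, as a complex number. -/
def superSign (p q : ZMod 2) : ℂ := (-1) ^ (p.val * q.val)

/-- A Lie superalgebra over `ℂ`: a `ℤ/2`-graded complex vector space `g` with a bilinear even
bracket `br`, which is super skew-symmetric and satisfies the super Jacobi identity. -/
class LieSuperalgebra (g : Type*) [AddCommGroup g] [Module ℂ g] where
  /-- `part 0` is the even part, `part 1` the odd part. -/
  part : ZMod 2 → Submodule ℂ g
  isInternal : DirectSum.IsInternal part
  /-- The superbracket. -/
  br : g →ₗ[ℂ] g →ₗ[ℂ] g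
  br_mem : ∀ (p q : ZMod 2) (a b : g), a ∈ part p → b ∈ part q → br a b ∈ part (p + q)
  br_skew : ∀ (p q : ZMod 2) (a b : g), a ∈ part p → b ∈ part q →
    br a b = -(superSign p q • br b a)
  br_jacobi : ∀ (p q : ZMod 2) (a b c : g), a ∈ part p → b ∈ part q →
    br a (br b c) = br (br a b) c + superSign p q • br b (br a c)

namespace LieSuperalgebra

section Even

variable (g : Type*) [AddCommGroup g] [Module ℂ g] [LieSuperalgebra g]

/-- The even part of a Lie superalgebra. -/
abbrev Even : Type _ := ↥(part (g := g) 0)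

/-- The even part of a Lie superalgebra is a Lie ring. -/
instance instLieRingEven : LieRing (Even g) where
  bracket a b := ⟨br (a : g) (b : g), by
    simpa using br_mem (0 : ZMod 2) 0 (a : g) (b : g) a.2 b.2⟩
  add_lie a b c := by ext; simp
  lie_add a b c := by ext; simp
  lie_self a := by
    ext
    have h := br_skew (0 : ZMod 2) 0 (a : g) (a : g) a.2 a.2
    simp only [superSign, ZMod.val_zero, mul_zero, pow_zero, one_smul] at h
    have h2 : (2 : ℂ) • br (a : g) (a : g) = 0 := by
      rw [two_smul]
      exact eq_neg_iff_add_eq_zero.mp h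
    exact (smul_eq_zero.mp h2).resolve_left two_ne_zero
  leibniz_lie a b c := by
    ext
    simpa [superSign] using br_jacobi (0 : ZMod 2) 0 (a : g) (b : g) (c : g) a.2 b.2

/-- The even part of a Lie superalgebra over `ℂ` is a Lie algebra over `ℂ`. -/
instance instLieAlgebraEven : LieAlgebra ℂ (Even g) where
  lie_smul t a b := by
    ext
    exact map_smul (br (a : g)) t (b : g)

end Even

variable {g : Type*} [AddCommGroup g] [Module ℂ g] [LieSuperalgebra g]

/-- A graded ideal of a Lie superalgebra. (A left ideal that is graded is two-sided.) -/
def IsGradedIdeal (I : Submodule ℂ g) : Prop :=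
  (∀ a, ∀ b ∈ I, br a b ∈ I) ∧ I = (I ⊓ part 0) ⊔ (I ⊓ part 1)

variable (g) in
/-- A Lie superalgebra is simple if its bracket is not zero and it has no graded ideals except `0`
and itself. -/
def IsSimple : Prop :=
  (∃ a b : g, br a b ≠ 0) ∧ ∀ I : Submodule ℂ g, IsGradedIdeal I → I = ⊥ ∨ I = ⊤

/-- `B` is an even, supersymmetric, invariant, non-degenerate bilinear form on `g`. -/
structure IsBasicForm (B : g →ₗ[ℂ] g →ₗ[ℂ] ℂ) : Prop where
  even : ∀ a ∈ part (g := g) 0, ∀ b ∈ part (g := g) 1, B a b = 0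
  supersymm : ∀ (p q : ZMod 2) (a b : g), a ∈ part p → b ∈ part q →
    B a b = superSign p q * B b a
  invariant : ∀ a b c : g, B (br a b) c = B a (br b c)
  nondeg : ∀ a : g, (∀ b, B a b = 0) → a = 0

/-- `t ∈ H` represents, through the form `B`, a root of `g` with respect to the subalgebra `H` of
the even part: the functional `h ↦ (t|h)` on `H` is non-zero and has a non-zero root vector. -/
def IsRootElement (B : g →ₗ[ℂ] g →ₗ[ℂ] ℂ) (H : LieSubalgebra ℂ (Even g)) (t : Even g) : Prop :=
  t ∈ H ∧ (∃ h ∈ H, B (t : g) (h : g) ≠ 0) ∧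
    ∃ v : g, v ≠ 0 ∧ ∀ h ∈ H, br (h : g) v = B (t : g) (h : g) • v

/-- All the inner products `(α|β)` of roots are real (with respect to some Cartan subalgebra of the
even part). -/
def HasRealRootProducts (B : g →ₗ[ℂ] g →ₗ[ℂ] ℂ) : Prop :=
  ∃ H : LieSubalgebra ℂ (Even g), H.IsCartanSubalgebra ∧
    ∀ s t : Even g, IsRootElement B H s → IsRootElement B H t → (B (s : g) (t : g)).im = 0

/-- The centralizer of `{e, x, f}` in `g`. -/
def centralizer (e x f : g) : Submodule ℂ g :=
  LinearMap.ker (br e) ⊓ LinearMap.ker (br x) ⊓ LinearMap.ker (br f)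

/-- The eigenspace of `ad x` in `g` with eigenvalue `j`. -/
abbrev grade (x : g) (j : ℂ) : Submodule ℂ g := Module.End.eigenspace (br x) j

/-- The standing assumptions on the complex Lie superalgebra `g`, the form `B = (. | .)` and the
triple `{e, x, f}`: `g` is basic simple, the form is normalized by `(x|x) = 1/2` and takes real
values on pairs of roots, `{e, x, f}` is an `sl₂`-triple with span `𝔰`, the even part is the direct
sum of `𝔰` and of the centralizer of `𝔰` in `g`, the latter is not abelian, and the grading by
`ad x` is minimal. -/
structure IsMinimalDatum (B : g →ₗ[ℂ] g →ₗ[ℂ] ℂ) (e x f : g) : Prop where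
  simple : IsSimple g
  even_reductive : LieAlgebra.radical ℂ (Even g) = LieAlgebra.center ℂ (Even g)
  form : IsBasicForm B
  real_roots : HasRealRootProducts B
  normalized : B x x = 1 / 2
  br_e_f : br e f = x
  br_x_e : br x e = e
  br_x_f : br x f = -f
  even_eq : Submodule.span ℂ {e, x, f} ⊔ centralizer e x f = part 0
  disjoint : Disjoint (Submodule.span ℂ {e, x, f}) (centralizer e x f)
  not_abelian : ∃ a ∈ centralizer e x f, ∃ b ∈ centralizer e x f, br a b ≠ 0
  grade_eq_bot : ∀ j : ℤ, 2 < |j| → grade x ((j : ℂ) / 2) = ⊥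
  grade_neg_one : grade x (-1) = Submodule.span ℂ {f}

/-- A conjugate linear involution of the Lie superalgebra `g`: an involutive conjugate linear map
which preserves the parity and the bracket. -/
structure IsConjInvolution (φ : g →ₗ⋆[ℂ] g) : Prop where
  involutive : ∀ a, φ (φ a) = a
  map_part : ∀ (p : ZMod 2), ∀ a ∈ part (g := g) p, φ a ∈ part p
  map_br : ∀ a b, φ (br a b) = br (φ a) (φ b)

/-- The fixed point set of a conjugate linear map, as a real subspace. -/
def realForm (φ : g →ₗ⋆[ℂ] g) : Submodule ℝ g where
  carrier := {a | φ a = a}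
  zero_mem' := map_zero φ
  add_mem' := fun {a b} ha hb => by
    change φ (a + b) = a + b
    rw [map_add, show φ a = a from ha, show φ b = b from hb]
  smul_mem' := fun r a ha => by
    change φ (r • a) = r • a
    rw [← Complex.coe_smul, map_smulₛₗ, show φ a = a from ha, Complex.conj_ofReal]

/-- The real subspace `K` of the even part of `g` (in practice closed under the bracket) is a
compact Lie algebra: it carries a positive definite symmetric real bilinear form that is invariant
under the adjoint action of `K`; equivalently, the adjoint group of `K` is compact. (The form `Q` is
written on all of `g`, but only its restriction to `K` is constrained.) -/
def IsCompactLie (K : Submodule ℝ g) : Prop :=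
  ∃ Q : g →ₗ[ℝ] g →ₗ[ℝ] ℝ,
    (∀ a ∈ K, ∀ b ∈ K, Q a b = Q b a) ∧
    (∀ a ∈ K, a ≠ 0 → 0 < Q a a) ∧
    ∀ c ∈ K, ∀ a ∈ K, ∀ b ∈ K, Q (br c a) b + Q a (br c b) = 0

/-- An almost compact involution: a conjugate linear involution of `g` that fixes `e`, `x`, `f` and
whose fixed points in the centralizer of `{e, x, f}` form a compact Lie algebra. -/
structure IsAlmostCompact (e x f : g) (φ : g →ₗ⋆[ℂ] g) : Prop where
  conjInvolution : IsConjInvolution φ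
  map_e : φ e = e
  map_x : φ x = x
  map_f : φ f = f
  compact : IsCompactLie (realForm φ ⊓ (centralizer e x f).restrictScalars ℝ)

/-- The bilinear form `(w | [u, v])`. For `w = e` (on `g_{-1/2}`) it is `⟨u, v⟩`, for `w = f` (on
`g_{1/2}`) it is `⟨u, v⟩_ne`. -/
def pairing (B : g →ₗ[ℂ] g →ₗ[ℂ] ℂ) (w : g) (u v : g) : ℂ := B w (br u v)

/-- The complex-valued form `b` is real-valued and positive definite on the real subspace `W`. -/
def IsPosDefOnReal (b : g → g → ℂ) (W : Submodule ℝ g) : Prop :=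
  (∀ u ∈ W, ∀ v ∈ W, (b u v).im = 0) ∧ ∀ u ∈ W, u ≠ 0 → 0 < (b u u).re

/-- The form `h` (sesquilinear, in all cases where this is used) is Hermitian on the complex
subspace `W`. -/
def IsHermitianOn (h : g → g → ℂ) (W : Submodule ℂ g) : Prop :=
  ∀ u ∈ W, ∀ v ∈ W, h v u = conj (h u v)

/-- The form `h` is Hermitian and positive definite on the complex subspace `W`. -/
def IsPosDefHermitianOn (h : g → g → ℂ) (W : Submodule ℂ g) : Prop :=
  IsHermitianOn h W ∧ ∀ u ∈ W, u ≠ 0 → 0 < (h u u).re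

/-- The form `h` is Hermitian and negative definite on the complex subspace `W`. -/
def IsNegDefHermitianOn (h : g → g → ℂ) (W : Submodule ℂ g) : Prop :=
  IsHermitianOn h W ∧ ∀ u ∈ W, u ≠ 0 → (h u u).re < 0

end LieSuperalgebra

/-! Write V for g_{-1/2} and n for its dimension. The pairing ⟨u, v⟩ = (e|[u, v]) is symmetric and
nondegenerate on V, so V has an orthonormal basis v_i, unique up to the complex orthogonal group.
The centralizer of the triple acts faithfully on V by skew matrices, and ad e identifies V with
g_{1/2}. Brackets between the two odd pieces are governed by `moment`, μ(w, u) = [[e, w], u] - ⟨w,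
u⟩x, which lies in the centralizer. Sending E_ij to the matrix of μ(v_i, v_j) gives an operator R on
matrices (`frameCurv`) that encodes the whole bracket. Jacobi says two things about R: it is the
constant curvature operator plus a totally antisymmetric four-tensor, and [RX, RY] = R[RX, Y]. This
is `IsAdmissible`.

If the entries of R are real, the conjugation fixing e, x, f, the v_i, the [e, v_i] and the μ(v_i,
v_j) respects the bracket. Its fixed points in the centralizer act by real skew matrices, so the
negative of the trace form is positive definite there, and ⟨·,·⟩ is a sum of squares on the fixed
points of V. Hence it suffices to make R real by an orthogonal change of basis.

For n ≠ 4 the key is a Casimir identity with coefficient n - 4 (`IsAdmissible.casimir`). It shows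
that the range of R equals its own normalizer among skew matrices, that equivariant four-form
perturbations with values in the range vanish, and that every infinitesimal deformation of R comes
from the orthogonal Lie algebra. A slice argument with a quadratic estimate then shows that every
admissible operator near R lies on its orbit. Next, as in Kempf and Ness, take a point S of least
Hilbert-Schmidt norm in the closure of the orbit of R. The moment map vanishes at S, which makes the
range of S stable under complex conjugation; uniqueness then forces S to be real. By rigidity at S,
nearby points of the orbit of R lie on the orbit of S, so the two orbits agree.

For n = 4 there are genuine parameters and rigidity fails. A four-form in dimension four is a scalar
times the Hodge star, so it is real as soon as it has a real eigenvalue on a nonzero skew matrix.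
Such an eigenvalue is, up to a factor, the ratio between the trace form of the odd part and the
invariant form. The real inner products of roots make this ratio real
(`CartanForm.im_eq_zero_of_weights`).

The Hermitian statements follow by splitting V into real and imaginary parts for φ. Passing to
g_{1/2} by ad e multiplies the form by -1/2, which turns positive into negative. -/

namespace CurvatureOperator

attribute [local instance] LieRing.ofAssociativeRing
set_option linter.unusedSectionVars false

open Matrix

/-! ### Four-forms as operators on matrices, and their Casimir sums -/

variable {ι : Type*} [Fintype ι] [DecidableEq ι]

/-- The matrix units, indexed by pairs. -/
def unit (p : ι × ι) : Matrix ι ι ℂ := Matrix.single p.1 p.2 1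

lemma unit_apply (p : ι × ι) (k l : ι) : unit p k l = if p.1 = k ∧ p.2 = l then 1 else 0 := by
  simp [unit, Matrix.single_apply]

lemma sum_unit (X : Matrix ι ι ℂ) : X = ∑ p : ι × ι, X p.1 p.2 • unit p := by
  rw [Fintype.sum_prod_type]
  conv_lhs => rw [Matrix.matrix_eq_sum_single X]
  simp [unit, Matrix.smul_single]

lemma trace_transpose_unit (X : Matrix ι ι ℂ) (p : ι × ι) :
    trace (Xᵀ * unit p) = X p.1 p.2 := by
  simp [unit, Matrix.trace_mul_single]

lemma trace_unit_transpose (X : Matrix ι ι ℂ) (p : ι × ι) :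
    trace ((unit p)ᵀ * X) = X p.1 p.2 := by
  rw [← Matrix.trace_transpose, Matrix.transpose_mul, Matrix.transpose_transpose,
    trace_transpose_unit]

/-- Moving an operator across the canonical symmetric tensor. -/
lemma sum_bilin_swap (A A' : Matrix ι ι ℂ →ₗ[ℂ] Matrix ι ι ℂ)
    (h : ∀ X Y, trace ((A X)ᵀ * Y) = trace (Xᵀ * A' Y))
    (F G : Matrix ι ι ℂ →ₗ[ℂ] Matrix ι ι ℂ) :
    ∑ p : ι × ι, ⁅F (A (unit p)), G (unit p)⁆ = ∑ p : ι × ι, ⁅F (unit p), G (A' (unit p))⁆ := by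
  have hA (p q : ι × ι) : A (unit p) q.1 q.2 = A' (unit q) p.1 p.2 := by
    rw [← trace_transpose_unit (A (unit p)), h, trace_unit_transpose]
  have h1 (p : ι × ι) : ⁅F (A (unit p)), G (unit p)⁆
      = ∑ q : ι × ι, A (unit p) q.1 q.2 • ⁅F (unit q), G (unit p)⁆ := by
    conv_lhs => rw [sum_unit (A (unit p))]
    simp [map_sum, sum_lie]
  have h2 (p : ι × ι) : ⁅F (unit p), G (A' (unit p))⁆
      = ∑ q : ι × ι, A' (unit p) q.1 q.2 • ⁅F (unit p), G (unit q)⁆ := by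
    conv_lhs => rw [sum_unit (A' (unit p))]
    simp [map_sum, lie_sum]
  simp only [h1, h2]
  rw [Finset.sum_comm]
  simp only [hA]

lemma trace_ad_skew {a : Matrix ι ι ℂ} (ha : aᵀ = -a) (X Y : Matrix ι ι ℂ) :
    trace (⁅a, X⁆ᵀ * Y) = trace (Xᵀ * (-⁅a, Y⁆)) := by
  have : trace (Xᵀ * (Y * a)) = trace (a * (Xᵀ * Y)) := by
    rw [Matrix.trace_mul_comm a, mul_assoc]
  simp only [Ring.lie_def, transpose_sub, transpose_mul, ha, sub_mul, mul_sub, neg_sub, trace_sub,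
    mul_neg, neg_mul, trace_neg, mul_assoc, this]
  ring

/-- Operators on matrices given by totally antisymmetric tensors with four indices. -/
structure IsFourForm (c : Matrix ι ι ℂ →ₗ[ℂ] Matrix ι ι ℂ) : Prop where
  map_transpose : ∀ X, c Xᵀ = -c X
  transpose_map : ∀ X, (c X)ᵀ = -c X
  cyclic : ∀ w u v, c (vecMulVec w u) *ᵥ v + c (vecMulVec w v) *ᵥ u = 0

namespace IsFourForm

variable {c d : Matrix ι ι ℂ →ₗ[ℂ] Matrix ι ι ℂ}

lemma add (hc : IsFourForm c) (hd : IsFourForm d) : IsFourForm (c + d) where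
  map_transpose X := by simp [hc.map_transpose, hd.map_transpose]; abel
  transpose_map X := by simp [hc.transpose_map, hd.transpose_map]; abel
  cyclic w u v := by
    have h1 := hc.cyclic w u v
    have h2 := hd.cyclic w u v
    simp only [LinearMap.add_apply, Matrix.add_mulVec]
    rw [← add_zero (0 : ι → ℂ)]
    nth_rewrite 1 [← h1]
    rw [← h2]; abel

lemma smul (t : ℂ) (hc : IsFourForm c) : IsFourForm (t • c) where
  map_transpose X := by simp [hc.map_transpose]
  transpose_map X := by simp [hc.transpose_map]
  cyclic w u v := by
    simp only [LinearMap.smul_apply, Matrix.smul_mulVec]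
    rw [← smul_add, hc.cyclic, smul_zero]

lemma zero : IsFourForm (0 : Matrix ι ι ℂ →ₗ[ℂ] Matrix ι ι ℂ) where
  map_transpose X := by simp
  transpose_map X := by simp
  cyclic w u v := by simp

lemma sub (hc : IsFourForm c) (hd : IsFourForm d) : IsFourForm (c - d) := by
  have h := hc.add (hd.smul (-1))
  have e : c + (-1 : ℂ) • d = c - d := by module
  rwa [e] at h

lemma swap_fst (hc : IsFourForm c) (i j k l : ι) : c (unit (i, j)) k l = -c (unit (j, i)) k l := by
  have := hc.map_transpose (unit (i, j))
  have h2 : (unit (i, j) : Matrix ι ι ℂ)ᵀ = unit (j, i) := by simp [unit]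
  rw [h2] at this
  rw [this]; simp

lemma swap_snd (hc : IsFourForm c) (X : Matrix ι ι ℂ) (k l : ι) : c X k l = -c X l k := by
  have := congr_fun (congr_fun (hc.transpose_map X) k) l
  simp only [transpose_apply] at this
  rw [this]; simp

/-- The coordinate form of `cyclic`. With `swap_fst` and `swap_snd` it gives three index
transpositions that generate all permutations of the four indices, so the tensor is totally
antisymmetric. -/
lemma swap_mid (hc : IsFourForm c) (i j k l : ι) : c (unit (i, j)) k l = -c (unit (i, l)) k j := by
  have h := congr_fun (hc.cyclic (Pi.single i 1) (Pi.single j 1) (Pi.single l 1)) k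
  have h2 (i j : ι) : vecMulVec (Pi.single i (1 : ℂ)) (Pi.single j 1) = unit (i, j) := by
    simp [unit, Matrix.single_eq_single_vecMulVec_single]
  rw [h2, h2] at h
  simp only [mulVec_single_one, Pi.add_apply, col_apply, Pi.zero_apply] at h
  linear_combination h

lemma swap_pairs (hc : IsFourForm c) (i j k l : ι) :
    c (unit (i, j)) k l = c (unit (k, l)) i j := by
  rw [hc.swap_fst i j k l, hc.swap_mid j i k l, hc.swap_fst j l k i, hc.swap_mid l j k i,
    hc.swap_snd _ k j, hc.swap_mid l i j k, hc.swap_fst l k j i, hc.swap_snd _ j i]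
  ring

lemma apply_eq_sum (X : Matrix ι ι ℂ) (k l : ι) :
    c X k l = ∑ p : ι × ι, X p.1 p.2 * c (unit p) k l := by
  conv_lhs => rw [sum_unit X]
  simp [map_sum, Matrix.sum_apply]

lemma symm (hc : IsFourForm c) (X Y : Matrix ι ι ℂ) :
    trace ((c X)ᵀ * Y) = trace (Xᵀ * c Y) := by
  have key (p q : ι × ι) : trace ((c (unit p))ᵀ * unit q) = trace ((unit p)ᵀ * c (unit q)) := by
    rw [trace_transpose_unit, trace_unit_transpose]
    exact hc.swap_pairs _ _ _ _
  conv_lhs => rw [sum_unit X, sum_unit Y]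
  conv_rhs => rw [sum_unit X, sum_unit Y]
  simp only [map_sum, map_smul, transpose_sum, transpose_smul, Finset.sum_mul, Finset.mul_sum,
    trace_sum, Matrix.smul_mul, Matrix.mul_smul, trace_smul, key]

/-- Four-forms are stable under the orthogonal group; this is the derivative of that action. -/
lemma ad (hc : IsFourForm c) {a : Matrix ι ι ℂ} (ha : aᵀ = -a) :
    IsFourForm (LieAlgebra.ad ℂ (Matrix ι ι ℂ) a ∘ₗ c - c ∘ₗ LieAlgebra.ad ℂ (Matrix ι ι ℂ) a) where
  map_transpose X := by
    have : ⁅a, Xᵀ⁆ = ⁅a, X⁆ᵀ := by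
      simp only [Ring.lie_def, transpose_sub, transpose_mul, ha]
      noncomm_ring
    simp only [this, LinearMap.sub_apply, LinearMap.comp_apply, LieAlgebra.ad_apply,
      hc.map_transpose, lie_neg]
    abel
  transpose_map X := by
    simp only [LinearMap.sub_apply, LinearMap.comp_apply, LieAlgebra.ad_apply, transpose_sub,
      hc.transpose_map, Ring.lie_def, transpose_mul, ha]
    noncomm_ring
  cyclic w u v := by
    have hv (w u : ι → ℂ) : ⁅a, vecMulVec w u⁆ = vecMulVec (a *ᵥ w) u + vecMulVec w (a *ᵥ u) := by
      rw [Ring.lie_def, mul_vecMulVec, vecMulVec_mul, ← mulVec_transpose, ha, neg_mulVec,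
        vecMulVec_neg, sub_neg_eq_add]
    simp only [LinearMap.sub_apply, LinearMap.comp_apply, LieAlgebra.ad_apply, hv, map_add,
      sub_mulVec, add_mulVec, Ring.lie_def, ← mulVec_mulVec]
    have h1 := congr_arg (a *ᵥ ·) (hc.cyclic w u v)
    have h2 := hc.cyclic (a *ᵥ w) u v
    have h3 := hc.cyclic w (a *ᵥ u) v
    have h4 := hc.cyclic w u (a *ᵥ v)
    simp only [mulVec_add, mulVec_zero] at h1
    rw [← sub_zero (0 : ι → ℂ)]
    nth_rewrite 1 [← h1]
    rw [← add_zero (0 : ι → ℂ)]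
    nth_rewrite 1 [← h2]
    rw [← add_zero (0 : ι → ℂ)]
    nth_rewrite 1 [← h3]
    rw [← h4]
    abel

end IsFourForm

lemma sum_mul_unit_apply (M : ι × ι → Matrix ι ι ℂ) (k l : ι) :
    (∑ p : ι × ι, M p * unit p) k l = ∑ i, M (i, l) k i := by
  simp [Matrix.sum_apply, mul_apply, unit_apply, Fintype.sum_prod_type, ite_and]

lemma sum_unit_mul_apply (M : ι × ι → Matrix ι ι ℂ) (k l : ι) :
    (∑ p : ι × ι, unit p * M p) k l = ∑ j, M (k, j) j l := by
  rw [Matrix.sum_apply, Fintype.sum_prod_type_right]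
  simp [mul_apply, unit_apply, ite_and]

namespace IsFourForm

variable {c : Matrix ι ι ℂ →ₗ[ℂ] Matrix ι ι ℂ}

lemma apply_same_fst (hc : IsFourForm c) (i k l : ι) : c (unit (i, l)) k i = 0 := by
  have h := hc.swap_fst i l k i
  rw [hc.swap_mid l i k i] at h
  have h2 := hc.swap_mid i l k i
  have h3 := hc.swap_fst i i k l
  linear_combination h2 - (1 / 2) * h3

/-- The sum contracts `a` with one input and one output index of the tensor; two transpositions move
both into the input slot. -/
lemma sum_map_unit_mul_mul_unit (hc : IsFourForm c) (a : Matrix ι ι ℂ) :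
    ∑ p : ι × ι, c (unit p) * a * unit p = c a := by
  ext k l
  rw [sum_mul_unit_apply (fun p => c (unit p) * a), apply_eq_sum a k l, Fintype.sum_prod_type_right]
  refine Finset.sum_congr rfl fun i _ => ?_
  rw [mul_apply]
  refine Finset.sum_congr rfl fun q _ => ?_
  rw [hc.swap_mid i l k q, hc.swap_fst i q k l]
  ring

lemma sum_unit_mul_mul_map_unit (hc : IsFourForm c) (a : Matrix ι ι ℂ) :
    ∑ p : ι × ι, unit p * (a * c (unit p)) = c a := by
  ext k l
  rw [sum_unit_mul_apply (fun p => a * c (unit p)), apply_eq_sum a k l, Fintype.sum_prod_type]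
  refine Finset.sum_congr rfl fun i _ => ?_
  rw [mul_apply]
  refine Finset.sum_congr rfl fun q _ => ?_
  rw [hc.swap_fst k i q l, hc.swap_snd _ q l, hc.swap_mid i k l q, hc.swap_snd _ l k]
  ring

/-- The Casimir operator attached to a four-form. -/
lemma casimir (hc : IsFourForm c) (a : Matrix ι ι ℂ) :
    ∑ p : ι × ι, ⁅c (unit p), ⁅a, unit p⁆⁆ = (2 : ℂ) • c a := by
  -- Contracting two indices of an antisymmetric tensor gives zero, so only the terms with `a` in
  -- the middle survive.
  have h0 : ∑ p : ι × ι, c (unit p) * unit p = 0 := by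
    ext k l
    rw [sum_mul_unit_apply (fun p => c (unit p))]
    simp [hc.apply_same_fst]
  have h1 : ∑ p : ι × ι, unit p * c (unit p) = 0 := by
    ext k l
    rw [sum_unit_mul_apply (fun p => c (unit p))]
    refine Finset.sum_eq_zero fun j _ => ?_
    rw [hc.swap_pairs, hc.swap_fst, hc.swap_snd, hc.swap_mid]
    linear_combination (-1 / 2) * hc.swap_snd (unit (l, k)) j j
  have h2 : ∀ p : ι × ι, ⁅c (unit p), ⁅a, unit p⁆⁆ = c (unit p) * a * unit p
      + unit p * (a * c (unit p)) - c (unit p) * unit p * a - a * (unit p * c (unit p)) := by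
    intro p; simp only [Ring.lie_def]; noncomm_ring
  simp only [h2, Finset.sum_sub_distrib, Finset.sum_add_distrib, hc.sum_map_unit_mul_mul_unit,
    hc.sum_unit_mul_mul_map_unit, ← Finset.sum_mul, ← Finset.mul_sum, h0, h1]
  simp [two_smul]

end IsFourForm

/-- The curvature operator of constant curvature: minus the projection to skew matrices. -/
noncomputable def constOp (ι : Type*) : Matrix ι ι ℂ →ₗ[ℂ] Matrix ι ι ℂ :=
  (1 / 2 : ℂ) • ((Matrix.transposeLinearEquiv ι ι ℂ ℂ).toLinearMap - LinearMap.id)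

lemma constOp_apply (X : Matrix ι ι ℂ) : constOp ι X = (1 / 2 : ℂ) • (Xᵀ - X) := rfl

lemma constOp_skew {a : Matrix ι ι ℂ} (ha : aᵀ = -a) : constOp ι a = -a := by
  rw [constOp_apply, ha]; module

/-- The dimension enters through ∑ E_ji E_ij = n·1. The other contractions are ∑ E_ij E_ij = 1, ∑
E_ij a E_ij = aᵀ = -a, and sums proportional to tr a = 0. -/
lemma constOp_casimir {a : Matrix ι ι ℂ} (ha : aᵀ = -a) :
    ∑ p : ι × ι, ⁅constOp ι (unit p), ⁅a, unit p⁆⁆ = (2 - Fintype.card ι : ℂ) • a := by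
  have hT (p : ι × ι) : (unit p)ᵀ = unit p.swap := by simp [unit]
  have ht : ∑ i, a i i = 0 := by
    refine Finset.sum_eq_zero fun i _ => ?_
    have := congr_fun (congr_fun ha i) i
    simp only [transpose_apply, Matrix.neg_apply] at this
    linear_combination (1 / 2) * this
  have h1 : ∑ p : ι × ι, unit p.swap * (unit p : Matrix ι ι ℂ) = (Fintype.card ι : ℂ) • 1 := by
    ext k l
    rw [sum_mul_unit_apply (fun p => unit p.swap)]
    simp [unit_apply, Matrix.one_apply, eq_comm]
  have h1' : ∑ p : ι × ι, (unit p : Matrix ι ι ℂ) * unit p.swap = (Fintype.card ι : ℂ) • 1 := by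
    ext k l
    rw [sum_unit_mul_apply (fun p => unit p.swap)]
    simp [unit_apply, Matrix.one_apply]
  have h2 : ∑ p : ι × ι, (unit p : Matrix ι ι ℂ) * unit p = 1 := by
    ext k l
    rw [sum_mul_unit_apply (fun p => unit p)]
    simp [unit_apply, Matrix.one_apply, ite_and, eq_comm]
  have h3 : ∑ p : ι × ι, unit p * a * unit p = -a := by
    ext k l
    rw [sum_mul_unit_apply (fun p => unit p * a), ← ha]
    simp [mul_apply, unit_apply, ite_and]
  have h4 : ∑ p : ι × ι, unit p.swap * a * unit p = 0 := by
    ext k l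
    rw [sum_mul_unit_apply (fun p => unit p.swap * a)]
    simp [mul_apply, unit_apply, ite_and, ht]
  have h4' : ∑ p : ι × ι, unit p * (a * unit p.swap) = 0 := by
    ext k l
    rw [sum_unit_mul_apply (fun p => a * unit p.swap)]
    simp [mul_apply, unit_apply, ite_and, ht]
  have h5 : ∀ p : ι × ι, ⁅constOp ι (unit p), ⁅a, unit p⁆⁆ = (1 / 2 : ℂ) • (
      unit p.swap * a * unit p - unit p.swap * unit p * a - a * (unit p * unit p.swap)
      + unit p * (a * unit p.swap) - (2 : ℂ) • (unit p * a * unit p) + unit p * unit p * a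
      + a * (unit p * unit p)) := by
    intro p
    rw [constOp_apply, hT, two_smul]
    simp only [Ring.lie_def, Matrix.smul_mul, Matrix.mul_smul, ← smul_sub]
    congr 1
    noncomm_ring
  simp only [h5, ← Finset.smul_sum, Finset.sum_sub_distrib, Finset.sum_add_distrib,
    ← Finset.sum_mul, ← Finset.mul_sum, h1, h1', h2, h3, h4, h4']
  simp only [Matrix.smul_mul, Matrix.mul_smul, one_mul, mul_one]
  module

lemma constOp_symm (X Y : Matrix ι ι ℂ) :
    trace ((constOp ι X)ᵀ * Y) = trace (Xᵀ * constOp ι Y) := by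
  have h : trace (X * Y) = trace (Xᵀ * Yᵀ) := by
    rw [← trace_transpose, transpose_mul, trace_mul_comm]
  simp only [constOp_apply, transpose_smul, transpose_sub, transpose_transpose, Matrix.smul_mul,
    Matrix.mul_smul, trace_smul, sub_mul, mul_sub, trace_sub, h]

/-! ### Admissible operators and infinitesimal rigidity -/

/-- The curvature operators of minimal type: four-forms plus the constant curvature operator,
invariant under their own image. -/
structure IsAdmissible (R : Matrix ι ι ℂ →ₗ[ℂ] Matrix ι ι ℂ) : Prop where
  fourForm : IsFourForm (R - constOp ι)
  lie_map : ∀ X Y, ⁅R X, R Y⁆ = R ⁅R X, Y⁆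

namespace IsAdmissible

variable {R c : Matrix ι ι ℂ →ₗ[ℂ] Matrix ι ι ℂ}

lemma symm (hR : IsAdmissible R) (X Y : Matrix ι ι ℂ) :
    trace ((R X)ᵀ * Y) = trace (Xᵀ * R Y) := by
  have h := hR.fourForm.symm X Y
  have h2 := constOp_symm X Y
  simp only [LinearMap.sub_apply, transpose_sub, sub_mul, mul_sub, trace_sub] at h
  linear_combination h + h2

lemma transpose_map (hR : IsAdmissible R) (X : Matrix ι ι ℂ) : (R X)ᵀ = -R X := by
  have h := hR.fourForm.transpose_map X
  simp only [LinearMap.sub_apply, transpose_sub, constOp_apply, transpose_smul,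
    transpose_transpose] at h
  rw [sub_eq_iff_eq_add] at h
  rw [h]
  module

/-- The four-form part contributes 2(Ra + a) and the constant part (2 - n)a. The coefficient n - 4
of `a` is the only source of the exception in dimension four. -/
lemma casimir (hR : IsAdmissible R) {a : Matrix ι ι ℂ} (ha : aᵀ = -a) :
    ∑ p : ι × ι, ⁅R (unit p), ⁅a, unit p⁆⁆ = (2 : ℂ) • R a - (Fintype.card ι - 4 : ℂ) • a := by
  have h1 := hR.fourForm.casimir a
  have h2 := constOp_casimir ha
  simp only [LinearMap.sub_apply, sub_lie, Finset.sum_sub_distrib, constOp_skew ha, h2] at h1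
  rw [sub_eq_iff_eq_add] at h1
  rw [h1]; module

lemma exists_pseudoinverse (R : Matrix ι ι ℂ →ₗ[ℂ] Matrix ι ι ℂ) :
    ∃ s : Matrix ι ι ℂ →ₗ[ℂ] Matrix ι ι ℂ, ∀ X, R (s (R X)) = R X := by
  obtain ⟨t, ht⟩ := R.rangeRestrict.exists_rightInverse_of_surjective R.range_rangeRestrict
  obtain ⟨s, hs⟩ := t.exists_extend
  refine ⟨s, fun X => ?_⟩
  have h1 : s (R X) = t (R.rangeRestrict X) := by
    rw [← hs]; rfl
  rw [h1]
  have := congr_arg Subtype.val (LinearMap.congr_fun ht (R.rangeRestrict X))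
  simpa using this

variable {s : Matrix ι ι ℂ →ₗ[ℂ] Matrix ι ι ℂ}

/-- Write R = RsR and move the last factor across the symmetric tensor, as R is self-adjoint for the
trace pairing. Both arguments are then expressed through the range of R. -/
lemma sum_lie_pseudoinverse (hR : IsAdmissible R) (hs : ∀ X, R (s (R X)) = R X)
    (F G : Matrix ι ι ℂ →ₗ[ℂ] Matrix ι ι ℂ) :
    ∑ p : ι × ι, ⁅F (R (unit p)), G (unit p)⁆
      = ∑ p : ι × ι, ⁅F (R (s (unit p))), G (R (unit p))⁆ := by
  have := sum_bilin_swap R R hR.symm (F ∘ₗ R ∘ₗ s) G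
  simpa only [LinearMap.comp_apply, hs] using this

lemma lie_mem_range (hR : IsAdmissible R) {a b : Matrix ι ι ℂ} (ha : a ∈ LinearMap.range R)
    (hb : b ∈ LinearMap.range R) : ⁅a, b⁆ ∈ LinearMap.range R := by
  obtain ⟨X, rfl⟩ := ha
  obtain ⟨Y, rfl⟩ := hb
  exact ⟨_, (hR.lie_map X Y).symm⟩

lemma card_ne (hn : Fintype.card ι ≠ 4) : (Fintype.card ι - 4 : ℂ) ≠ 0 := by
  rw [sub_ne_zero]
  exact_mod_cast hn

/-- The range of an admissible operator has no invariants in the skew matrices modulo itself. -/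
lemma mem_range_of_lie_mem (hR : IsAdmissible R) (hn : Fintype.card ι ≠ 4) {a : Matrix ι ι ℂ}
    (ha : aᵀ = -a) (h : ∀ X, ⁅a, R X⁆ ∈ LinearMap.range R) : a ∈ LinearMap.range R := by
  obtain ⟨s, hs⟩ := exists_pseudoinverse R
  have h1 := hR.casimir ha
  have h2 := hR.sum_lie_pseudoinverse hs LinearMap.id (LieAlgebra.ad ℂ (Matrix ι ι ℂ) a)
  simp only [LinearMap.id_apply, LieAlgebra.ad_apply] at h2
  rw [h2] at h1
  -- In the Casimir identity everything except (n - 4)a is now in the range: the sum consists of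
  -- brackets of two range elements.
  have h3 : (Fintype.card ι - 4 : ℂ) • a ∈ LinearMap.range R := by
    have : (Fintype.card ι - 4 : ℂ) • a = (2 : ℂ) • R a
        - ∑ p : ι × ι, ⁅R (s (unit p)), ⁅a, R (unit p)⁆⁆ := by rw [h1]; abel
    rw [this]
    exact sub_mem (Submodule.smul_mem _ _ ⟨_, rfl⟩)
      (sum_mem fun p _ => hR.lie_mem_range ⟨_, rfl⟩ (h _))
  exact (Submodule.smul_mem_iff _ (card_ne hn)).mp h3

/-- Invariant deformations supported on the range of an admissible operator vanish. -/
lemma eq_zero_of_range_le (hR : IsAdmissible R) (hn : Fintype.card ι ≠ 4) (hc : IsFourForm c)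
    (hrange : ∀ X, c X ∈ LinearMap.range R) (heq : ∀ X Y, ⁅R Y, c X⁆ = c ⁅R Y, X⁆) : c = 0 := by
  obtain ⟨s, hs⟩ := exists_pseudoinverse R
  -- Both operators are self-adjoint for the trace pairing, so inclusion of ranges dualizes to
  -- inclusion of kernels. Thus c∘s is the well-defined map RX ↦ cX on the range.
  have hker : ∀ X, R X = 0 → c X = 0 := by
    intro X hX
    ext k l
    obtain ⟨Z, hZ⟩ := hrange (unit (k, l))
    rw [← trace_transpose_unit (c X) (k, l), hc.symm, ← hZ, ← hR.symm, hX]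
    simp
  have hcs : ∀ X, c (s (R X)) = c X := by
    intro X
    have := hker (s (R X) - X) (by rw [map_sub, hs, sub_self])
    rwa [map_sub, sub_eq_zero] at this
  ext1 Y
  have h1 := hc.casimir (R Y)
  have h2 := hR.casimir (hR.transpose_map Y)
  have h3 := hR.sum_lie_pseudoinverse hs (c ∘ₗ s) (LieAlgebra.ad ℂ (Matrix ι ι ℂ) (R Y))
  have h4 := hR.sum_lie_pseudoinverse hs LinearMap.id (LieAlgebra.ad ℂ (Matrix ι ι ℂ) (R Y))
  -- Equivariance lets c∘s carry the Casimir sum of R to that of c. Comparing 2c(RY) with 2c(RY) -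
  -- (n - 4)cY gives cY = 0.
  have h5 : ∀ p q, ⁅c p, R q⁆ = c (s ⁅R p, R q⁆) := by
    intro p q
    rw [← lie_skew, heq, ← lie_skew (R p), hR.lie_map q p, map_neg, map_neg, hcs]
  simp only [LinearMap.id_apply, LinearMap.comp_apply, LieAlgebra.ad_apply, hcs,
    hR.lie_map Y, h5] at h1 h3 h4
  simp only [← map_sum] at h3
  rw [← h4, h1, h2, map_sub, map_sub, map_smul, map_smul, hcs, map_smul, map_smul, hcs] at h3
  have h6 : (Fintype.card ι - 4 : ℂ) • c Y = 0 := by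
    rw [eq_comm, sub_eq_self] at h3
    exact h3
  exact (smul_eq_zero.mp h6).resolve_left (card_ne hn)

/-- Infinitesimal rigidity of admissible operators. -/
lemma exists_eq_ad (hR : IsAdmissible R) (hn : Fintype.card ι ≠ 4) (hc : IsFourForm c)
    (heq : ∀ X Y, ⁅c X, R Y⁆ + ⁅R X, c Y⁆ = c ⁅R X, Y⁆ + R ⁅c X, Y⁆) :
    ∃ a : Matrix ι ι ℂ, aᵀ = -a ∧ ∀ X, c X = ⁅a, R X⁆ - R ⁅a, X⁆ := by
  obtain ⟨s, hs⟩ := exists_pseudoinverse R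
  -- For X in the kernel of R the linearised equation says that cX normalizes the range.
  have hker : ∀ X, R X = 0 → c X ∈ LinearMap.range R := by
    intro X hX
    refine hR.mem_range_of_lie_mem hn (hc.transpose_map X) fun Y => ?_
    have := heq X Y
    simp only [hX, zero_lie, add_zero, map_zero, zero_add] at this
    exact ⟨_, this.symm⟩
  have hcs : ∀ X, c X - c (s (R X)) ∈ LinearMap.range R := by
    intro X
    rw [← map_sub]
    exact hker _ (by rw [map_sub, hs, sub_self])
  -- Contracting the cocycle c with the Casimir tensor gives, up to the factor n - 4, a primitive of
  -- c modulo the range.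
  set b := ∑ p : ι × ι, ⁅R (s (unit p)), c (unit p)⁆ with hb
  have hbT : bᵀ = -b := by
    simp only [hb, transpose_sum, ← Finset.sum_neg_distrib]
    refine Finset.sum_congr rfl fun p _ => ?_
    simp only [Ring.lie_def, transpose_sub, transpose_mul, hR.transpose_map, hc.transpose_map]
    noncomm_ring
  have key : ∀ Y, ⁅R Y, b⁆ - (Fintype.card ι - 4 : ℂ) • c Y ∈ LinearMap.range R := by
    intro Y
    -- The section s need not be equivariant. The defect d of R∘s vanishes on the range and takes
    -- values in it, so it contributes only range elements.
    let d : Matrix ι ι ℂ →ₗ[ℂ] Matrix ι ι ℂ := LieAlgebra.ad ℂ (Matrix ι ι ℂ) (R Y) ∘ₗ R ∘ₗ s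
      - R ∘ₗ s ∘ₗ LieAlgebra.ad ℂ (Matrix ι ι ℂ) (R Y)
    have hd (X) : d X = ⁅R Y, R (s X)⁆ - R (s ⁅R Y, X⁆) := rfl
    have hdR (X) : d (R X) = 0 := by rw [hd, hs, hR.lie_map, hs, sub_self]
    have hdk (X) : d X ∈ LinearMap.range R := by
      rw [hd, hR.lie_map]
      exact sub_mem ⟨_, rfl⟩ ⟨_, rfl⟩
    have e1 := sum_bilin_swap (LieAlgebra.ad ℂ (Matrix ι ι ℂ) (R Y))
      (-LieAlgebra.ad ℂ (Matrix ι ι ℂ) (R Y)) (trace_ad_skew (hR.transpose_map Y)) (R ∘ₗ s) c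
    have e2 := sum_bilin_swap R R hR.symm d (c ∘ₗ s)
    have e3 := hR.sum_lie_pseudoinverse hs LinearMap.id (LieAlgebra.ad ℂ (Matrix ι ι ℂ) (c Y))
    have e4 := hR.casimir (hc.transpose_map Y)
    simp only [LinearMap.id_apply, LinearMap.comp_apply, LieAlgebra.ad_apply, hdR, zero_lie,
      Finset.sum_const_zero, LinearMap.neg_apply, map_neg, lie_neg, Finset.sum_neg_distrib]
      at e1 e2 e3
    rw [e3] at e4
    have e5 (p : ι × ι) : ⁅R Y, ⁅R (s (unit p)), c (unit p)⁆⁆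
        = ⁅d (unit p), c (unit p) - c (s (R (unit p)))⁆ + ⁅d (unit p), c (s (R (unit p)))⁆
          + ⁅R (s ⁅R Y, unit p⁆), c (unit p)⁆ + ⁅R (s (unit p)), c ⁅R Y, unit p⁆⁆
          + ⁅R (s (unit p)), R ⁅c Y, unit p⁆⁆ - ⁅R (s (unit p)), ⁅c Y, R (unit p)⁆⁆ := by
      have h1 : ⁅R Y, c (unit p)⁆ = c ⁅R Y, unit p⁆ + R ⁅c Y, unit p⁆ - ⁅c Y, R (unit p)⁆ := by
        rw [← heq]; abel
      rw [leibniz_lie, h1, hd]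
      simp only [lie_add, lie_sub, sub_lie]
      abel
    have e6 : ⁅R Y, b⁆ - (Fintype.card ι - 4 : ℂ) • c Y
        = ∑ p : ι × ι, ⁅d (unit p), c (unit p) - c (s (R (unit p)))⁆
          + ∑ p : ι × ι, ⁅R (s (unit p)), R ⁅c Y, unit p⁆⁆ - (2 : ℂ) • R (c Y) := by
      rw [hb, lie_sum]
      simp only [e5, Finset.sum_sub_distrib, Finset.sum_add_distrib, e1, ← e2, e4]
      abel
    rw [e6]
    refine sub_mem (add_mem (sum_mem fun p _ => ?_) (sum_mem fun p _ => ?_))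
      (Submodule.smul_mem _ _ ⟨_, rfl⟩)
    · exact hR.lie_mem_range (hdk _) (hcs _)
    · exact hR.lie_mem_range ⟨_, rfl⟩ ⟨_, rfl⟩
  set t : ℂ := (Fintype.card ι - 4 : ℂ) with ht
  have ht0 : t ≠ 0 := card_ne hn
  set a : Matrix ι ι ℂ := -(t⁻¹ • b) with ha
  have haT : aᵀ = -a := by simp [ha, hbT]
  refine ⟨a, haT, ?_⟩
  set c' := c - (LieAlgebra.ad ℂ (Matrix ι ι ℂ) a ∘ₗ R - R ∘ₗ LieAlgebra.ad ℂ (Matrix ι ι ℂ) a)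
    with hc'
  have hc'a (X) : c' X = c X - (⁅a, R X⁆ - R ⁅a, X⁆) := rfl
  have hfour : IsFourForm c' := by
    refine hc.sub ?_
    have h1 := hR.fourForm.ad haT
    convert h1 using 1
    have h2 : LieAlgebra.ad ℂ (Matrix ι ι ℂ) a ∘ₗ constOp ι
        = constOp ι ∘ₗ LieAlgebra.ad ℂ (Matrix ι ι ℂ) a := by
      ext1 X
      have : ⁅a, Xᵀ⁆ = ⁅a, X⁆ᵀ := by
        simp only [Ring.lie_def, transpose_sub, transpose_mul, haT]
        noncomm_ring
      simp only [LinearMap.comp_apply, LieAlgebra.ad_apply, constOp_apply, lie_smul, lie_sub, this]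
    rw [LinearMap.comp_sub, LinearMap.sub_comp, h2]
    abel
  have hrange (X) : c' X ∈ LinearMap.range R := by
    have h1 : c' X = -(t⁻¹ • (⁅R X, b⁆ - t • c X)) + R ⁅a, X⁆ := by
      rw [hc'a, smul_sub, smul_smul, inv_mul_cancel₀ ht0, one_smul, ha, neg_lie, smul_lie,
        ← lie_skew (R X) b, smul_neg]
      abel
    rw [h1]
    exact add_mem (neg_mem (Submodule.smul_mem _ _ (key X))) ⟨_, rfl⟩
  have hlin (X Y) : ⁅c' X, R Y⁆ + ⁅R X, c' Y⁆ = c' ⁅R X, Y⁆ + R ⁅c' X, Y⁆ := by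
    have h1 := heq X Y
    have h2 : ⁅a, ⁅R X, R Y⁆⁆ = ⁅a, R ⁅R X, Y⁆⁆ := by rw [hR.lie_map]
    have h3 := hR.lie_map ⁅a, X⁆ Y
    have h4 := hR.lie_map X ⁅a, Y⁆
    simp only [hc'a, leibniz_lie a (R X) Y, sub_lie, lie_sub, map_sub, map_add]
    rw [leibniz_lie a (R X) (R Y)] at h2
    rw [h3, h4, ← h2, sub_add_sub_comm, h1]
    abel
  -- Once the deformation has values in the range, two terms of the linearised equation cancel and
  -- what remains is equivariance.
  have hfin := hR.eq_zero_of_range_le hn hfour hrange (by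
    intro X Y
    have h1 := hlin Y X
    obtain ⟨Z, hZ⟩ := hrange Y
    rw [← hZ, hR.lie_map, add_comm, add_left_inj] at h1
    exact h1)
  intro X
  have := hc'a X
  rw [hfin, LinearMap.zero_apply] at this
  exact sub_eq_zero.mp this.symm

end IsAdmissible
end CurvatureOperator

/-! ### The orthogonal action and a slice theorem -/

namespace CurvatureOperator

attribute [local instance] LieRing.ofAssociativeRing
set_option linter.unusedSectionVars false

open Matrix

variable {ι : Type*} [Fintype ι] [DecidableEq ι]

/-- The action of a matrix on operators on matrices, by change of an orthonormal basis. -/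
noncomputable def conjBy (g : Matrix ι ι ℂ) (R : Matrix ι ι ℂ →ₗ[ℂ] Matrix ι ι ℂ) :
    Matrix ι ι ℂ →ₗ[ℂ] Matrix ι ι ℂ :=
  LinearMap.mulLeft ℂ g ∘ₗ LinearMap.mulRight ℂ gᵀ ∘ₗ R ∘ₗ LinearMap.mulLeft ℂ gᵀ ∘ₗ
    LinearMap.mulRight ℂ g

lemma conjBy_apply (g : Matrix ι ι ℂ) (R : Matrix ι ι ℂ →ₗ[ℂ] Matrix ι ι ℂ) (X : Matrix ι ι ℂ) :
    conjBy g R X = g * R (gᵀ * X * g) * gᵀ := by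
  simp [conjBy, mul_assoc]

lemma conjBy_conjBy (g h : Matrix ι ι ℂ) (R : Matrix ι ι ℂ →ₗ[ℂ] Matrix ι ι ℂ) :
    conjBy g (conjBy h R) = conjBy (g * h) R := by
  ext1 X
  simp only [conjBy_apply, transpose_mul, mul_assoc]

lemma conjBy_one (R : Matrix ι ι ℂ →ₗ[ℂ] Matrix ι ι ℂ) : conjBy 1 R = R := by
  ext1 X
  simp [conjBy_apply]

lemma IsFourForm.conjBy {c : Matrix ι ι ℂ →ₗ[ℂ] Matrix ι ι ℂ} (hc : IsFourForm c)
    (g : Matrix ι ι ℂ) : IsFourForm (conjBy g c) where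
  map_transpose X := by
    have : gᵀ * Xᵀ * g = (gᵀ * X * g)ᵀ := by simp [mul_assoc]
    rw [conjBy_apply, conjBy_apply, this, hc.map_transpose]
    simp
  transpose_map X := by
    simp [conjBy_apply, hc.transpose_map, mul_assoc]
  cyclic w u v := by
    have h (w u : ι → ℂ) : gᵀ * vecMulVec w u * g = vecMulVec (gᵀ *ᵥ w) (gᵀ *ᵥ u) := by
      rw [mul_vecMulVec, vecMulVec_mul, mulVec_transpose g u]
    simp only [conjBy_apply, h, ← mulVec_mulVec, ← mulVec_add, hc.cyclic, mulVec_zero]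

/-- Orthogonal changes of basis commute with transposition. Hence the affine space of four-forms
based at `constOp` is preserved. -/
lemma conjBy_constOp {g : Matrix ι ι ℂ} (hg : g * gᵀ = 1) : conjBy g (constOp ι) = constOp ι := by
  have hg' := mul_eq_one_comm.mp hg
  ext1 X
  have h1 : g * (gᵀ * X * g) * gᵀ = X := by
    calc _ = (g * gᵀ) * X * (g * gᵀ) := by noncomm_ring
      _ = X := by simp [hg]
  have h2 : g * (gᵀ * Xᵀ * g) * gᵀ = Xᵀ := by
    calc _ = (g * gᵀ) * Xᵀ * (g * gᵀ) := by noncomm_ring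
      _ = Xᵀ := by simp [hg]
  have h3 : (gᵀ * X * g)ᵀ = gᵀ * Xᵀ * g := by simp [mul_assoc]
  simp only [conjBy_apply, constOp_apply, h3, Matrix.mul_smul, Matrix.smul_mul, mul_sub, sub_mul,
    h1, h2]

lemma IsAdmissible.conjBy {R : Matrix ι ι ℂ →ₗ[ℂ] Matrix ι ι ℂ} (hR : IsAdmissible R)
    {g : Matrix ι ι ℂ} (hg : g * gᵀ = 1) : IsAdmissible (conjBy g R) where
  fourForm := by
    have := hR.fourForm.conjBy g
    convert this using 1
    nth_rewrite 1 [← conjBy_constOp hg]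
    ext1 X
    simp [conjBy_apply, mul_sub, sub_mul]
  lie_map X Y := by
    have hg' := mul_eq_one_comm.mp hg
    have h1 (A B : Matrix ι ι ℂ) : g * A * gᵀ * (g * B * gᵀ) = g * (A * B) * gᵀ := by
      calc _ = g * A * (gᵀ * g) * B * gᵀ := by noncomm_ring
        _ = _ := by rw [hg']; noncomm_ring
    have h2 (A : Matrix ι ι ℂ) : gᵀ * (g * A * gᵀ * Y) * g = A * (gᵀ * Y * g) := by
      calc _ = (gᵀ * g) * A * gᵀ * Y * g := by noncomm_ring
        _ = _ := by rw [hg']; noncomm_ring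
    have h3 (A : Matrix ι ι ℂ) : gᵀ * (Y * (g * A * gᵀ)) * g = (gᵀ * Y * g) * A := by
      calc _ = gᵀ * Y * g * A * (gᵀ * g) := by noncomm_ring
        _ = _ := by rw [hg']; noncomm_ring
    have := hR.lie_map (gᵀ * X * g) (gᵀ * Y * g)
    simp only [conjBy_apply, Ring.lie_def, h1, mul_sub, sub_mul, h2, h3] at this ⊢
    rw [← sub_mul, ← mul_sub, this]

section Chart

open Topology NormedSpace

variable {𝔸 : Type*} [NormedRing 𝔸] [NormedAlgebra ℂ 𝔸]

variable (𝔸) in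
/-- Left multiplication, as a continuous operator. -/
noncomputable def mulL : 𝔸 →L[ℂ] (𝔸 →L[ℂ] 𝔸) := ContinuousLinearMap.mul ℂ 𝔸

variable (𝔸) in
/-- Right multiplication, as a continuous operator. -/
noncomputable def mulR : 𝔸 →L[ℂ] (𝔸 →L[ℂ] 𝔸) := (ContinuousLinearMap.mul ℂ 𝔸).flip

lemma mulL_apply (a X : 𝔸) : mulL 𝔸 a X = a * X := rfl

lemma mulR_apply (a X : 𝔸) : mulR 𝔸 a X = X * a := rfl

variable (𝔸) in
/-- The commutator, as a continuous operator. -/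
noncomputable def adL : 𝔸 →L[ℂ] (𝔸 →L[ℂ] 𝔸) := mulL 𝔸 - mulR 𝔸

/-- The conjugation of operators by an exponential. -/
noncomputable def expAct (a : 𝔸) (S : 𝔸 →L[ℂ] 𝔸) : 𝔸 →L[ℂ] 𝔸 :=
  mulL 𝔸 (exp a) ∘L (mulR 𝔸 (exp (-a)) ∘L (S ∘L (mulL 𝔸 (exp (-a)) ∘L mulR 𝔸 (exp a))))

lemma expAct_apply (a : 𝔸) (S : 𝔸 →L[ℂ] 𝔸) (X : 𝔸) :
    expAct a S X = exp a * S (exp (-a) * X * exp a) * exp (-a) := by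
  simp [expAct, mulL_apply, mulR_apply, mul_assoc]

/-- The infinitesimal action on operators. -/
noncomputable def adAct (R : 𝔸 →L[ℂ] 𝔸) : 𝔸 →L[ℂ] (𝔸 →L[ℂ] 𝔸) :=
  ((ContinuousLinearMap.compL ℂ 𝔸 𝔸 𝔸).flip R - ContinuousLinearMap.compL ℂ 𝔸 𝔸 𝔸 R) ∘L adL 𝔸

lemma adAct_apply (R : 𝔸 →L[ℂ] 𝔸) (a X : 𝔸) : adAct R a X = ⁅a, R X⁆ - R ⁅a, X⁆ := rfl

/-- The product rule at the origin: the derivative adds an orbit direction and an arbitrary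
perturbation, as a slice argument needs. -/
lemma hasStrictFDerivAt_expAct [CompleteSpace 𝔸] (R : 𝔸 →L[ℂ] 𝔸) :
    HasStrictFDerivAt (fun p : 𝔸 × (𝔸 →L[ℂ] 𝔸) => expAct p.1 (R + p.2))
      (adAct R ∘L ContinuousLinearMap.fst ℂ _ _ + ContinuousLinearMap.snd ℂ _ _) 0 := by
  have h0 := hasStrictFDerivAt_exp_zero (𝕂 := ℂ) (𝔸 := 𝔸)
  have hexp : HasStrictFDerivAt (fun p : 𝔸 × (𝔸 →L[ℂ] 𝔸) => exp p.1)
      (ContinuousLinearMap.fst ℂ 𝔸 (𝔸 →L[ℂ] 𝔸)) 0 :=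
    HasStrictFDerivAt.comp (g := exp) (f := Prod.fst) (0 : 𝔸 × (𝔸 →L[ℂ] 𝔸)) h0
      hasStrictFDerivAt_fst
  have hexp' : HasStrictFDerivAt (fun p : 𝔸 × (𝔸 →L[ℂ] 𝔸) => exp (-p.1))
      (-ContinuousLinearMap.fst ℂ 𝔸 (𝔸 →L[ℂ] 𝔸)) 0 := by
    rw [← neg_zero] at h0
    exact HasStrictFDerivAt.comp (g := exp) (f := fun p : 𝔸 × (𝔸 →L[ℂ] 𝔸) => -p.1)
      (0 : 𝔸 × (𝔸 →L[ℂ] 𝔸)) h0 hasStrictFDerivAt_fst.neg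
  have h1 : HasStrictFDerivAt (fun p : 𝔸 × (𝔸 →L[ℂ] 𝔸) => mulL 𝔸 (exp p.1)) _ 0 :=
    (mulL 𝔸).hasStrictFDerivAt.comp _ hexp
  have h2 : HasStrictFDerivAt (fun p : 𝔸 × (𝔸 →L[ℂ] 𝔸) => mulR 𝔸 (exp (-p.1))) _ 0 :=
    (mulR 𝔸).hasStrictFDerivAt.comp _ hexp'
  have h3 : HasStrictFDerivAt (fun p : 𝔸 × (𝔸 →L[ℂ] 𝔸) => mulL 𝔸 (exp (-p.1))) _ 0 :=
    (mulL 𝔸).hasStrictFDerivAt.comp _ hexp'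
  have h4 : HasStrictFDerivAt (fun p : 𝔸 × (𝔸 →L[ℂ] 𝔸) => mulR 𝔸 (exp p.1)) _ 0 :=
    (mulR 𝔸).hasStrictFDerivAt.comp _ hexp
  have h5 : HasStrictFDerivAt (fun p : 𝔸 × (𝔸 →L[ℂ] 𝔸) => R + p.2)
      (ContinuousLinearMap.snd ℂ 𝔸 (𝔸 →L[ℂ] 𝔸)) 0 := hasStrictFDerivAt_snd.const_add R
  have h := h1.clm_comp (h2.clm_comp (h5.clm_comp (h3.clm_comp h4)))
  refine h.congr_fderiv ?_
  refine ContinuousLinearMap.ext fun p => ContinuousLinearMap.ext fun X => ?_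
  simp [mulL_apply, mulR_apply, adAct_apply, Ring.lie_def]
  abel

lemma expAct_neg_expAct [CompleteSpace 𝔸] (a : 𝔸) (S : 𝔸 →L[ℂ] 𝔸) :
    expAct (-a) (expAct a S) = S := by
  let _ : NormedAlgebra ℚ 𝔸 := NormedAlgebra.restrictScalars ℚ ℂ 𝔸
  have h1 : exp (-a) * exp a = 1 := by
    rw [← exp_add_of_commute (Commute.neg_left (Commute.refl a))]; simp
  have h2 : exp a * exp (-a) = 1 := by
    rw [← exp_add_of_commute (Commute.neg_right (Commute.refl a))]; simp
  ext X
  rw [expAct_apply, expAct_apply, neg_neg]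
  have h3 : exp (-a) * (exp a * X * exp (-a)) * exp a = X := by
    calc _ = (exp (-a) * exp a) * X * (exp (-a) * exp a) := by noncomm_ring
      _ = X := by simp [h1]
  rw [h3]
  calc _ = (exp (-a) * exp a) * S X * (exp (-a) * exp a) := by noncomm_ring
    _ = S X := by simp [h1]

/-- The linearisation at `R` of the quadratic equation `⁅S A, S B⁆ = S ⁅S A, B⁆`. -/
noncomputable def linEq (R c : 𝔸 →L[ℂ] 𝔸) : 𝔸 →L[ℂ] 𝔸 →L[ℂ] 𝔸 :=
  (adL 𝔸).bilinearComp c R + (adL 𝔸).bilinearComp R c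
    - ContinuousLinearMap.compL ℂ 𝔸 𝔸 𝔸 c ∘L adL 𝔸 ∘L R
    - ContinuousLinearMap.compL ℂ 𝔸 𝔸 𝔸 R ∘L adL 𝔸 ∘L c

lemma linEq_apply (R c : 𝔸 →L[ℂ] 𝔸) (A B : 𝔸) :
    linEq R c A B = ⁅c A, R B⁆ + ⁅R A, c B⁆ - c ⁅R A, B⁆ - R ⁅c A, B⁆ := rfl

lemma linEq_add (R c d : 𝔸 →L[ℂ] 𝔸) : linEq R (c + d) = linEq R c + linEq R d := by
  ext A B
  simp only [linEq_apply, _root_.add_apply, Ring.lie_def, mul_add, add_mul, map_sub, map_add]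
  noncomm_ring

lemma linEq_smul (t : ℂ) (R c : 𝔸 →L[ℂ] 𝔸) : linEq R (t • c) = t • linEq R c := by
  ext A B
  simp only [linEq_apply, _root_.smul_apply, Ring.lie_def, mul_smul_comm, smul_mul_assoc, map_sub,
    map_smul, smul_add, smul_sub]

/-- The equation is quadratic, so subtracting its instances at R and R + c leaves linEq R c A B =
c⁅cA, B⁆ - ⁅cA, cB⁆, each term bounded by 2‖c‖²‖A‖‖B‖. -/
lemma norm_linEq_le (R c : 𝔸 →L[ℂ] 𝔸) (hR : ∀ A B, ⁅R A, R B⁆ = R ⁅R A, B⁆)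
    (hc : ∀ A B, ⁅(R + c) A, (R + c) B⁆ = (R + c) ⁅(R + c) A, B⁆) :
    ‖linEq R c‖ ≤ 4 * ‖c‖ * ‖c‖ := by
  have hlie (A B : 𝔸) : ‖⁅A, B⁆‖ ≤ 2 * ‖A‖ * ‖B‖ := by
    rw [Ring.lie_def]
    calc _ ≤ ‖A * B‖ + ‖B * A‖ := norm_sub_le _ _
      _ ≤ ‖A‖ * ‖B‖ + ‖B‖ * ‖A‖ := add_le_add (norm_mul_le _ _) (norm_mul_le _ _)
      _ = _ := by ring
  refine ContinuousLinearMap.opNorm_le_bound₂ _ (by positivity) fun A B => ?_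
  have h1 : linEq R c A B = c ⁅c A, B⁆ - ⁅c A, c B⁆ := by
    have h2 := hc A B
    have h3 := hR A B
    simp only [_root_.add_apply, Ring.lie_def, map_add, map_sub, mul_add, add_mul]
      at h2 h3
    simp only [linEq_apply, Ring.lie_def, map_sub]
    have h4 := congr_arg₂ (· - ·) h2 h3
    rw [← sub_eq_zero] at h4 ⊢
    rw [← h4]
    noncomm_ring
  rw [h1]
  have hA := c.le_opNorm A
  have hB := c.le_opNorm B
  have h0 := norm_nonneg c
  calc _ ≤ ‖c ⁅c A, B⁆‖ + ‖⁅c A, c B⁆‖ := norm_sub_le _ _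
    _ ≤ ‖c‖ * (2 * (‖c‖ * ‖A‖) * ‖B‖) + 2 * (‖c‖ * ‖A‖) * (‖c‖ * ‖B‖) := by
      gcongr
      · refine (c.le_opNorm _).trans ?_
        gcongr
        exact (hlie _ _).trans (by gcongr)
      · exact (hlie _ _).trans (by gcongr)
    _ = _ := by ring

lemma exists_norm_le_of_injOn {E F : Type*} [NormedAddCommGroup E] [NormedSpace ℂ E]
    [NormedAddCommGroup F] [NormedSpace ℂ F] [FiniteDimensional ℂ E] {C : Submodule ℂ E}
    {f : E → F} (hadd : ∀ c d, f (c + d) = f c + f d) (hsmul : ∀ (t : ℂ) c, f (t • c) = t • f c)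
    (hf : ∀ c ∈ C, f c = 0 → c = 0) : ∃ K : NNReal, 0 < K ∧ ∀ c ∈ C, ‖c‖ ≤ K * ‖f c‖ := by
  let f' : E →ₗ[ℂ] F := ⟨⟨f, hadd⟩, hsmul⟩
  have hker : LinearMap.ker (f' ∘ₗ C.subtype) = ⊥ := by
    rw [LinearMap.ker_eq_bot']
    rintro ⟨c, hc⟩ h
    exact Subtype.ext (hf c hc h)
  obtain ⟨K, hK0, hK⟩ := (f' ∘ₗ C.subtype).exists_antilipschitzWith hker
  refine ⟨K, hK0, fun c hc => ?_⟩
  have := hK.le_mul_norm_sub (x := ⟨c, hc⟩) (y := 0)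
  have h0 : f 0 = 0 := f'.map_zero
  simpa [f', h0] using this

/-- A local surjectivity statement for slices. -/
lemma eventually_exists_slice {E F : Type*} [NormedAddCommGroup E] [NormedSpace ℂ E]
    [NormedAddCommGroup F] [NormedSpace ℂ F] [FiniteDimensional ℂ E] [FiniteDimensional ℂ F]
    {Φ : E × F → F} {D : E →L[ℂ] F}
    (hΦ : HasStrictFDerivAt Φ (D ∘L ContinuousLinearMap.fst ℂ E F + ContinuousLinearMap.snd ℂ E F) 0)
    {L : Submodule ℂ E} {C : Submodule ℂ F} (hC : ∀ T, ∃ a ∈ L, ∃ c ∈ C, D a + c = T) {ε : ℝ}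
    (hε : 0 < ε) : ∀ᶠ S in 𝓝 (Φ 0), ∃ a ∈ L, ∃ c ∈ C, ‖c‖ < ε ∧ Φ (a, c) = S := by
  have : CompleteSpace L := FiniteDimensional.complete ℂ L
  have : CompleteSpace C := FiniteDimensional.complete ℂ C
  have : CompleteSpace F := FiniteDimensional.complete ℂ F
  let ψ : (L × C) →L[ℂ] E × F := L.subtypeL.prodMap C.subtypeL
  rw [← map_zero ψ] at hΦ
  have hF' := hΦ.comp (0 : L × C) ψ.hasStrictFDerivAt
  have hsurj : ((D ∘L ContinuousLinearMap.fst ℂ E F + ContinuousLinearMap.snd ℂ E F) ∘L ψ :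
      (L × C) →L[ℂ] F).range = ⊤ := by
    rw [eq_top_iff]
    intro T _
    obtain ⟨a, ha, c, hc, rfl⟩ := hC T
    exact ⟨(⟨a, ha⟩, ⟨c, hc⟩), rfl⟩
  -- A strictly differentiable map with surjective derivative is open at the point, so values near Φ
  -- 0 come from parameters near 0.
  have hmap := hF'.map_nhds_eq_of_surj hsurj
  rw [map_zero] at hmap
  have hnear : ∀ᶠ p : L × C in 𝓝 0, ‖(p.2 : F)‖ < ε := by
    have hcont : Continuous fun p : L × C => ‖(p.2 : F)‖ := by fun_prop
    have := hcont.tendsto 0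
    simp only [Prod.snd_zero, ZeroMemClass.coe_zero, norm_zero] at this
    exact this.eventually_lt_const hε
  rw [← hmap]
  refine Filter.eventually_map.mpr ?_
  filter_upwards [hnear] with p hp
  exact ⟨p.1, p.1.2, p.2, p.2.2, hp, rfl⟩

/-- Near an infinitesimally rigid point, a stable set of solutions of the quadratic equation is
contained in one orbit. -/
lemma eventually_exists_expAct [FiniteDimensional ℂ 𝔸] {L : Submodule ℂ 𝔸}
    {W : Submodule ℂ (𝔸 →L[ℂ] 𝔸)} {Z : Set (𝔸 →L[ℂ] 𝔸)} {R : 𝔸 →L[ℂ] 𝔸} (hRZ : R ∈ Z)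
    (hW : ∀ S ∈ Z, S - R ∈ W) (hquad : ∀ S ∈ Z, ∀ A B, ⁅S A, S B⁆ = S ⁅S A, B⁆)
    (hstab : ∀ a ∈ L, ∀ S ∈ Z, expAct a S ∈ Z)
    (hrig : ∀ c ∈ W, linEq R c = 0 → ∃ a ∈ L, adAct R a = c) :
    ∀ᶠ S in 𝓝 R, S ∈ Z → ∃ a ∈ L, S = expAct a R := by
  have : CompleteSpace 𝔸 := FiniteDimensional.complete ℂ 𝔸
  obtain ⟨C, hC⟩ := Submodule.exists_isCompl (L.map (adAct R : 𝔸 →ₗ[ℂ] (𝔸 →L[ℂ] 𝔸)))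
  have hC' : ∀ T, ∃ a ∈ L, ∃ c ∈ C, adAct R a + c = T := by
    intro T
    have hT : T ∈ L.map (adAct R : 𝔸 →ₗ[ℂ] (𝔸 →L[ℂ] 𝔸)) ⊔ C := by
      rw [hC.sup_eq_top]; trivial
    obtain ⟨_, ⟨a, ha, rfl⟩, c, hc, rfl⟩ := Submodule.mem_sup.mp hT
    exact ⟨a, ha, c, hc, rfl⟩
  -- By rigidity the kernel of the linearisation in W is tangent to the orbit, hence meets the
  -- complement C trivially; finite dimension gives a lower bound.
  obtain ⟨K, hK0, hK⟩ : ∃ K : NNReal, 0 < K ∧ ∀ c ∈ C ⊓ W, ‖c‖ ≤ K * ‖linEq R c‖ := by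
    refine exists_norm_le_of_injOn (E := 𝔸 →L[ℂ] 𝔸) (F := 𝔸 →L[ℂ] 𝔸 →L[ℂ] 𝔸)
      (linEq_add R) (fun t c => linEq_smul t R c) fun c hcW hc => ?_
    obtain ⟨a, ha, hac⟩ := hrig c hcW.2 hc
    have : c ∈ L.map (adAct R : 𝔸 →ₗ[ℂ] (𝔸 →L[ℂ] 𝔸)) ⊓ C := ⟨⟨a, ha, hac⟩, hcW.1⟩
    rw [hC.inf_eq_bot] at this
    exact this
  have hK0' : (0 : ℝ) < K := hK0
  have hslice := eventually_exists_slice (hasStrictFDerivAt_expAct R) hC'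
    (ε := 1 / (4 * K)) (by positivity)
  have h0 : expAct (0 : 𝔸 × (𝔸 →L[ℂ] 𝔸)).1 (R + (0 : 𝔸 × (𝔸 →L[ℂ] 𝔸)).2) = R := by
    ext X
    simp [expAct_apply]
  rw [h0] at hslice
  filter_upwards [hslice]
  rintro S ⟨a, ha, c, hc, hp, rfl⟩ hpZ
  change ∃ b ∈ L, expAct a (R + c) = expAct b R
  refine ⟨a, ha, ?_⟩
  have hRc : R + c ∈ Z := by
    have := hstab (-a) (neg_mem ha) _ hpZ
    rwa [expAct_neg_expAct] at this
  have hcW : c ∈ W := by simpa using hW _ hRc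
  have hle := norm_linEq_le R c (hquad R hRZ) (hquad _ hRc)
  have hge : ‖c‖ ≤ K * ‖linEq R c‖ := hK c ⟨hc, hcW⟩
  -- A nonzero c would satisfy ‖c‖ ≤ 4K‖c‖², which the size 1/(4K) of the slice excludes.
  have hc0 : c = 0 := by
    by_contra hne
    have hpos : 0 < ‖c‖ := norm_pos_iff.mpr hne
    have h1 : ‖c‖ ≤ K * (4 * ‖c‖ * ‖c‖) := hge.trans (by gcongr)
    have h2 : ‖c‖ * (4 * K) < 1 := (lt_div_iff₀ (by positivity)).mp hp
    nlinarith
  rw [hc0, add_zero]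

end Chart

end CurvatureOperator

/-! ### Complex conjugation and vanishing of the moment map -/

namespace CurvatureOperator

attribute [local instance] LieRing.ofAssociativeRing
set_option linter.unusedSectionVars false

open Matrix Topology

variable {ι : Type*} [Fintype ι] [DecidableEq ι]

/-- Entrywise complex conjugation of matrices. -/
noncomputable def cj (X : Matrix ι ι ℂ) : Matrix ι ι ℂ := X.map (starRingEnd ℂ)

lemma cj_apply (X : Matrix ι ι ℂ) (i j : ι) : cj X i j = conj (X i j) := rfl

lemma cj_cj (X : Matrix ι ι ℂ) : cj (cj X) = X := by ext; simp [cj_apply]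

lemma cj_add (X Y : Matrix ι ι ℂ) : cj (X + Y) = cj X + cj Y := by ext; simp [cj_apply]

lemma cj_sub (X Y : Matrix ι ι ℂ) : cj (X - Y) = cj X - cj Y := by ext; simp [cj_apply]

lemma cj_neg (X : Matrix ι ι ℂ) : cj (-X) = -cj X := by ext; simp [cj_apply]

lemma cj_smul (t : ℂ) (X : Matrix ι ι ℂ) : cj (t • X) = conj t • cj X := by ext; simp [cj_apply]

lemma cj_mul (X Y : Matrix ι ι ℂ) : cj (X * Y) = cj X * cj Y := Matrix.map_mul

lemma cj_lie (X Y : Matrix ι ι ℂ) : cj ⁅X, Y⁆ = ⁅cj X, cj Y⁆ := by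
  simp [Ring.lie_def, cj_sub, cj_mul]

lemma cj_transpose (X : Matrix ι ι ℂ) : cj Xᵀ = (cj X)ᵀ := rfl

lemma cj_unit (p : ι × ι) : cj (unit p) = unit p := by
  ext i j
  simp only [cj_apply, unit_apply]
  split_ifs <;> simp

/-- The complex conjugate of an operator on matrices. -/
noncomputable def conjOp (R : Matrix ι ι ℂ →ₗ[ℂ] Matrix ι ι ℂ) :
    Matrix ι ι ℂ →ₗ[ℂ] Matrix ι ι ℂ where
  toFun X := cj (R (cj X))
  map_add' X Y := by simp [cj_add]
  map_smul' t X := by simp [cj_smul]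

lemma conjOp_apply (R : Matrix ι ι ℂ →ₗ[ℂ] Matrix ι ι ℂ) (X : Matrix ι ι ℂ) :
    conjOp R X = cj (R (cj X)) := rfl

lemma IsFourForm.conjOp {c : Matrix ι ι ℂ →ₗ[ℂ] Matrix ι ι ℂ} (hc : IsFourForm c) :
    IsFourForm (conjOp c) where
  map_transpose X := by
    rw [conjOp_apply, conjOp_apply, cj_transpose, hc.map_transpose, cj_neg]
  transpose_map X := by
    rw [conjOp_apply, ← cj_transpose, hc.transpose_map, cj_neg]
  cyclic w u v := by
    have h1 (w u : ι → ℂ) : cj (vecMulVec w u) = vecMulVec (star w) (star u) := by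
      ext i j
      simp [cj_apply, vecMulVec_apply]
    have h2 (X : Matrix ι ι ℂ) (v : ι → ℂ) : cj X *ᵥ v = star (X *ᵥ star v) := by
      ext i
      simp [mulVec, dotProduct, cj_apply]
    rw [conjOp_apply, conjOp_apply, h1, h1, h2, h2, ← star_add, hc.cyclic, star_zero]

lemma conjOp_constOp : conjOp (constOp ι) = constOp ι := by
  ext1 X
  have h : conj (1 / 2 : ℂ) = 1 / 2 := by rw [map_div₀, map_one, map_ofNat]
  rw [conjOp_apply, constOp_apply, constOp_apply, cj_smul, cj_sub, cj_transpose, cj_cj, h]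

/-- An admissible operator whose range is stable under conjugation is real. -/
lemma IsAdmissible.conjOp_eq {R : Matrix ι ι ℂ →ₗ[ℂ] Matrix ι ι ℂ} (hR : IsAdmissible R)
    (hn : Fintype.card ι ≠ 4) (h : ∀ X, cj (R X) ∈ LinearMap.range R) : conjOp R = R := by
  have hf : IsFourForm (conjOp R - R) := by
    have h1 := hR.fourForm.conjOp.sub hR.fourForm
    convert h1 using 1
    nth_rewrite 2 [← conjOp_constOp]
    ext1 X
    simp only [LinearMap.sub_apply, conjOp_apply, cj_sub]
    abel
  -- Conjugating the admissibility relation makes `conjOp R` equivariant under the conjugate range,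
  -- which is the range of R. Its difference from R is thus an equivariant four-form with values in
  -- the range.
  have h0 := hR.eq_zero_of_range_le hn hf
    (fun X => sub_mem (h _) ⟨X, rfl⟩) (fun X Y => by
      obtain ⟨Z, hZ⟩ := h Y
      have h2 : R Y = cj (R Z) := by rw [hZ, cj_cj]
      have h3 : ⁅R Y, conjOp R X⁆ = conjOp R ⁅R Y, X⁆ := by
        rw [conjOp_apply, conjOp_apply, h2, cj_lie, cj_cj, ← hR.lie_map, cj_lie]
      rw [LinearMap.sub_apply, LinearMap.sub_apply, lie_sub, h3, hR.lie_map])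
  exact sub_eq_zero.mp h0

/-- The Hilbert-Schmidt pairing of operators on matrices. -/
noncomputable def hsPairing (S T : Matrix ι ι ℂ →ₗ[ℂ] Matrix ι ι ℂ) : ℂ :=
  ∑ p : ι × ι, trace ((S (unit p))ᴴ * T (unit p))

/-- The infinitesimal action of a matrix on operators. -/
noncomputable def adOp (a : Matrix ι ι ℂ) (R : Matrix ι ι ℂ →ₗ[ℂ] Matrix ι ι ℂ) :
    Matrix ι ι ℂ →ₗ[ℂ] Matrix ι ι ℂ :=
  LieAlgebra.ad ℂ (Matrix ι ι ℂ) a ∘ₗ R - R ∘ₗ LieAlgebra.ad ℂ (Matrix ι ι ℂ) a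

lemma adOp_apply (a : Matrix ι ι ℂ) (R : Matrix ι ι ℂ →ₗ[ℂ] Matrix ι ι ℂ) (X : Matrix ι ι ℂ) :
    adOp a R X = ⁅a, R X⁆ - R ⁅a, X⁆ := rfl

lemma adOp_adOp (a b : Matrix ι ι ℂ) (R : Matrix ι ι ℂ →ₗ[ℂ] Matrix ι ι ℂ) :
    adOp a (adOp b R) = adOp ⁅a, b⁆ R + adOp b (adOp a R) := by
  ext1 X
  simp only [adOp_apply, LinearMap.add_apply, Ring.lie_def, mul_sub, sub_mul, map_sub, mul_assoc]
  abel

/-- For skew `a` the conjugate transpose of `cj a` is -a, so the two infinitesimal actions are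
adjoint up to sign for the Hilbert-Schmidt product. -/
lemma hsPairing_adOp {a : Matrix ι ι ℂ} (ha : aᵀ = -a) (S T : Matrix ι ι ℂ →ₗ[ℂ] Matrix ι ι ℂ) :
    hsPairing (adOp (cj a) S) T = -hsPairing S (adOp a T) := by
  have haH : (cj a)ᴴ = -a := by
    rw [← ha]; ext i j; simp [cj_apply]
  have h1 (X Y : Matrix ι ι ℂ) : trace (⁅cj a, X⁆ᴴ * Y) = -trace (Xᴴ * ⁅a, Y⁆) := by
    have : trace (Xᴴ * (Y * a)) = trace (a * (Xᴴ * Y)) := by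
      rw [Matrix.trace_mul_comm a, mul_assoc]
    simp only [Ring.lie_def, conjTranspose_sub, conjTranspose_mul, haH, sub_mul, mul_sub, neg_sub,
      trace_sub, mul_neg, neg_mul, trace_neg, mul_assoc, this]
    ring
  have h2 : ∑ p : ι × ι, trace ((S ⁅cj a, unit p⁆)ᴴ * T (unit p))
      = -∑ p : ι × ι, trace ((S (unit p))ᴴ * T ⁅a, unit p⁆) := by
    have hsk (p q : ι × ι) : ⁅a, unit p⁆ q.1 q.2 = -⁅a, unit q⁆ p.1 p.2 := by
      rw [← trace_transpose_unit ⁅a, unit p⁆, trace_ad_skew ha, mul_neg, trace_neg,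
        trace_unit_transpose]
    have e1 (p : ι × ι) : trace ((S ⁅cj a, unit p⁆)ᴴ * T (unit p))
        = ∑ q : ι × ι, ⁅a, unit p⁆ q.1 q.2 * trace ((S (unit q))ᴴ * T (unit p)) := by
      have : ⁅cj a, unit p⁆ = cj ⁅a, unit p⁆ := by rw [cj_lie, cj_unit]
      rw [this]
      conv_lhs => rw [sum_unit (cj ⁅a, unit p⁆)]
      simp [map_sum, Matrix.conjTranspose_sum, Finset.sum_mul, trace_sum, cj_apply]
    have e2 (p : ι × ι) : trace ((S (unit p))ᴴ * T ⁅a, unit p⁆)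
        = ∑ q : ι × ι, ⁅a, unit p⁆ q.1 q.2 * trace ((S (unit p))ᴴ * T (unit q)) := by
      conv_lhs => rw [sum_unit ⁅a, unit p⁆]
      simp [map_sum, Finset.mul_sum, trace_sum]
    simp only [e1, e2]
    rw [Finset.sum_comm, ← Finset.sum_neg_distrib]
    refine Finset.sum_congr rfl fun p _ => ?_
    rw [← Finset.sum_neg_distrib]
    refine Finset.sum_congr rfl fun q _ => ?_
    rw [hsk q p]; ring
  simp only [hsPairing, adOp_apply, conjTranspose_sub, sub_mul, mul_sub, trace_sub,
    Finset.sum_sub_distrib, h1, h2, Finset.sum_neg_distrib]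
  ring

/-- An admissible operator at which the moment map of the orthogonal group vanishes is real. -/
lemma IsAdmissible.conjOp_eq_of_moment {R : Matrix ι ι ℂ →ₗ[ℂ] Matrix ι ι ℂ} (hR : IsAdmissible R)
    (hn : Fintype.card ι ≠ 4) (h : ∀ a : Matrix ι ι ℂ, aᵀ = -a → hsPairing R (adOp a R) = 0) :
    conjOp R = R := by
  refine hR.conjOp_eq hn fun X => ?_
  set a := R X with ha
  have haT : aᵀ = -a := hR.transpose_map X
  have hbT : (cj a)ᵀ = -cj a := by rw [← cj_transpose, haT, cj_neg]
  have h1 : adOp a R = 0 := by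
    ext1 Y
    rw [adOp_apply, ha, hR.lie_map, sub_self, LinearMap.zero_apply]
  -- Since `a` lies in the range it annihilates R. The squared norm of the action of its conjugate
  -- therefore reduces to the moment map at the commutator ⁅a, cj a⁆.
  have h2 : hsPairing (adOp (cj a) R) (adOp (cj a) R) = 0 := by
    rw [hsPairing_adOp haT, adOp_adOp, h1]
    have h3 : (⁅a, cj a⁆)ᵀ = -⁅a, cj a⁆ := by
      simp only [Ring.lie_def, transpose_sub, transpose_mul, haT, hbT]
      noncomm_ring
    have h4 : adOp (cj a) (0 : Matrix ι ι ℂ →ₗ[ℂ] Matrix ι ι ℂ) = 0 := by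
      ext1 Y; simp [adOp_apply]
    rw [h4, add_zero, h _ h3, neg_zero]
  have h5 : ∀ p : ι × ι, adOp (cj a) R (unit p) = 0 := by
    have hnn (M : Matrix ι ι ℂ) : trace (Mᴴ * M) = ((∑ i, ∑ j, ‖M j i‖ ^ 2 : ℝ) : ℂ) := by
      simp [trace, mul_apply, Complex.conj_mul']
    simp only [hsPairing, hnn] at h2
    have h6 : ∑ p : ι × ι, ∑ i, ∑ j, ‖adOp (cj a) R (unit p) j i‖ ^ 2 = 0 := by
      exact_mod_cast h2
    intro p
    rw [Finset.sum_eq_zero_iff_of_nonneg (fun p _ => by positivity)] at h6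
    have h7 := h6 p (Finset.mem_univ _)
    rw [Finset.sum_eq_zero_iff_of_nonneg (fun p _ => by positivity)] at h7
    ext j i
    have h8 := h7 i (Finset.mem_univ _)
    rw [Finset.sum_eq_zero_iff_of_nonneg (fun p _ => by positivity)] at h8
    simpa using h8 j (Finset.mem_univ _)
  -- A skew matrix annihilating R normalizes its range, hence lies in it.
  refine hR.mem_range_of_lie_mem hn hbT fun Y => ?_
  have h6 : adOp (cj a) R Y = 0 := by
    rw [sum_unit Y]; simp [h5]
  rw [adOp_apply, sub_eq_zero] at h6
  exact ⟨_, h6.symm⟩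

end CurvatureOperator

/-! ### Rigidity of admissible operators -/

namespace CurvatureOperator

attribute [local instance] LieRing.ofAssociativeRing
set_option linter.unusedSectionVars false

open Matrix Topology NormedSpace

variable {ι : Type*} [Fintype ι] [DecidableEq ι]
variable {𝔸 : Type*} [NormedRing 𝔸] [NormedAlgebra ℂ 𝔸] [FiniteDimensional ℂ 𝔸]

/-- Operators on matrices, seen on a normed algebra isomorphic to the matrix algebra. -/
noncomputable def opEquiv (τ : Matrix ι ι ℂ ≃ₐ[ℂ] 𝔸) :
    (Matrix ι ι ℂ →ₗ[ℂ] Matrix ι ι ℂ) ≃ₗ[ℂ] (𝔸 →L[ℂ] 𝔸) :=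
  τ.toLinearEquiv.conj ≪≫ₗ LinearMap.toContinuousLinearMap

lemma opEquiv_apply (τ : Matrix ι ι ℂ ≃ₐ[ℂ] 𝔸) (R : Matrix ι ι ℂ →ₗ[ℂ] Matrix ι ι ℂ) (A : 𝔸) :
    opEquiv τ R A = τ (R (τ.symm A)) := rfl

lemma opEquiv_symm_apply (τ : Matrix ι ι ℂ ≃ₐ[ℂ] 𝔸) (S : 𝔸 →L[ℂ] 𝔸) (X : Matrix ι ι ℂ) :
    (opEquiv τ).symm S X = τ.symm (S (τ X)) := rfl

lemma opEquiv_symm_adAct (τ : Matrix ι ι ℂ ≃ₐ[ℂ] 𝔸) (S : 𝔸 →L[ℂ] 𝔸) (a : Matrix ι ι ℂ) :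
    (opEquiv τ).symm (adAct S (τ a)) = adOp a ((opEquiv τ).symm S) := by
  ext1 X
  simp only [opEquiv_symm_apply, adAct_apply, adOp_apply, Ring.lie_def, map_sub, map_mul,
    AlgEquiv.symm_apply_apply]

/-- Transposition is an algebra morphism to the opposite algebra, so it commutes with the
exponential. -/
lemma transpose_symm_exp (τ : Matrix ι ι ℂ ≃ₐ[ℂ] 𝔸) {a : 𝔸} (ha : (τ.symm a)ᵀ = -τ.symm a) :
    (τ.symm (exp a))ᵀ = τ.symm (exp (-a)) := by
  let _ : NormedAlgebra ℚ 𝔸 := NormedAlgebra.restrictScalars ℚ ℂ 𝔸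
  have : CompleteSpace 𝔸 := FiniteDimensional.complete ℂ 𝔸
  let t : 𝔸 →ₐ[ℂ] 𝔸ᵐᵒᵖ := (AlgEquiv.op τ).toAlgHom.comp
    ((Matrix.transposeAlgEquiv ι ℂ ℂ).toAlgHom.comp τ.symm.toAlgHom)
  have ht (A : 𝔸) : (t A).unop = τ (τ.symm A)ᵀ := rfl
  have h := map_exp t (t.toLinearMap.continuous_of_finiteDimensional) a
  have h2 : t a = MulOpposite.op (-a) := by
    apply MulOpposite.unop_injective
    rw [ht, ha]; simp
  rw [h2, exp_op] at h
  have h3 := congr_arg MulOpposite.unop h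
  rw [ht] at h3
  have h4 := congr_arg τ.symm h3
  simpa using h4

lemma symm_exp_mul_transpose (τ : Matrix ι ι ℂ ≃ₐ[ℂ] 𝔸) {a : 𝔸} (ha : (τ.symm a)ᵀ = -τ.symm a) :
    τ.symm (exp a) * (τ.symm (exp a))ᵀ = 1 := by
  let _ : NormedAlgebra ℚ 𝔸 := NormedAlgebra.restrictScalars ℚ ℂ 𝔸
  have : CompleteSpace 𝔸 := FiniteDimensional.complete ℂ 𝔸
  rw [transpose_symm_exp τ ha, ← map_mul,
    ← exp_add_of_commute (Commute.neg_right (Commute.refl a))]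
  simp

lemma expAct_opEquiv (τ : Matrix ι ι ℂ ≃ₐ[ℂ] 𝔸) {a : 𝔸} (ha : (τ.symm a)ᵀ = -τ.symm a)
    (R : Matrix ι ι ℂ →ₗ[ℂ] Matrix ι ι ℂ) :
    expAct a (opEquiv τ R) = opEquiv τ (conjBy (τ.symm (exp a)) R) := by
  ext A
  rw [expAct_apply, opEquiv_apply, opEquiv_apply, conjBy_apply, transpose_symm_exp τ ha]
  simp

lemma isClosed_isAdmissible (τ : Matrix ι ι ℂ ≃ₐ[ℂ] 𝔸) :
    IsClosed {S : 𝔸 →L[ℂ] 𝔸 | IsAdmissible ((opEquiv τ).symm S)} := by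
  have hev (X : Matrix ι ι ℂ) : Continuous fun S : 𝔸 →L[ℂ] 𝔸 => (opEquiv τ).symm S X := by
    simp only [opEquiv_symm_apply]
    have h1 : Continuous τ.symm := τ.symm.toLinearMap.continuous_of_finiteDimensional
    fun_prop
  have hset : {S : 𝔸 →L[ℂ] 𝔸 | IsAdmissible ((opEquiv τ).symm S)} =
      (⋂ X, {S | (opEquiv τ).symm S Xᵀ - constOp ι Xᵀ = -((opEquiv τ).symm S X - constOp ι X)}) ∩
      (⋂ X, {S | ((opEquiv τ).symm S X - constOp ι X)ᵀ = -((opEquiv τ).symm S X - constOp ι X)}) ∩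
      (⋂ w, ⋂ u, ⋂ v, {S | ((opEquiv τ).symm S (vecMulVec w u) - constOp ι (vecMulVec w u)) *ᵥ v +
        ((opEquiv τ).symm S (vecMulVec w v) - constOp ι (vecMulVec w v)) *ᵥ u = 0}) ∩
      (⋂ A, ⋂ B, {S | S A * S B - S B * S A = S (S A * B - B * S A)}) := by
    ext S
    simp only [Set.mem_inter_iff, Set.mem_iInter, Set.mem_ofPred_eq]
    constructor
    · intro h
      refine ⟨⟨⟨h.1.1, h.1.2⟩, h.1.3⟩, fun A B => ?_⟩
      have := congr_arg τ (h.2 (τ.symm A) (τ.symm B))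
      simpa [opEquiv_symm_apply, Ring.lie_def] using this
    · rintro ⟨⟨⟨h1, h2⟩, h3⟩, h4⟩
      refine ⟨⟨h1, h2, h3⟩, fun X Y => ?_⟩
      have := congr_arg τ.symm (h4 (τ X) (τ Y))
      simpa [opEquiv_symm_apply, Ring.lie_def] using this
  rw [hset]
  refine ((IsClosed.inter ?_ ?_).inter ?_).inter ?_
  · exact isClosed_iInter fun X => isClosed_eq (by fun_prop) (by fun_prop)
  · exact isClosed_iInter fun X => isClosed_eq (by fun_prop) (by fun_prop)
  · exact isClosed_iInter fun w => isClosed_iInter fun u => isClosed_iInter fun v =>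
      isClosed_eq (by fun_prop) (by fun_prop)
  · exact isClosed_iInter fun X => isClosed_iInter fun Y => isClosed_eq (by fun_prop) (by fun_prop)

/-- Rigidity: admissible operators near a given one lie on its orbit. -/
lemma IsAdmissible.eventually_exists_conjBy (τ : Matrix ι ι ℂ ≃ₐ[ℂ] 𝔸)
    {R : Matrix ι ι ℂ →ₗ[ℂ] Matrix ι ι ℂ} (hR : IsAdmissible R) (hn : Fintype.card ι ≠ 4) :
    ∀ᶠ S in 𝓝 (opEquiv τ R), IsAdmissible ((opEquiv τ).symm S) →
      ∃ g : Matrix ι ι ℂ, g * gᵀ = 1 ∧ (opEquiv τ).symm S = CurvatureOperator.conjBy g R := by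
  -- L is the complex orthogonal Lie algebra, and W the space of four-forms, where differences of
  -- admissible operators live.
  let L : Submodule ℂ 𝔸 :=
    { carrier := {a | (τ.symm a)ᵀ = -τ.symm a}
      add_mem' := fun {a b} ha hb => by
        have ha' : (τ.symm a)ᵀ = -τ.symm a := ha
        have hb' : (τ.symm b)ᵀ = -τ.symm b := hb
        simp [ha', hb', add_comm]
      zero_mem' := by simp
      smul_mem' := fun t a ha => by
        have ha' : (τ.symm a)ᵀ = -τ.symm a := ha
        simp [ha'] }
  let W : Submodule ℂ (𝔸 →L[ℂ] 𝔸) :=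
    { carrier := {c | IsFourForm ((opEquiv τ).symm c)}
      add_mem' := fun {a b} ha hb => by
        change IsFourForm _
        rw [map_add]
        exact IsFourForm.add ha hb
      zero_mem' := by
        change IsFourForm _
        rw [map_zero]
        exact IsFourForm.zero
      smul_mem' := fun t a ha => by
        change IsFourForm _
        rw [map_smul]
        exact IsFourForm.smul t ha }
  have h := eventually_exists_expAct (L := L) (W := W)
    (Z := {S | IsAdmissible ((opEquiv τ).symm S)}) (R := opEquiv τ R)
    (by simpa using hR)
    (fun S hS => by
      change IsFourForm _
      have h1 := IsFourForm.sub (IsAdmissible.fourForm hS) hR.fourForm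
      rw [map_sub, LinearEquiv.symm_apply_apply]
      simpa using h1)
    (fun S hS A B => by
      have := congr_arg τ (IsAdmissible.lie_map hS (τ.symm A) (τ.symm B))
      simpa [opEquiv_symm_apply, Ring.lie_def] using this)
    (fun a ha S hS => by
      change IsAdmissible _
      have h1 := expAct_opEquiv τ ha ((opEquiv τ).symm S)
      rw [LinearEquiv.apply_symm_apply] at h1
      rw [h1, LinearEquiv.symm_apply_apply]
      exact IsAdmissible.conjBy hS (symm_exp_mul_transpose τ ha))
    (fun c hc hlin => by
      obtain ⟨a, ha, h1⟩ := hR.exists_eq_ad hn hc (fun X Y => by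
        have h2 := congr_arg τ.symm
          (DFunLike.congr_fun (DFunLike.congr_fun hlin (τ X)) (τ Y))
        simp only [linEq_apply, opEquiv_apply, Ring.lie_def, map_sub, map_add, map_mul,
          AlgEquiv.symm_apply_apply, _root_.zero_apply, map_zero] at h2
        simp only [opEquiv_symm_apply, Ring.lie_def, map_sub, map_mul]
        rw [← sub_eq_zero, ← h2]
        abel)
      refine ⟨τ a, by change _ = _; simpa using ha, ?_⟩
      apply (opEquiv τ).symm.injective
      rw [opEquiv_symm_adAct, LinearEquiv.symm_apply_apply]
      ext1 X
      rw [adOp_apply, h1])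
  filter_upwards [h] with S hS hSad
  obtain ⟨a, ha, h1⟩ := hS hSad
  refine ⟨τ.symm (exp a), symm_exp_mul_transpose τ ha, ?_⟩
  rw [h1, expAct_opEquiv τ ha, LinearEquiv.symm_apply_apply]

end CurvatureOperator

/-! ### A real point on each orbit, by norm minimization -/

namespace CurvatureOperator

attribute [local instance] LieRing.ofAssociativeRing
set_option linter.unusedSectionVars false

open Matrix Topology NormedSpace

variable {ι : Type*} [Fintype ι] [DecidableEq ι]
variable {𝔸 : Type*} [NormedRing 𝔸] [NormedAlgebra ℂ 𝔸] [FiniteDimensional ℂ 𝔸]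

/-- The entries of an operator on matrices. -/
noncomputable def entries (ι : Type*) [Fintype ι] [DecidableEq ι] :
    (Matrix ι ι ℂ →ₗ[ℂ] Matrix ι ι ℂ) →ₗ[ℂ] EuclideanSpace ℂ ((ι × ι) × (ι × ι)) where
  toFun R := WithLp.toLp 2 fun s => R (unit s.1) s.2.1 s.2.2
  map_add' R S := by ext; simp
  map_smul' t R := by ext; simp

lemma inner_entries (S T : Matrix ι ι ℂ →ₗ[ℂ] Matrix ι ι ℂ) :
    inner ℂ (entries ι S) (entries ι T) = hsPairing S T := by
  rw [PiLp.inner_apply, Fintype.sum_prod_type]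
  refine Finset.sum_congr rfl fun p _ => ?_
  rw [Fintype.sum_prod_type_right]
  simp [entries, trace, mul_apply, mul_comm]

lemma entries_injective : Function.Injective (entries ι) := by
  intro S T h
  have h1 (p : ι × ι) : S (unit p) = T (unit p) := by
    ext i j
    exact congr_fun (congr_arg WithLp.ofLp h) (p, (i, j))
  ext1 X
  rw [sum_unit X]
  simp [h1]

lemma hasDerivAt_expAct (R : 𝔸 →L[ℂ] 𝔸) (a : 𝔸) :
    HasDerivAt (fun t : ℝ => expAct ((t : ℂ) • a) R) (adAct R a) 0 := by
  have : CompleteSpace 𝔸 := FiniteDimensional.complete ℂ 𝔸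
  have h1 := (hasStrictFDerivAt_expAct R).hasFDerivAt
  have h2 : HasDerivAt (fun z : ℂ => ((z • a, 0) : 𝔸 × (𝔸 →L[ℂ] 𝔸))) (a, 0) 0 := by
    have h3 : HasDerivAt (fun z : ℂ => z • a) a 0 := by
      simpa using (hasDerivAt_id (0 : ℂ)).smul_const a
    exact h3.prodMk (hasDerivAt_const _ _)
  have h0 : (fun z : ℂ => ((z • a, 0) : 𝔸 × (𝔸 →L[ℂ] 𝔸))) 0 = 0 := by simp
  have h4 : HasDerivAt (fun z : ℂ => expAct (z • a) (R + 0)) (adAct R a) 0 := by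
    rw [← h0] at h1
    have := h1.comp_hasDerivAt (0 : ℂ) h2
    simpa [Function.comp_def] using this
  have h5 : HasDerivAt (fun t : ℝ => (t : ℂ)) 1 0 := Complex.ofRealCLM.hasDerivAt
  rw [← Complex.ofReal_zero] at h4
  have h6 := h4.scomp (0 : ℝ) h5
  simpa [Function.comp_def] using h6

/-- Every orbit of admissible operators contains a real one. -/
theorem IsAdmissible.exists_conjOp_eq_aux (τ : Matrix ι ι ℂ ≃ₐ[ℂ] 𝔸)
    {R : Matrix ι ι ℂ →ₗ[ℂ] Matrix ι ι ℂ} (hR : IsAdmissible R) (hn : Fintype.card ι ≠ 4) :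
    ∃ g : Matrix ι ι ℂ, g * gᵀ = 1 ∧
      conjOp (CurvatureOperator.conjBy g R) = CurvatureOperator.conjBy g R := by
  let O : Set (𝔸 →L[ℂ] 𝔸) :=
    {S | ∃ g : Matrix ι ι ℂ, g * gᵀ = 1 ∧ S = opEquiv τ (CurvatureOperator.conjBy g R)}
  let E : (𝔸 →L[ℂ] 𝔸) →L[ℂ] EuclideanSpace ℂ ((ι × ι) × (ι × ι)) :=
    LinearMap.toContinuousLinearMap (entries ι ∘ₗ (opEquiv τ).symm.toLinearMap)
  have hE (S) : E S = entries ι ((opEquiv τ).symm S) := rfl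
  have hEinj : Function.Injective E := entries_injective.comp (opEquiv τ).symm.injective
  have hEcl : IsClosed (E '' closure O) :=
    (E.toLinearMap.isClosedEmbedding_of_injective
      (LinearMap.ker_eq_bot.mpr hEinj)).isClosedMap _ isClosed_closure
  have hOne : O.Nonempty := ⟨_, 1, by simp, rfl⟩
  -- The norm is minimized on the closure because the orbit is not yet known to be closed.
  obtain ⟨_, ⟨S, hS, rfl⟩, hmin⟩ :=
    hEcl.exists_infDist_eq_dist (hOne.closure.image E) 0
  have hmin' : ∀ T ∈ closure O, ‖E S‖ ≤ ‖E T‖ := by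
    intro T hT
    have h1 := Metric.infDist_le_dist_of_mem (x := (0 : EuclideanSpace ℂ ((ι × ι) × (ι × ι))))
      (Set.mem_image_of_mem E hT)
    rw [hmin] at h1
    simpa using h1
  have hOadm : ∀ T ∈ closure O, IsAdmissible ((opEquiv τ).symm T) := by
    have : closure O ⊆ {S | IsAdmissible ((opEquiv τ).symm S)} := by
      refine closure_minimal ?_ (isClosed_isAdmissible τ)
      rintro _ ⟨g, hg, rfl⟩
      change IsAdmissible _
      rw [LinearEquiv.symm_apply_apply]
      exact hR.conjBy hg
    exact this
  have hstab : ∀ a : 𝔸, (τ.symm a)ᵀ = -τ.symm a → expAct a S ∈ closure O := by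
    intro a ha
    have hcont : Continuous fun T : 𝔸 →L[ℂ] 𝔸 => expAct a T := by
      unfold expAct
      fun_prop
    refine map_mem_closure hcont hS ?_
    rintro _ ⟨g, hg, rfl⟩
    refine ⟨τ.symm (exp a) * g, ?_, ?_⟩
    · rw [transpose_mul]
      calc _ = τ.symm (exp a) * (g * gᵀ) * (τ.symm (exp a))ᵀ := by noncomm_ring
        _ = 1 := by rw [hg, mul_one, symm_exp_mul_transpose τ ha]
    · rw [expAct_opEquiv τ ha, conjBy_conjBy]
  -- The squared norm along the curve exp(ta)·S is minimal at t = 0; its derivative there is twice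
  -- this real part.
  have hre : ∀ a : Matrix ι ι ℂ, aᵀ = -a →
      (hsPairing ((opEquiv τ).symm S) (adOp a ((opEquiv τ).symm S))).re = 0 := by
    intro a ha
    have h1 : HasDerivAt (fun t : ℝ => E (expAct ((t : ℂ) • τ a) S)) (E (adAct S (τ a))) 0 :=
      ((E.restrictScalars ℝ).hasFDerivAt.comp_hasDerivAt (0 : ℝ) (hasDerivAt_expAct S (τ a)))
    have h2 := h1.norm_sq
    have h0 : expAct (((0 : ℝ) : ℂ) • τ a) S = S := by ext; simp [expAct_apply]
    have hloc : IsLocalMin (fun t : ℝ => ‖E (expAct ((t : ℂ) • τ a) S)‖ ^ 2) 0 := by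
      refine Filter.Eventually.of_forall fun t => ?_
      simp only [h0]
      have := hmin' _ (hstab ((t : ℂ) • τ a) (by
        rw [map_smul, AlgEquiv.symm_apply_apply, transpose_smul, ha, smul_neg]))
      gcongr
    have h3 := hloc.hasDerivAt_eq_zero h2
    rw [h0] at h3
    have h4 : (inner ℂ (E S) (E (adAct S (τ a)))).re = 0 := by
      have h5 : inner ℝ (E S) (E (adAct S (τ a))) = 0 := by linarith
      rw [PiLp.inner_apply] at h5 ⊢
      rw [Complex.re_sum, ← h5]
      rfl
    rw [hE, hE, opEquiv_symm_adAct, inner_entries] at h4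
    simpa using h4
  have hmom : ∀ a : Matrix ι ι ℂ, aᵀ = -a →
      hsPairing ((opEquiv τ).symm S) (adOp a ((opEquiv τ).symm S)) = 0 := by
    intro a ha
    apply Complex.ext
    · simpa using hre a ha
    -- The orthogonal Lie algebra is complex, so testing with ia yields the imaginary part.
    · have h1 := hre (Complex.I • a) (by simp [ha])
      have h2 : adOp (Complex.I • a) ((opEquiv τ).symm S)
          = Complex.I • adOp a ((opEquiv τ).symm S) := by
        ext1 X
        simp [adOp_apply, smul_sub]
      rw [h2, ← inner_entries, map_smul, inner_smul_right, inner_entries] at h1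
      simpa using h1
  have hSadm := hOadm S hS
  have hreal := hSadm.conjOp_eq_of_moment hn hmom
  have hrig := hSadm.eventually_exists_conjBy τ hn
  rw [LinearEquiv.apply_symm_apply] at hrig
  -- S is a limit of the orbit of R, and admissible operators near S are on the orbit of S; a common
  -- point identifies the two orbits.
  obtain ⟨T, hTO, hT⟩ := ((mem_closure_iff_frequently.mp hS).and_eventually hrig).exists
  obtain ⟨g, hg, rfl⟩ := hTO
  rw [LinearEquiv.symm_apply_apply] at hT
  obtain ⟨h, hh, heq⟩ := hT (hR.conjBy hg)
  have hh' := mul_eq_one_comm.mp hh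
  refine ⟨hᵀ * g, ?_, ?_⟩
  · rw [transpose_mul, transpose_transpose]
    calc _ = hᵀ * (g * gᵀ) * h := by noncomm_ring
      _ = 1 := by rw [hg, mul_one, hh']
  · have h3 : CurvatureOperator.conjBy (hᵀ * g) R = (opEquiv τ).symm S := by
      rw [← conjBy_conjBy, heq, conjBy_conjBy, hh', conjBy_one]
    rw [h3, hreal]

/-- Every orbit of admissible operators contains a real one. -/
theorem IsAdmissible.exists_conjOp_eq
    {R : Matrix ι ι ℂ →ₗ[ℂ] Matrix ι ι ℂ} (hR : IsAdmissible R) (hn : Fintype.card ι ≠ 4) :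
    ∃ g : Matrix ι ι ℂ, g * gᵀ = 1 ∧
      conjOp (CurvatureOperator.conjBy g R) = CurvatureOperator.conjBy g R :=
  hR.exists_conjOp_eq_aux
    (Matrix.toEuclideanCLM (n := ι) (𝕜 := ℂ)).toAlgEquiv hn

end CurvatureOperator

/-! ### Sign rules in a Lie superalgebra with invariant form -/

namespace LieSuperalgebra

set_option linter.unusedSectionVars false

section Superalgebra

variable {g : Type*} [AddCommGroup g] [Module ℂ g] [LieSuperalgebra g]

variable (g) in
lemma isCompl_part : IsCompl (part (g := g) 0) (part 1) :=
  (isInternal (g := g)).isCompl (i := 0) (j := 1) (by decide) (by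
    ext i
    fin_cases i
    · exact ⟨fun _ => Or.inl rfl, fun _ => trivial⟩
    · exact ⟨fun _ => Or.inr rfl, fun _ => trivial⟩)

lemma exists_eq_add (a : g) : ∃ u ∈ part (g := g) 0, ∃ v ∈ part (g := g) 1, a = u + v := by
  obtain ⟨u, hu, v, hv, h⟩ := Submodule.mem_sup.mp
    ((isCompl_part g).sup_eq_top ▸ Submodule.mem_top : a ∈ part (g := g) 0 ⊔ part 1)
  exact ⟨u, hu, v, hv, h.symm⟩

lemma eq_zero_of_mem_part {a : g} (h0 : a ∈ part (g := g) 0) (h1 : a ∈ part (g := g) 1) :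
    a = 0 := by
  have : a ∈ part (g := g) 0 ⊓ part 1 := ⟨h0, h1⟩
  rwa [(isCompl_part g).inf_eq_bot] at this

lemma br_mem_even {a b : g} (ha : a ∈ part (g := g) 0) (hb : b ∈ part (g := g) 0) :
    br a b ∈ part (g := g) 0 := by
  simpa using br_mem 0 0 a b ha hb

lemma br_mem_odd {a b : g} (ha : a ∈ part (g := g) 0) (hb : b ∈ part (g := g) 1) :
    br a b ∈ part (g := g) 1 := by
  simpa using br_mem 0 1 a b ha hb

lemma br_mem_even_of_odd {a b : g} (ha : a ∈ part (g := g) 1) (hb : b ∈ part (g := g) 1) :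
    br a b ∈ part (g := g) 0 := by
  have h := br_mem 1 1 a b ha hb
  rwa [show (1 : ZMod 2) + 1 = 0 by decide] at h

lemma br_even_br {a : g} (ha : a ∈ part (g := g) 0) (b c : g) :
    br a (br b c) = br (br a b) c + br b (br a c) := by
  obtain ⟨u, hu, v, hv, rfl⟩ := exists_eq_add b
  have h1 := br_jacobi 0 0 a u c ha hu
  have h2 := br_jacobi 0 1 a v c ha hv
  simp only [superSign, ZMod.val_zero, zero_mul, pow_zero, one_smul] at h1 h2
  simp only [map_add, LinearMap.add_apply, h1, h2]
  abel

lemma br_even_comm {a : g} (ha : a ∈ part (g := g) 0) (b : g) : br a b = -br b a := by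
  obtain ⟨u, hu, v, hv, rfl⟩ := exists_eq_add b
  have h1 := br_skew 0 0 a u ha hu
  have h2 := br_skew 0 1 a v ha hv
  simp only [superSign, ZMod.val_zero, zero_mul, pow_zero, one_smul] at h1 h2
  simp only [map_add, LinearMap.add_apply, h1, h2]
  abel

lemma br_odd_comm {a b : g} (ha : a ∈ part (g := g) 1) (hb : b ∈ part (g := g) 1) :
    br a b = br b a := by
  simpa [superSign, ZMod.val_one] using br_skew 1 1 a b ha hb

lemma br_odd_br {a b : g} (ha : a ∈ part (g := g) 1) (hb : b ∈ part (g := g) 1) (c : g) :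
    br a (br b c) = br (br a b) c - br b (br a c) := by
  simpa [superSign, ZMod.val_one, sub_eq_add_neg] using br_jacobi 1 1 a b c ha hb

variable {B : g →ₗ[ℂ] g →ₗ[ℂ] ℂ}

lemma IsBasicForm.symm_even (hB : IsBasicForm B) {a : g} (ha : a ∈ part (g := g) 0) (b : g) :
    B a b = B b a := by
  obtain ⟨u, hu, v, hv, rfl⟩ := exists_eq_add b
  have h1 := hB.supersymm 0 0 a u ha hu
  have h2 := hB.supersymm 0 1 a v ha hv
  simp only [superSign, ZMod.val_zero, zero_mul, pow_zero, one_mul] at h1 h2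
  simp only [map_add, LinearMap.add_apply, h1, h2]

lemma IsBasicForm.odd_even (hB : IsBasicForm B) {a b : g} (ha : a ∈ part (g := g) 1)
    (hb : b ∈ part (g := g) 0) : B a b = 0 := by
  rw [← hB.symm_even hb, hB.even b hb a ha]

lemma IsBasicForm.skew_odd (hB : IsBasicForm B) {a b : g} (ha : a ∈ part (g := g) 1)
    (hb : b ∈ part (g := g) 1) : B a b = -B b a := by
  simpa [superSign, ZMod.val_one] using hB.supersymm 1 1 a b ha hb

lemma IsBasicForm.br_even (hB : IsBasicForm B) {a : g} (ha : a ∈ part (g := g) 0) (b c : g) :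
    B (br a b) c = -B b (br a c) := by
  rw [br_even_comm ha b, map_neg, LinearMap.neg_apply, hB.invariant]

lemma IsBasicForm.grade_grade (hB : IsBasicForm B) {x a b : g} {i j : ℂ}
    (hx : x ∈ part (g := g) 0) (ha : br x a = i • a) (hb : br x b = j • b) (hij : i + j ≠ 0) :
    B a b = 0 := by
  have h := hB.br_even hx a b
  rw [ha, hb, map_smul, map_smul, LinearMap.smul_apply, smul_eq_mul, smul_eq_mul] at h
  exact (mul_eq_zero.mp (by linear_combination h : (i + j) * B a b = 0)).resolve_left hij

end Superalgebra

/-! ### The grading by ad x -/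

section SlTwo
attribute [local instance] LieRing.ofAssociativeRing

/-- An eigenvector of `ad x`, for an `sl₂`-triple `e, x, f`, has a half-integral eigenvalue. -/
lemma exists_int_of_eigenvector {g : Type*} [AddCommGroup g] [Module ℂ g] [FiniteDimensional ℂ g]
    {E X F : Module.End ℂ g} (hEF : E * F - F * E = X) (hXE : X * E - E * X = E)
    (hXF : X * F - F * X = -F) {u : g} (hu : u ≠ 0) {j : ℂ} (h : X u = j • u) :
    ∃ n : ℤ, j = n / 2 := by
  by_cases hX : X = 0
  · refine ⟨0, ?_⟩
    rw [hX, LinearMap.zero_apply, eq_comm, smul_eq_zero] at h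
    simpa [hu] using h
  -- The normalization [e, f] = x, [x, e] = e becomes the standard one after doubling X and F. The
  -- case X = 0 is apart because a triple must have a nonzero middle element.
  have ht : IsSl2Triple ((2 : ℂ) • X) E ((2 : ℂ) • F) := by
    refine ⟨by simpa using hX, ?_, ?_, ?_⟩
    · rw [LieRing.of_associative_ring_bracket, mul_smul_comm, smul_mul_assoc, ← smul_sub, hEF]
    · rw [LieRing.of_associative_ring_bracket, mul_smul_comm, smul_mul_assoc, ← smul_sub, hXE,
        two_smul, two_nsmul]
    · rw [LieRing.of_associative_ring_bracket, mul_smul_comm, smul_mul_assoc, smul_mul_assoc,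
        mul_smul_comm, ← smul_sub, ← smul_sub, hXF]
      simp only [two_smul]
      abel
  have hpow (k : ℕ) : X ((E ^ k) u) = (j + k) • (E ^ k) u := by
    induction k with
    | zero => simp [h]
    | succ k ih =>
      have h1 : X (E ((E ^ k) u)) - E (X ((E ^ k) u)) = E ((E ^ k) u) := congr($hXE ((E ^ k) u))
      rw [ih, map_smul] at h1
      rw [pow_succ', Module.End.mul_apply, sub_eq_iff_eq_add.mp h1]
      push_cast
      module
  -- Otherwise X would have the infinitely many eigenvalues j + k.
  obtain ⟨k, hk⟩ : ∃ k, (E ^ k) u = 0 := by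
    by_contra! hne
    have hinj : Function.Injective fun k : ℕ => j + (k : ℂ) := fun a b hab => by simpa using hab
    refine Set.infinite_of_injective_forall_mem hinj (fun k => ?_) (Module.End.finite_hasEigenvalue X)
    exact Module.End.hasEigenvalue_of_hasEigenvector
      (x := (E ^ k) u) ⟨Module.End.mem_eigenspace_iff.mpr (hpow k), hne k⟩
  obtain ⟨m, h1, h2⟩ := Nat.exists_not_and_succ_of_not_zero_of_exists
    (p := fun k => (E ^ k) u = 0) (by simpa using hu) ⟨k, hk⟩
  have hp : ht.HasPrimitiveVectorWith ((E ^ m) u) (2 * (j + m)) := by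
    refine ⟨h1, ?_, ?_⟩
    · change ((2 : ℂ) • X) ((E ^ m) u) = _
      rw [LinearMap.smul_apply, hpow, smul_smul]
    · change E ((E ^ m) u) = 0
      rw [← h2, pow_succ', Module.End.mul_apply]
  obtain ⟨n, hn⟩ := hp.exists_nat
  -- The vector E^m u is primitive, of weight 2(j + m) = n.
  exact ⟨n - 2 * m, by push_cast; linear_combination hn / 2⟩

end SlTwo

namespace IsMinimalDatum

variable {g : Type*} [AddCommGroup g] [Module ℂ g] [FiniteDimensional ℂ g] [LieSuperalgebra g]
  {B : g →ₗ[ℂ] g →ₗ[ℂ] ℂ} {e x f : g} (hg : IsMinimalDatum B e x f)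

include hg

lemma mem_even_of_mem_span {a : g} (ha : a ∈ Submodule.span ℂ {e, x, f}) :
    a ∈ part (g := g) 0 :=
  hg.even_eq ▸ Submodule.mem_sup_left ha

lemma e_mem : e ∈ part (g := g) 0 := hg.mem_even_of_mem_span (Submodule.subset_span (by simp))
lemma x_mem : x ∈ part (g := g) 0 := hg.mem_even_of_mem_span (Submodule.subset_span (by simp))
lemma f_mem : f ∈ part (g := g) 0 := hg.mem_even_of_mem_span (Submodule.subset_span (by simp))

lemma centralizer_le : centralizer e x f ≤ part (g := g) 0 :=
  hg.even_eq ▸ le_sup_right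

lemma form_e_f : B e f = 1 / 2 := by
  have h := hg.form.invariant e f x
  rw [hg.br_e_f, br_even_comm hg.f_mem, hg.br_x_f, neg_neg, hg.normalized] at h
  exact h.symm

lemma br_x_br_e (u : g) : br x (br e u) = br e u + br e (br x u) := by
  rw [br_even_br hg.x_mem, hg.br_x_e]

lemma br_x_br_f (u : g) : br x (br f u) = -br f u + br f (br x u) := by
  rw [br_even_br hg.x_mem, hg.br_x_f, map_neg, LinearMap.neg_apply]

lemma br_e_br_f (u : g) : br e (br f u) = br x u + br f (br e u) := by
  rw [br_even_br hg.e_mem, hg.br_e_f]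

lemma exists_int {u : g} (hu : u ≠ 0) {j : ℂ} (h : br x u = j • u) :
    ∃ n : ℤ, |n| ≤ 2 ∧ j = n / 2 := by
  obtain ⟨n, rfl⟩ := exists_int_of_eigenvector (E := br e) (X := br x) (F := br f)
    (LinearMap.ext fun v => by simpa [sub_eq_iff_eq_add] using hg.br_e_br_f v)
    (LinearMap.ext fun v => by simpa [sub_eq_iff_eq_add] using hg.br_x_br_e v)
    (LinearMap.ext fun v => by simpa [sub_eq_iff_eq_add] using hg.br_x_br_f v) hu h
  refine ⟨n, ?_, rfl⟩
  by_contra! hn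
  have h1 : u ∈ grade x ((n : ℂ) / 2) := Module.End.mem_eigenspace_iff.mpr h
  rw [hg.grade_eq_bot n hn] at h1
  exact hu h1

lemma eq_zero_of_grade {u : g} {j : ℂ} (h : br x u = j • u)
    (hj : j ≠ 1 ∧ j ≠ 1 / 2 ∧ j ≠ 0 ∧ j ≠ -1 / 2 ∧ j ≠ -1) : u = 0 := by
  by_contra hu
  obtain ⟨n, hn, rfl⟩ := hg.exists_int hu h
  obtain ⟨h1, h2⟩ := abs_le.mp hn
  obtain ⟨h3, h4, h5, h6, h7⟩ := hj
  interval_cases n <;> norm_num at *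

/-- The eigenvalues of `ad x` on the odd part are `1/2` and `-1/2`. -/
lemma odd_eq_zero_of_grade {u : g} (hu : u ∈ part (g := g) 1) {j : ℂ} (h : br x u = j • u)
    (hj : j ≠ 1 / 2 ∧ j ≠ -1 / 2) : u = 0 := by
  have hneg {v : g} (hv : v ∈ part (g := g) 1) (h : br x v = (-1 : ℂ) • v) : v = 0 := by
    have h1 : v ∈ grade x (-1) := Module.End.mem_eigenspace_iff.mpr h
    rw [hg.grade_neg_one] at h1
    obtain ⟨c, rfl⟩ := Submodule.mem_span_singleton.mp h1
    exact eq_zero_of_mem_part (Submodule.smul_mem _ _ hg.f_mem) hv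
  have hone {v : g} (h : br x v = (1 : ℂ) • v) : br e v = 0 := by
    refine hg.eq_zero_of_grade (j := 2) ?_ (by norm_num)
    rw [hg.br_x_br_e, h, map_smul]
    module
  -- Such a v is a highest weight vector, and f²v is odd of weight -1, hence zero. Applying e twice
  -- brings this back to v = 0.
  have hone' {v : g} (hv : v ∈ part (g := g) 1) (h : br x v = (1 : ℂ) • v) : v = 0 := by
    have h1 := hg.br_e_br_f v
    rw [hone h, map_zero, add_zero, h] at h1
    have h2 : br x (br f v) = (0 : ℂ) • br f v := by
      rw [hg.br_x_br_f, h, map_smul]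
      module
    have h3 : br f (br f v) = 0 := by
      refine hneg (br_mem_odd hg.f_mem (br_mem_odd hg.f_mem hv)) ?_
      rw [hg.br_x_br_f, h2, map_smul]
      module
    have h4 := hg.br_e_br_f (br f v)
    rw [h3, h2, h1] at h4
    have h5 : br f v = 0 := by simpa using h4.symm
    rw [h5] at h1
    simpa using h1.symm
  by_cases h1 : j = 1
  · exact hone' hu (h1 ▸ h)
  by_cases h2 : j = -1
  · exact hneg hu (h2 ▸ h)
  by_cases h0 : j = 0
  · subst h0
    -- An odd vector of weight 0 is killed by e and f, so it lies in the centralizer, which is even.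
    have h3 : br e u = 0 := by
      refine hone' (br_mem_odd hg.e_mem hu) ?_
      rw [hg.br_x_br_e, h, map_smul]
      module
    have h4 : br f u = 0 := by
      refine hneg (br_mem_odd hg.f_mem hu) ?_
      rw [hg.br_x_br_f, h, map_smul]
      module
    refine eq_zero_of_mem_part (hg.centralizer_le ⟨⟨h3, ?_⟩, h4⟩) hu
    rw [SetLike.mem_coe, LinearMap.mem_ker, h, zero_smul]
  · exact hg.eq_zero_of_grade h ⟨h1, hj.1, h0, hj.2, h2⟩

/-- A linear endomorphism of the odd part shifting the generalised eigenspaces of `ad x` by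
`±1` has square zero. -/
lemma odd_sq_zero {T : Module.End ℂ g} {ε : ℂ} (hε : ε = 1 ∨ ε = -1)
    (hTp : ∀ u ∈ part (g := g) 1, T u ∈ part (g := g) 1)
    (hT : ∀ u, br x (T u) = ε • T u + T (br x u)) {u : g} (hu : u ∈ part (g := g) 1) :
    T (T u) = 0 := by
  let Y : Module.End ℂ (part (g := g) 1) :=
    (br x).restrict fun v hv => br_mem_odd hg.x_mem hv
  let T' : Module.End ℂ (part (g := g) 1) := T.restrict hTp
  -- Semisimplicity of ad x on the odd part is not yet available, so generalised eigenspaces are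
  -- used. Two shifts in the same direction leave {1/2, -1/2}.
  have hbot : ∀ j : ℂ, j ≠ 1 / 2 ∧ j ≠ -1 / 2 → Y.maxGenEigenspace j = ⊥ := by
    intro j hj
    by_contra hne
    have hev' : Y.HasUnifEigenvalue j ⊤ := hne
    have hev : Y.HasEigenvalue j := hev'.lt zero_lt_one
    obtain ⟨v, hv⟩ := hev.exists_hasEigenvector
    have h1 : br x (v : g) = j • (v : g) := congr_arg Subtype.val hv.apply_eq_smul
    exact hv.2 (Subtype.ext (hg.odd_eq_zero_of_grade v.2 h1 hj))
  have hshift : ∀ (j : ℂ) (v), v ∈ Y.maxGenEigenspace j → T' v ∈ Y.maxGenEigenspace (j + ε) := by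
    intro j v hv
    rw [Module.End.mem_maxGenEigenspace] at hv ⊢
    obtain ⟨k, hk⟩ := hv
    refine ⟨k, ?_⟩
    have h1 (v) : (Y - (j + ε) • 1) (T' v) = T' ((Y - j • 1) v) := by
      ext
      change br x (T v) - (j + ε) • T v = T (br x v - j • v)
      rw [hT, map_sub, map_smul]
      module
    have h2 (k : ℕ) (v) : ((Y - (j + ε) • 1) ^ k) (T' v) = T' (((Y - j • 1) ^ k) v) := by
      induction k generalizing v with
      | zero => rfl
      | succ k ih => rw [pow_succ, Module.End.mul_apply, h1, ih, pow_succ, Module.End.mul_apply]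
    rw [h2, hk, map_zero]
  suffices h : ∀ v, T' (T' v) = 0 from congr_arg Subtype.val (h ⟨u, hu⟩)
  intro v
  have hv : v ∈ ⨆ j : ℂ, Y.maxGenEigenspace j := by
    rw [Module.End.iSup_maxGenEigenspace_eq_top]
    trivial
  induction hv using Submodule.iSup_induction' with
  | zero => simp
  | add v w _ _ hv hw => rw [map_add, map_add, hv, hw, add_zero]
  | mem j v hv =>
    by_cases hj : j ≠ 1 / 2 ∧ j ≠ -1 / 2
    · rw [hbot j hj, Submodule.mem_bot] at hv
      simp [hv]
    · have h2 := hshift _ _ (hshift j v hv)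
      rwa [hbot, Submodule.mem_bot] at h2
      rw [not_and_or, not_not, not_not] at hj
      rcases hj with rfl | rfl <;> rcases hε with rfl | rfl <;> norm_num

/-- The odd part is the sum of the eigenspaces of `ad x` with eigenvalues `1/2` and `-1/2`. -/
lemma odd_sq {u : g} (hu : u ∈ part (g := g) 1) : br x (br x u) = (1 / 4 : ℂ) • u := by
  have hEE {v : g} (hv : v ∈ part (g := g) 1) : br e (br e v) = 0 :=
    hg.odd_sq_zero (ε := 1) (Or.inl rfl) (fun u hu => br_mem_odd hg.e_mem hu)
      (fun u => by rw [hg.br_x_br_e, one_smul]) hv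
  have hFF {v : g} (hv : v ∈ part (g := g) 1) : br f (br f v) = 0 :=
    hg.odd_sq_zero (ε := -1) (Or.inr rfl) (fun u hu => br_mem_odd hg.f_mem hu)
      (fun u => by rw [hg.br_x_br_f, neg_one_smul]) hv
  -- Expanding e²f v = 0 with e² = 0 gives (ex + xe)v = 0, which with [x, e] = e fixes the weight of
  -- ev.
  have hXE {v : g} (hv : v ∈ part (g := g) 1) : br x (br e v) = (1 / 2 : ℂ) • br e v := by
    have h1 := hEE (br_mem_odd hg.f_mem hv)
    rw [hg.br_e_br_f, map_add, hg.br_e_br_f, hEE hv, map_zero, add_zero] at h1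
    have h2 := hg.br_x_br_e v
    linear_combination (norm := module) (1 / 2 : ℂ) • h2 + (1 / 2 : ℂ) • h1
  have hXF {v : g} (hv : v ∈ part (g := g) 1) : br x (br f v) = (-1 / 2 : ℂ) • br f v := by
    have h1 := hFF (br_mem_odd hg.e_mem hv)
    have h3 := hg.br_e_br_f (br f v)
    rw [hFF hv, map_zero, hg.br_e_br_f, map_add, h1, add_zero] at h3
    have h2 := hg.br_x_br_f v
    linear_combination (norm := module) (1 / 2 : ℂ) • h2 - (1 / 2 : ℂ) • h3
  have h1 := hXE (br_mem_odd hg.f_mem hu)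
  have h2 := hXF (br_mem_odd hg.e_mem hu)
  rw [hg.br_e_br_f, map_add, h2] at h1
  have h3 : br x (br x (br x u)) = (1 / 4 : ℂ) • br x u := by
    have h4 := congr_arg (br x) h1
    simp only [map_add, map_smul, h2] at h4
    linear_combination (norm := module) h4 + (1 / 2 : ℂ) • h1
  -- The difference is an odd vector killed by ad x, and 0 is not an odd eigenvalue.
  have h5 : br x (br x u) - (1 / 4 : ℂ) • u = 0 := by
    refine hg.odd_eq_zero_of_grade (j := 0) (sub_mem (br_mem_odd hg.x_mem
      (br_mem_odd hg.x_mem hu)) (Submodule.smul_mem _ _ hu)) ?_ (by norm_num)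
    rw [map_sub, map_smul, h3, sub_self, zero_smul]
  exact sub_eq_zero.mp h5

lemma exists_odd_eq_add {u : g} (hu : u ∈ part (g := g) 1) :
    ∃ v ∈ grade x (-1 / 2), ∃ w ∈ grade x (1 / 2), u = v + w := by
  refine ⟨(1 / 2 : ℂ) • u - br x u, ?_, (1 / 2 : ℂ) • u + br x u, ?_, by module⟩ <;>
  · rw [Module.End.mem_eigenspace_iff]
    simp only [map_sub, map_add, map_smul, hg.odd_sq hu]
    module

/-- On the span of the triple and its centralizer ad x has only the eigenvalues 1, 0, -1. This
forces the half-integral eigenspaces to be odd. -/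
lemma even_cube {u : g} (hu : u ∈ part (g := g) 0) : br x (br x (br x u)) = br x u := by
  rw [← hg.even_eq] at hu
  obtain ⟨s, hs, a, ha, rfl⟩ := Submodule.mem_sup.mp hu
  have h1 : br x a = 0 := ha.1.2
  have h2 : br x x = 0 := by
    have h3 : (2 : ℂ) • br x x = 0 := by
      linear_combination (norm := module) br_even_comm hg.x_mem x
    simpa using h3
  obtain ⟨p, q, r, rfl⟩ := Submodule.mem_span_triple.mp hs
  simp [h1, h2, hg.br_x_e, hg.br_x_f]

lemma odd_of_grade {u : g} {j : ℂ} (hu : br x u = j • u) (hj : j ^ 3 ≠ j) :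
    u ∈ part (g := g) 1 := by
  obtain ⟨v, hv, w, hw, rfl⟩ := exists_eq_add u
  rw [map_add, smul_add] at hu
  have h1 : br x v - j • v = 0 := by
    refine eq_zero_of_mem_part (sub_mem (br_mem_even hg.x_mem hv) (Submodule.smul_mem _ _ hv)) ?_
    rw [show br x v - j • v = j • w - br x w by linear_combination (norm := module) hu]
    exact sub_mem (Submodule.smul_mem _ _ hw) (br_mem_odd hg.x_mem hw)
  have h2 := hg.even_cube hv
  simp only [sub_eq_zero.mp h1, map_smul, smul_smul] at h2
  have h3 : (j ^ 3 - j) • v = 0 := by linear_combination (norm := module) h2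
  rw [smul_eq_zero, sub_eq_zero] at h3
  rw [h3.resolve_left hj, zero_add]
  exact hw

lemma odd_of_neg {u : g} (hu : u ∈ grade x (-1 / 2)) : u ∈ part (g := g) 1 :=
  hg.odd_of_grade (Module.End.mem_eigenspace_iff.mp hu) (by norm_num)

lemma odd_of_pos {u : g} (hu : u ∈ grade x (1 / 2)) : u ∈ part (g := g) 1 :=
  hg.odd_of_grade (Module.End.mem_eigenspace_iff.mp hu) (by norm_num)

end IsMinimalDatum
end LieSuperalgebra

/-! ### The pairing on g_{-1/2}, the moment map and faithfulness -/

namespace LieSuperalgebra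

set_option linter.unusedSectionVars false

namespace IsMinimalDatum

variable {g : Type*} [AddCommGroup g] [Module ℂ g] [FiniteDimensional ℂ g] [LieSuperalgebra g]
  {B : g →ₗ[ℂ] g →ₗ[ℂ] ℂ} {e x f : g} (hg : IsMinimalDatum B e x f)

include hg

lemma br_f_neg {u : g} (hu : u ∈ grade x (-1 / 2)) : br f u = 0 := by
  rw [Module.End.mem_eigenspace_iff] at hu
  refine hg.eq_zero_of_grade (j := -3 / 2) ?_ (by norm_num)
  rw [hg.br_x_br_f, hu, map_smul]
  module

lemma br_e_pos {u : g} (hu : u ∈ grade x (1 / 2)) : br e u = 0 := by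
  rw [Module.End.mem_eigenspace_iff] at hu
  refine hg.eq_zero_of_grade (j := 3 / 2) ?_ (by norm_num)
  rw [hg.br_x_br_e, hu, map_smul]
  module

lemma br_e_neg {u : g} (hu : u ∈ grade x (-1 / 2)) : br e u ∈ grade x (1 / 2) := by
  rw [Module.End.mem_eigenspace_iff] at hu ⊢
  rw [hg.br_x_br_e, hu, map_smul]
  module

lemma br_f_pos {u : g} (hu : u ∈ grade x (1 / 2)) : br f u ∈ grade x (-1 / 2) := by
  rw [Module.End.mem_eigenspace_iff] at hu ⊢
  rw [hg.br_x_br_f, hu, map_smul]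
  module

lemma br_f_br_e {u : g} (hu : u ∈ grade x (-1 / 2)) : br f (br e u) = (1 / 2 : ℂ) • u := by
  have h := hg.br_e_br_f u
  rw [hg.br_f_neg hu, Module.End.mem_eigenspace_iff.mp hu, map_zero] at h
  linear_combination (norm := module) -h

lemma exists_br_e_eq {w : g} (hw : w ∈ grade x (1 / 2)) : ∃ u ∈ grade x (-1 / 2), br e u = w := by
  refine ⟨(2 : ℂ) • br f w, Submodule.smul_mem _ _ (hg.br_f_pos hw), ?_⟩
  rw [map_smul, hg.br_e_br_f, hg.br_e_pos hw, Module.End.mem_eigenspace_iff.mp hw, map_zero]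
  module

/-- The grade -1 is the line of f; the factor 2 is the inverse of (e|f) = 1/2. -/
lemma br_neg_neg {u v : g} (hu : u ∈ grade x (-1 / 2)) (hv : v ∈ grade x (-1 / 2)) :
    br u v = (2 * B e (br u v)) • f := by
  have h : br u v ∈ grade x (-1) := by
    rw [Module.End.mem_eigenspace_iff] at hu hv ⊢
    rw [br_even_br hg.x_mem, hu, hv, map_smul, map_smul, LinearMap.smul_apply]
    module
  rw [hg.grade_neg_one] at h
  obtain ⟨c, hc⟩ := Submodule.mem_span_singleton.mp h
  rw [← hc, map_smul, hg.form_e_f, smul_eq_mul]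
  congr 1
  ring

lemma pairing_comm {u v : g} (hu : u ∈ grade x (-1 / 2)) (hv : v ∈ grade x (-1 / 2)) :
    B e (br u v) = B e (br v u) := by
  rw [br_odd_comm (hg.odd_of_neg hu) (hg.odd_of_neg hv)]

lemma form_br_e {u v : g} : B (br e u) v = B e (br u v) := hg.form.invariant e u v

/-- By invariance the pairing is (ad e u|v). It inherits nondegeneracy from the form, since the
other pieces are orthogonal to g_{1/2} and ad e is injective on g_{-1/2}. -/
lemma pairing_nondeg {u : g} (hu : u ∈ grade x (-1 / 2))
    (h : ∀ v ∈ grade x (-1 / 2), B e (br u v) = 0) : u = 0 := by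
  have h1 : br e u = 0 := by
    refine hg.form.nondeg _ fun b => ?_
    have hpos := hg.br_e_neg hu
    obtain ⟨c, hc, d, hd, rfl⟩ := exists_eq_add b
    obtain ⟨v, hv, w, hw, rfl⟩ := hg.exists_odd_eq_add hd
    rw [map_add, map_add, hg.form.odd_even (hg.odd_of_pos hpos) hc, hg.form_br_e, h v hv,
      hg.form.grade_grade hg.x_mem (Module.End.mem_eigenspace_iff.mp hpos)
        (Module.End.mem_eigenspace_iff.mp hw) (by norm_num)]
    simp
  have h2 := hg.br_f_br_e hu
  rw [h1, map_zero] at h2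
  simpa using h2.symm

lemma br_x_self : br x x = 0 := by
  have h3 : (2 : ℂ) • br x x = 0 := by
    linear_combination (norm := module) br_even_comm hg.x_mem x
  simpa using h3

lemma br_e_self : br e e = 0 := by
  have h3 : (2 : ℂ) • br e e = 0 := by
    linear_combination (norm := module) br_even_comm hg.e_mem e
  simpa using h3

lemma br_f_self : br f f = 0 := by
  have h3 : (2 : ℂ) • br f f = 0 := by
    linear_combination (norm := module) br_even_comm hg.f_mem f
  simpa using h3

lemma br_e_x : br e x = -e := by rw [br_even_comm hg.e_mem, hg.br_x_e]

lemma br_f_x : br f x = f := by rw [br_even_comm hg.f_mem, hg.br_x_f, neg_neg]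

lemma br_f_e : br f e = -x := by rw [br_even_comm hg.f_mem, hg.br_e_f]

lemma br_neg_f {u : g} (hu : u ∈ grade x (-1 / 2)) : br u f = 0 := by
  rw [← neg_eq_zero, ← br_even_comm hg.f_mem, hg.br_f_neg hu]

lemma br_neg_x {u : g} (hu : u ∈ grade x (-1 / 2)) : br u x = (1 / 2 : ℂ) • u := by
  have h := br_even_comm hg.x_mem u
  rw [Module.End.mem_eigenspace_iff.mp hu] at h
  linear_combination (norm := module) h

/-- The bracket of two elements of `g_{1/2}`. -/
lemma br_pos_pos {u v : g} (hu : u ∈ grade x (-1 / 2)) (hv : v ∈ grade x (-1 / 2)) :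
    br (br e u) (br e v) = -B e (br u v) • e := by
  have h := congr_arg (br e) (hg.br_neg_neg hu hv)
  rw [map_smul, hg.br_e_f, br_even_br hg.e_mem] at h
  have h1 := congr_arg (br e) h
  rw [map_smul, hg.br_e_x, map_add, br_even_br hg.e_mem (br e u), br_even_br hg.e_mem u,
    hg.br_e_pos (hg.br_e_neg hu), hg.br_e_pos (hg.br_e_neg hv), map_zero, map_zero,
    LinearMap.zero_apply] at h1
  linear_combination (norm := module) (1 / 2 : ℂ) • h1

/-- The negative sign here is what makes the form on g_{1/2} negative definite. -/
lemma form_f_br_pos_pos {u v : g} (hu : u ∈ grade x (-1 / 2)) (hv : v ∈ grade x (-1 / 2)) :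
    B f (br (br e u) (br e v)) = -(1 / 2) * B e (br u v) := by
  rw [hg.br_pos_pos hu hv, map_smul, hg.form.symm_even hg.f_mem, hg.form_e_f, smul_eq_mul]
  ring

end IsMinimalDatum
/-- The projection of `[[e, w], u]` to the centralizer of `e, x, f`. -/
def moment {g : Type*} [AddCommGroup g] [Module ℂ g] [LieSuperalgebra g]
    (B : g →ₗ[ℂ] g →ₗ[ℂ] ℂ) (e x : g) : g →ₗ[ℂ] g →ₗ[ℂ] g :=
  LinearMap.mk₂ ℂ (fun w u => br (br e w) u - B e (br w u) • x)
    (fun a b c => by simp only [map_add, LinearMap.add_apply]; module)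
    (fun a b c => by simp only [map_smul, LinearMap.smul_apply, smul_eq_mul]; module)
    (fun a b c => by simp only [map_add]; module)
    (fun a b c => by simp only [map_smul, smul_eq_mul]; module)

lemma moment_apply {g : Type*} [AddCommGroup g] [Module ℂ g] [LieSuperalgebra g]
    (B : g →ₗ[ℂ] g →ₗ[ℂ] ℂ) (e x w u : g) :
    moment B e x w u = br (br e w) u - B e (br w u) • x := rfl

namespace IsMinimalDatum

variable {g : Type*} [AddCommGroup g] [Module ℂ g] [FiniteDimensional ℂ g] [LieSuperalgebra g]
  {B : g →ₗ[ℂ] g →ₗ[ℂ] ℂ} {e x f : g} (hg : IsMinimalDatum B e x f)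

include hg

lemma mem_centralizer {a : g} : a ∈ centralizer e x f ↔ br e a = 0 ∧ br x a = 0 ∧ br f a = 0 := by
  simp [centralizer, and_assoc]

/-- The bracket [[e, w], u] has weight 0, and the multiple of x is chosen to cancel its brackets
with e and f. -/
lemma moment_mem {w u : g} (hw : w ∈ grade x (-1 / 2)) (hu : u ∈ grade x (-1 / 2)) :
    moment B e x w u ∈ centralizer e x f := by
  have hw' := hg.br_e_neg hw
  rw [hg.mem_centralizer, moment_apply]
  refine ⟨?_, ?_, ?_⟩
  · rw [map_sub, map_smul, br_even_br hg.e_mem, hg.br_e_pos hw', map_zero, LinearMap.zero_apply,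
      zero_add, hg.br_pos_pos hw hu, hg.br_e_x]
    module
  · rw [map_sub, map_smul, br_even_br hg.x_mem, Module.End.mem_eigenspace_iff.mp hw',
      Module.End.mem_eigenspace_iff.mp hu, hg.br_x_self, map_smul, map_smul, LinearMap.smul_apply]
    module
  · rw [map_sub, map_smul, br_even_br hg.f_mem, hg.br_f_br_e hw, hg.br_f_neg hu, map_zero,
      hg.br_f_x, map_smul, LinearMap.smul_apply, hg.br_neg_neg hw hu]
    simp only [map_smul, hg.form_e_f, smul_eq_mul]
    module

lemma br_e_br_neg {w u : g} (hw : w ∈ grade x (-1 / 2)) (hu : u ∈ grade x (-1 / 2)) :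
    br (br e w) u + br w (br e u) = (2 * B e (br w u)) • x := by
  rw [← br_even_br hg.e_mem, hg.br_neg_neg hw hu, map_smul, hg.br_e_f]
  simp only [map_smul, hg.form_e_f, smul_eq_mul]
  module

lemma moment_skew {w u : g} (hw : w ∈ grade x (-1 / 2)) (hu : u ∈ grade x (-1 / 2)) :
    moment B e x w u = -moment B e x u w := by
  have h := hg.br_e_br_neg hw hu
  rw [br_odd_comm (hg.odd_of_neg hw) (hg.odd_of_pos (hg.br_e_neg hu))] at h
  rw [moment_apply, moment_apply, hg.pairing_comm hu hw]
  linear_combination (norm := module) h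

lemma br_centralizer_e {a : g} (ha : a ∈ centralizer e x f) : br a e = 0 := by
  rw [br_even_comm (hg.centralizer_le ha), (hg.mem_centralizer.mp ha).1, neg_zero]

lemma br_centralizer_x {a : g} (ha : a ∈ centralizer e x f) : br a x = 0 := by
  rw [br_even_comm (hg.centralizer_le ha), (hg.mem_centralizer.mp ha).2.1, neg_zero]

lemma br_centralizer_f {a : g} (ha : a ∈ centralizer e x f) : br a f = 0 := by
  rw [br_even_comm (hg.centralizer_le ha), (hg.mem_centralizer.mp ha).2.2, neg_zero]

lemma br_centralizer_neg {a u : g} (ha : a ∈ centralizer e x f) (hu : u ∈ grade x (-1 / 2)) :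
    br a u ∈ grade x (-1 / 2) := by
  rw [Module.End.mem_eigenspace_iff] at hu ⊢
  rw [br_even_br hg.x_mem, hu, (hg.mem_centralizer.mp ha).2.1, map_smul]
  simp

lemma br_centralizer_br_e {a : g} (ha : a ∈ centralizer e x f) (u : g) :
    br a (br e u) = br e (br a u) := by
  rw [br_even_br (hg.centralizer_le ha), hg.br_centralizer_e ha]
  simp

lemma br_centralizer_mem {a b : g} (ha : a ∈ centralizer e x f) (hb : b ∈ centralizer e x f) :
    br a b ∈ centralizer e x f := by
  obtain ⟨h1, h2, h3⟩ := hg.mem_centralizer.mp ha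
  obtain ⟨k1, k2, k3⟩ := hg.mem_centralizer.mp hb
  rw [hg.mem_centralizer, br_even_br hg.e_mem, br_even_br hg.x_mem, br_even_br hg.f_mem]
  simp [h1, h2, h3, k1, k2, k3]

lemma pairing_centralizer {a u v : g} (ha : a ∈ centralizer e x f) (hu : u ∈ grade x (-1 / 2))
    (hv : v ∈ grade x (-1 / 2)) : B e (br (br a u) v) = -B e (br u (br a v)) := by
  have h := br_even_br (hg.centralizer_le ha) u v
  rw [hg.br_neg_neg hu hv, map_smul, hg.br_centralizer_f ha, smul_zero] at h
  rw [eq_neg_iff_add_eq_zero, ← map_add, ← h, map_zero]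

lemma br_centralizer_moment {a w u : g} (ha : a ∈ centralizer e x f)
    (hw : w ∈ grade x (-1 / 2)) (hu : u ∈ grade x (-1 / 2)) :
    br a (moment B e x w u) = moment B e x (br a w) u + moment B e x w (br a u) := by
  simp only [moment_apply]
  rw [map_sub, map_smul, hg.br_centralizer_x ha, br_even_br (hg.centralizer_le ha),
    hg.br_centralizer_br_e ha, hg.pairing_centralizer ha hw hu]
  module

/-- The Jacobi identity for [e, w], u, v. The right-hand side is the contribution of the constant
curvature operator; subtracting it leaves the antisymmetry `IsFourForm.cyclic`. -/
lemma br_moment_add {w u v : g} (hw : w ∈ grade x (-1 / 2)) (hu : u ∈ grade x (-1 / 2))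
    (hv : v ∈ grade x (-1 / 2)) :
    br (moment B e x w u) v + br (moment B e x w v) u =
      -B e (br u v) • w + (1 / 2 * B e (br w u)) • v + (1 / 2 * B e (br w v)) • u := by
  have hw' := hg.br_e_neg hw
  have h := br_odd_br (hg.odd_of_pos hw') (hg.odd_of_neg hu) v
  have h1 : br u (br (br e w) v) = -br (br (br e w) v) u := by
    rw [br_even_comm (br_mem_even_of_odd (hg.odd_of_pos hw') (hg.odd_of_neg hv)), neg_neg]
  have h2 : br (br e w) f = -(1 / 2 : ℂ) • w := by
    have := br_even_comm hg.f_mem (br e w)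
    rw [hg.br_f_br_e hw] at this
    linear_combination (norm := module) this
  rw [h1, hg.br_neg_neg hu hv, map_smul, h2] at h
  simp only [moment_apply, map_sub, map_smul, LinearMap.sub_apply, LinearMap.smul_apply,
    Module.End.mem_eigenspace_iff.mp hu, Module.End.mem_eigenspace_iff.mp hv]
  linear_combination (norm := module) -h

lemma form_x_centralizer {a : g} (ha : a ∈ centralizer e x f) : B x a = 0 := by
  rw [← hg.br_e_f, hg.form.invariant, (hg.mem_centralizer.mp ha).2.2, map_zero]

lemma form_e_centralizer {a : g} (ha : a ∈ centralizer e x f) : B e a = 0 := by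
  rw [← hg.br_x_e, hg.form.br_even hg.x_mem, (hg.mem_centralizer.mp ha).2.1, map_zero, neg_zero]

lemma form_f_centralizer {a : g} (ha : a ∈ centralizer e x f) : B f a = 0 := by
  have h := hg.form.br_even hg.x_mem f a
  rw [hg.br_x_f, (hg.mem_centralizer.mp ha).2.1, map_zero, neg_zero] at h
  simpa using h

/-- Invariance of the form: μ is dual to the action of the centralizer on g_{-1/2}, as a moment map
is. -/
lemma form_moment_centralizer {a w u : g} (ha : a ∈ centralizer e x f)
    (hw : w ∈ grade x (-1 / 2)) (hu : u ∈ grade x (-1 / 2)) :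
    B (moment B e x w u) a = B e (br (br a w) u) := by
  rw [moment_apply, map_sub, map_smul, LinearMap.sub_apply, LinearMap.smul_apply,
    hg.form_x_centralizer ha, hg.form.invariant, hg.form_br_e, ← neg_neg (br u a),
    ← br_even_comm (hg.centralizer_le ha), map_neg, map_neg, hg.pairing_centralizer ha hw hu]
  simp

/-- The centralizer of `e, x, f` acts faithfully on `g_{-1/2}`. -/
lemma centralizer_faithful {a : g} (ha : a ∈ centralizer e x f)
    (h : ∀ u ∈ grade x (-1 / 2), br a u = 0) : a = 0 := by
  -- The kernel of the action commutes with the triple and with all odd elements, so it is an ideal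
  -- of the whole superalgebra, to which simplicity applies.
  let I : Submodule ℂ g :=
    { carrier := {a | a ∈ centralizer e x f ∧ ∀ u ∈ grade x (-1 / 2), br a u = 0}
      zero_mem' := ⟨zero_mem _, by simp⟩
      add_mem' := fun {a b} ha hb => ⟨add_mem ha.1 hb.1, fun u hu => by
        rw [map_add, LinearMap.add_apply, ha.2 u hu, hb.2 u hu, add_zero]⟩
      smul_mem' := fun t a ha => ⟨Submodule.smul_mem _ _ ha.1, fun u hu => by
        rw [map_smul, LinearMap.smul_apply, ha.2 u hu, smul_zero]⟩ }
  have hI : IsGradedIdeal I := by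
    refine ⟨fun y a ha => ?_, ?_⟩
    · have hae := hg.centralizer_le ha.1
      obtain ⟨c, hc, d, hd, rfl⟩ := exists_eq_add y
      rw [← hg.even_eq] at hc
      obtain ⟨s, hs, k, hk, rfl⟩ := Submodule.mem_sup.mp hc
      obtain ⟨p, q, r, rfl⟩ := Submodule.mem_span_triple.mp hs
      obtain ⟨v, hv, w, hw, rfl⟩ := hg.exists_odd_eq_add hd
      obtain ⟨z, hz, rfl⟩ := hg.exists_br_e_eq hw
      obtain ⟨h1, h2, h3⟩ := hg.mem_centralizer.mp ha.1
      have h4 : br v a = 0 := by rw [← neg_eq_zero, ← br_even_comm hae, ha.2 v hv]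
      have h5 : br (br e z) a = 0 := by
        rw [← neg_eq_zero, ← br_even_comm hae, hg.br_centralizer_br_e ha.1, ha.2 z hz, map_zero]
      have h6 : br ((p • e + q • x + r • f + k) + (v + br e z)) a = br k a := by
        simp [h1, h2, h3, h4, h5]
      rw [h6]
      refine ⟨hg.br_centralizer_mem hk ha.1, fun u hu => ?_⟩
      have h7 := br_even_br (hg.centralizer_le hk) a u
      rw [ha.2 u hu, ha.2 _ (hg.br_centralizer_neg hk hu), map_zero, add_zero] at h7
      exact h7.symm
    · refine le_antisymm (le_trans (le_inf le_rfl fun a ha => hg.centralizer_le ha.1) le_sup_left)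
        (sup_le inf_le_left inf_le_left)
  rcases hg.simple.2 I hI with h0 | h0
  · have : a ∈ I := ⟨ha, h⟩
    rwa [h0, Submodule.mem_bot] at this
  · have h1 : e ∈ I := h0 ▸ Submodule.mem_top
    have h2 := hg.br_centralizer_f h1.1
    rw [hg.br_e_f] at h2
    have h3 := hg.normalized
    rw [h2] at h3
    simp at h3

end IsMinimalDatum
end LieSuperalgebra

/-! ### Orthonormal frames and the curvature operator -/

namespace LieSuperalgebra

set_option linter.unusedSectionVars false

open Matrix

section Frame

variable {g : Type*} [AddCommGroup g] [Module ℂ g] [LieSuperalgebra g]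
  {B : g →ₗ[ℂ] g →ₗ[ℂ] ℂ} {e x f : g}
  {ι : Type*} [Fintype ι] [DecidableEq ι]

/-- An orthonormal basis of `g_{-1/2}` for the form `(e | [u, v])`. -/
structure IsFrame (B : g →ₗ[ℂ] g →ₗ[ℂ] ℂ) (e x : g) (v : ι → g) : Prop where
  mem : ∀ i, v i ∈ grade x (-1 / 2)
  pairing : ∀ i j, B e (br (v i) (v j)) = if i = j then 1 else 0
  sum_eq : ∀ u ∈ grade x (-1 / 2), ∑ i, B e (br (v i) u) • v i = u

/-- The matrix of the action of an element of `g` on `g_{-1/2}`. -/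
def frameRep (B : g →ₗ[ℂ] g →ₗ[ℂ] ℂ) (e : g) (v : ι → g) : g →ₗ[ℂ] Matrix ι ι ℂ where
  toFun a := Matrix.of fun k l => B e (br (v k) (br a (v l)))
  map_add' a b := by ext; simp
  map_smul' t a := by ext; simp

lemma frameRep_apply (v : ι → g) (a : g) (k l : ι) :
    frameRep B e v a k l = B e (br (v k) (br a (v l))) := rfl

/-- The linear map on matrices that sends `E_{ij}` to `moment (v i) (v j)`. -/
def frameMoment (B : g →ₗ[ℂ] g →ₗ[ℂ] ℂ) (e x : g) (v : ι → g) : Matrix ι ι ℂ →ₗ[ℂ] g where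
  toFun X := ∑ i, ∑ j, X i j • moment B e x (v i) (v j)
  map_add' X Y := by simp [add_smul, Finset.sum_add_distrib]
  map_smul' t X := by simp [Finset.smul_sum, mul_smul]

lemma frameMoment_apply (v : ι → g) (X : Matrix ι ι ℂ) :
    frameMoment B e x v X = ∑ i, ∑ j, X i j • moment B e x (v i) (v j) := rfl

lemma frameMoment_unit (v : ι → g) (p : ι × ι) :
    frameMoment B e x v (CurvatureOperator.unit p) = moment B e x (v p.1) (v p.2) := by
  rw [frameMoment_apply, Finset.sum_eq_single p.1, Finset.sum_eq_single p.2]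
  · simp [CurvatureOperator.unit_apply]
  · intro j _ hj
    simp [CurvatureOperator.unit_apply, hj.symm]
  · simp
  · intro i _ hi
    refine Finset.sum_eq_zero fun j _ => ?_
    simp [CurvatureOperator.unit_apply, hi.symm]
  · simp

/-- The curvature operator of an orthonormal basis of `g_{-1/2}`. -/
def frameCurv (B : g →ₗ[ℂ] g →ₗ[ℂ] ℂ) (e x : g) (v : ι → g) : Matrix ι ι ℂ →ₗ[ℂ] Matrix ι ι ℂ :=
  frameRep B e v ∘ₗ frameMoment B e x v

lemma frameCurv_apply (v : ι → g) (X : Matrix ι ι ℂ) :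
    frameCurv B e x v X = frameRep B e v (frameMoment B e x v X) := rfl

/-- The linear combination of the vectors of a basis with given coefficients. -/
def frameSum (v : ι → g) (c : ι → ℂ) : g := ∑ i, c i • v i

lemma moment_frameSum (v : ι → g) (c d : ι → ℂ) :
    moment B e x (frameSum v c) (frameSum v d) = frameMoment B e x v (vecMulVec c d) := by
  simp only [frameSum, map_sum, map_smul, LinearMap.sum_apply, LinearMap.smul_apply,
    frameMoment_apply, vecMulVec_apply, mul_smul]
  rw [Finset.sum_comm]
  simp only [Finset.smul_sum]
  exact Finset.sum_congr rfl fun i _ => Finset.sum_congr rfl fun j _ => smul_comm _ _ _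

namespace IsFrame

variable {v : ι → g} (hv : IsFrame B e x v)

include hv

lemma frameSum_mem (c : ι → ℂ) : frameSum v c ∈ grade x (-1 / 2) :=
  Submodule.sum_mem _ fun i _ => Submodule.smul_mem _ _ (hv.mem i)

lemma pairing_left (c : ι → ℂ) (i : ι) : B e (br (v i) (frameSum v c)) = c i := by
  simp [frameSum, hv.pairing]

lemma pairing_frameSum (c d : ι → ℂ) : B e (br (frameSum v c) (frameSum v d)) = c ⬝ᵥ d := by
  conv_lhs => rw [frameSum]
  simp only [map_sum, map_smul, LinearMap.sum_apply, LinearMap.smul_apply, hv.pairing_left]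
  rfl

lemma exists_frameSum {u : g} (hu : u ∈ grade x (-1 / 2)) : ∃ c, u = frameSum v c :=
  ⟨_, (hv.sum_eq u hu).symm⟩

lemma frameSum_injective : Function.Injective (frameSum v) := fun c d h => by
  funext i
  rw [← hv.pairing_left c, h, hv.pairing_left]

end IsFrame

end Frame

namespace IsMinimalDatum

variable {g : Type*} [AddCommGroup g] [Module ℂ g] [FiniteDimensional ℂ g] [LieSuperalgebra g]
  {B : g →ₗ[ℂ] g →ₗ[ℂ] ℂ} {e x f : g} (hg : IsMinimalDatum B e x f)
  {ι : Type*} [Fintype ι] [DecidableEq ι] {v : ι → g} (hv : IsFrame B e x v)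

section

include hg

/-- Diagonalize the symmetric nondegenerate pairing and divide each basis vector by a complex square
root of its norm. -/
lemma exists_isFrame : ∃ (n : ℕ) (v : Fin n → g), IsFrame B e x v := by
  let b : LinearMap.BilinForm ℂ (grade x (-1 / 2)) :=
    (br.compr₂ (B e)).domRestrict₁₂ (grade x (-1 / 2)) (grade x (-1 / 2))
  have hb (u w) : b u w = B e (br (u : g) (w : g)) := rfl
  have hsymm : LinearMap.IsSymm b := ⟨fun u w => hg.pairing_comm u.2 w.2⟩
  have : Invertible (2 : ℂ) := invertibleOfNonzero two_ne_zero
  obtain ⟨w, hw⟩ := LinearMap.BilinForm.exists_orthogonal_basis hsymm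
  have hne : ∀ i, b (w i) (w i) ≠ 0 := by
    intro i h0
    refine w.ne_zero i (Subtype.ext (hg.pairing_nondeg (w i).2 fun u hu => ?_))
    change b (w i) ⟨u, hu⟩ = 0
    rw [← w.sum_repr ⟨u, hu⟩, map_sum]
    refine Finset.sum_eq_zero fun j _ => ?_
    rw [map_smul]
    rcases eq_or_ne i j with rfl | hij
    · rw [h0, smul_zero]
    · rw [hw hij, smul_zero]
  choose s hs using fun i => IsAlgClosed.exists_pow_nat_eq (b (w i) (w i)) (n := 2) (by norm_num)
  have hs0 : ∀ i, s i ≠ 0 := fun i h => hne i (by rw [← hs, h]; norm_num)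
  have hpair : ∀ i j, b ((s i)⁻¹ • w i) ((s j)⁻¹ • w j) = if i = j then 1 else 0 := by
    intro i j
    rw [map_smul, map_smul, LinearMap.smul_apply, smul_eq_mul, smul_eq_mul]
    split_ifs with hij
    · subst hij
      rw [← hs]
      field_simp [hs0 i]
    · rw [hw hij, mul_zero, mul_zero]
  refine ⟨_, fun i => ((s i)⁻¹ • w i : grade x (-1 / 2)), fun i => Subtype.prop _, hpair, ?_⟩
  intro u hu
  have h1 : (⟨u, hu⟩ : grade x (-1 / 2)) = ∑ i, b ((s i)⁻¹ • w i) ⟨u, hu⟩ • (s i)⁻¹ • w i := by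
    have h2 : ∀ i, w.repr ⟨u, hu⟩ i = (s i)⁻¹ * (s i)⁻¹ * b (w i) ⟨u, hu⟩ := by
      intro i
      conv_rhs => rw [← w.sum_repr ⟨u, hu⟩, map_sum]
      rw [Finset.sum_eq_single i]
      · rw [map_smul, ← hs, smul_eq_mul]
        field_simp [hs0 i]
      · intro j _ hij
        rw [map_smul, hw hij.symm, smul_zero]
      · simp
    conv_lhs => rw [← w.sum_repr ⟨u, hu⟩]
    refine Finset.sum_congr rfl fun i _ => ?_
    rw [h2, map_smul, LinearMap.smul_apply, smul_eq_mul, smul_smul]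
    congr 1
    ring
  have h3 := congr_arg Subtype.val h1
  rw [Submodule.coe_sum] at h3
  exact h3.symm

end

include hg hv

lemma br_frameSum {a : g} (ha : a ∈ centralizer e x f) (c : ι → ℂ) :
    br a (frameSum v c) = frameSum v (frameRep B e v a *ᵥ c) := by
  rw [← hv.sum_eq _ (hg.br_centralizer_neg ha (hv.frameSum_mem c)), frameSum]
  refine Finset.sum_congr rfl fun i _ => ?_
  congr 1
  simp [mulVec, dotProduct, frameRep_apply, mul_comm]

lemma br_frame {a : g} (ha : a ∈ centralizer e x f) (l : ι) :
    br a (v l) = ∑ k, frameRep B e v a k l • v k :=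
  (hv.sum_eq _ (hg.br_centralizer_neg ha (hv.mem l))).symm

lemma frameRep_transpose {a : g} (ha : a ∈ centralizer e x f) :
    (frameRep B e v a)ᵀ = -frameRep B e v a := by
  ext k l
  rw [transpose_apply, neg_apply, frameRep_apply, frameRep_apply,
    hg.pairing_comm (hv.mem l) (hg.br_centralizer_neg ha (hv.mem k)),
    hg.pairing_centralizer ha (hv.mem k) (hv.mem l)]

lemma frameRep_br {a b : g} (ha : a ∈ centralizer e x f) (hb : b ∈ centralizer e x f) :
    frameRep B e v (br a b) =
      frameRep B e v a * frameRep B e v b - frameRep B e v b * frameRep B e v a := by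
  have key (a b : g) (ha : a ∈ centralizer e x f) (hb : b ∈ centralizer e x f) (k l : ι) :
      B e (br (v k) (br a (br b (v l)))) = (frameRep B e v a * frameRep B e v b) k l := by
    rw [hg.br_frame hv hb, mul_apply]
    simp [frameRep_apply, mul_comm]
  ext k l
  rw [frameRep_apply, Matrix.sub_apply, ← key a b ha hb, ← key b a hb ha,
    br_even_br (hg.centralizer_le ha), map_add, map_add, add_sub_cancel_right]

lemma frameRep_injOn {a : g} (ha : a ∈ centralizer e x f) (h : frameRep B e v a = 0) : a = 0 := by
  refine hg.centralizer_faithful ha fun u hu => ?_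
  obtain ⟨c, rfl⟩ := hv.exists_frameSum hu
  rw [hg.br_frameSum hv ha, h, zero_mulVec]
  simp [frameSum]

lemma frameMoment_mem (X : Matrix ι ι ℂ) : frameMoment B e x v X ∈ centralizer e x f :=
  Submodule.sum_mem _ fun i _ => Submodule.sum_mem _ fun j _ =>
    Submodule.smul_mem _ _ (hg.moment_mem (hv.mem i) (hv.mem j))

lemma frameMoment_transpose (X : Matrix ι ι ℂ) :
    frameMoment B e x v Xᵀ = -frameMoment B e x v X := by
  rw [frameMoment_apply, frameMoment_apply, Finset.sum_comm, ← Finset.sum_neg_distrib]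
  refine Finset.sum_congr rfl fun i _ => ?_
  rw [← Finset.sum_neg_distrib]
  refine Finset.sum_congr rfl fun j _ => ?_
  rw [transpose_apply, hg.moment_skew (hv.mem j) (hv.mem i), smul_neg]

lemma br_frameMoment {a : g} (ha : a ∈ centralizer e x f) (X : Matrix ι ι ℂ) :
    br a (frameMoment B e x v X) =
      frameMoment B e x v (frameRep B e v a * X - X * frameRep B e v a) := by
  have h1 : frameRep B e v a * X - X * frameRep B e v a =
      frameRep B e v a * X + X * (frameRep B e v a)ᵀ := by
    rw [hg.frameRep_transpose hv ha, mul_neg, sub_eq_add_neg]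
  rw [h1, map_add, frameMoment_apply]
  simp only [map_sum, map_smul, hg.br_centralizer_moment ha (hv.mem _) (hv.mem _), smul_add,
    Finset.sum_add_distrib]
  congr 1
  · simp only [hg.br_frame hv ha, map_sum, map_smul, LinearMap.sum_apply, LinearMap.smul_apply,
      frameMoment_apply, mul_apply, Finset.sum_smul, Finset.smul_sum, smul_smul]
    rw [Finset.sum_congr rfl fun i _ => Finset.sum_comm, Finset.sum_comm]
    refine Finset.sum_congr rfl fun k _ => ?_
    rw [Finset.sum_comm]
    simp only [mul_comm]
  · simp only [hg.br_frame hv ha, map_sum, map_smul, frameMoment_apply, mul_apply, transpose_apply,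
      Finset.sum_smul, Finset.smul_sum, smul_smul]
    refine Finset.sum_congr rfl fun i _ => ?_
    rw [Finset.sum_comm]

lemma form_frameMoment {a : g} (ha : a ∈ centralizer e x f) (X : Matrix ι ι ℂ) :
    B (frameMoment B e x v X) a = trace (X * frameRep B e v a) := by
  simp only [frameMoment_apply, map_sum, map_smul, LinearMap.sum_apply, LinearMap.smul_apply,
    hg.form_moment_centralizer ha (hv.mem _) (hv.mem _), trace, mul_apply, diag_apply, smul_eq_mul,
    frameRep_apply]
  refine Finset.sum_congr rfl fun i _ => Finset.sum_congr rfl fun j _ => ?_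
  rw [hg.pairing_comm (hv.mem j) (hg.br_centralizer_neg ha (hv.mem i))]

/-- The input and output symmetries are skewness of μ and of the action, `cyclic` is the Jacobi
identity `br_moment_add`, and `lie_map` is equivariance of μ under the centralizer. -/
lemma frameCurv_isAdmissible : CurvatureOperator.IsAdmissible (frameCurv B e x v) where
  fourForm :=
    { map_transpose := fun X => by
        rw [LinearMap.sub_apply, LinearMap.sub_apply, frameCurv_apply, frameCurv_apply,
          hg.frameMoment_transpose hv, map_neg, CurvatureOperator.constOp_apply,
          CurvatureOperator.constOp_apply, transpose_transpose]
        module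
      transpose_map := fun X => by
        rw [LinearMap.sub_apply, frameCurv_apply, transpose_sub,
          hg.frameRep_transpose hv (hg.frameMoment_mem hv X), CurvatureOperator.constOp_apply,
          transpose_smul, transpose_sub, transpose_transpose]
        module
      cyclic := fun w u d => by
        have h1 := hg.br_moment_add (hv.frameSum_mem w) (hv.frameSum_mem u) (hv.frameSum_mem d)
        rw [moment_frameSum, moment_frameSum, hg.br_frameSum hv (hg.frameMoment_mem hv _),
          hg.br_frameSum hv (hg.frameMoment_mem hv _), hv.pairing_frameSum, hv.pairing_frameSum,
          hv.pairing_frameSum] at h1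
        have h2 : frameCurv B e x v (vecMulVec w u) *ᵥ d + frameCurv B e x v (vecMulVec w d) *ᵥ u =
            -(u ⬝ᵥ d) • w + (1 / 2 * (w ⬝ᵥ u)) • d + (1 / 2 * (w ⬝ᵥ d)) • u := by
          refine hv.frameSum_injective ?_
          simp only [frameSum] at h1 ⊢
          simp only [Pi.add_apply, Pi.smul_apply, add_smul, smul_assoc, Finset.sum_add_distrib,
            ← Finset.smul_sum]
          exact h1
        rw [LinearMap.sub_apply, LinearMap.sub_apply, sub_mulVec, sub_mulVec,
          CurvatureOperator.constOp_apply, CurvatureOperator.constOp_apply, transpose_vecMulVec,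
          transpose_vecMulVec, smul_mulVec, smul_mulVec, sub_mulVec, sub_mulVec, vecMulVec_mulVec,
          vecMulVec_mulVec, vecMulVec_mulVec, vecMulVec_mulVec]
        simp only [op_smul_eq_smul]
        rw [dotProduct_comm d u]
        linear_combination (norm := module) h2 }
  lie_map := fun X Y => by
    rw [LieRing.of_associative_ring_bracket, LieRing.of_associative_ring_bracket]
    simp only [frameCurv_apply]
    rw [← hg.frameRep_br hv (hg.frameMoment_mem hv X) (hg.frameMoment_mem hv Y),
      hg.br_frameMoment hv (hg.frameMoment_mem hv X)]

end IsMinimalDatum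
end LieSuperalgebra

/-! ### Conjugations from a real spanning set -/

namespace LieSuperalgebra

set_option linter.unusedSectionVars false

open Matrix

/-- A spanning set on which a nondegenerate form takes real values is fixed by a conjugation. -/
lemma exists_conjugation {g : Type*} [AddCommGroup g] [Module ℂ g] (B : g →ₗ[ℂ] g →ₗ[ℂ] ℂ)
    (hB : ∀ a, (∀ b, B a b = 0) → a = 0) (Y : Set g) (hY : Submodule.span ℂ Y = ⊤)
    (hreal : ∀ y ∈ Y, ∀ z ∈ Y, (B y z).im = 0) :
    ∃ φ : g →ₗ⋆[ℂ] g, (∀ y ∈ Y, φ y = y) ∧ (∀ a, φ (φ a) = a) ∧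
      ∀ a b, B (φ a) (φ b) = conj (B a b) := by
  let D : Submodule ℝ g := Submodule.span ℝ Y
  have hI (r : ℝ) (a : g) : r • a = (r : ℂ) • a := (Complex.coe_smul r a).symm
  have him1 : ∀ d ∈ D, ∀ y ∈ Y, (B d y).im = 0 := by
    intro d hd y hy
    induction hd using Submodule.span_induction with
    | mem z hz => exact hreal z hz y hy
    | zero => simp
    | add a b _ _ ha hb => simp [ha, hb]
    | smul r a _ ha =>
      rw [hI, map_smul, LinearMap.smul_apply, smul_eq_mul, Complex.im_ofReal_mul, ha, mul_zero]
  have him : ∀ d ∈ D, ∀ d' ∈ D, (B d d').im = 0 := by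
    intro d hd d' hd'
    induction hd' using Submodule.span_induction with
    | mem z hz => exact him1 d hd z hz
    | zero => simp
    | add a b _ _ ha hb => simp [ha, hb]
    | smul r a _ ha =>
      rw [hI, map_smul, smul_eq_mul, Complex.im_ofReal_mul, ha, mul_zero]
  have hzero : ∀ d ∈ D, (∀ y ∈ Y, B d y = 0) → d = 0 := by
    intro d _ h
    refine hB d fun b => ?_
    have hb : b ∈ Submodule.span ℂ Y := hY ▸ Submodule.mem_top
    induction hb using Submodule.span_induction with
    | mem z hz => exact h z hz
    | zero => simp
    | add a b _ _ ha hb => simp [ha, hb]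
    | smul r a _ ha => simp [ha]
  -- Pairing with the spanning set separates real and imaginary parts, so D meets iD trivially by
  -- nondegeneracy. Linear independence of the spanning set is thus not needed.
  have huniq : ∀ d ∈ D, ∀ d' ∈ D, d + Complex.I • d' = 0 → d = 0 ∧ d' = 0 := by
    intro d hd d' hd' h
    have h1 : ∀ y ∈ Y, B d y = 0 ∧ B d' y = 0 := by
      intro y hy
      have h2 : B d y + Complex.I * B d' y = 0 := by
        simpa using congr_arg (fun a => B a y) h
      have h3 := congr_arg Complex.re h2
      have h4 := congr_arg Complex.im h2
      simp [him1 d hd y hy, him1 d' hd' y hy] at h3 h4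
      exact ⟨Complex.ext h3 (him1 d hd y hy), Complex.ext h4 (him1 d' hd' y hy)⟩
    exact ⟨hzero d hd fun y hy => (h1 y hy).1, hzero d' hd' fun y hy => (h1 y hy).2⟩
  have hex : ∀ a : g, ∃ d ∈ D, ∃ d' ∈ D, a = d + Complex.I • d' := by
    intro a
    have ha : a ∈ Submodule.span ℂ Y := hY ▸ Submodule.mem_top
    induction ha using Submodule.span_induction with
    | mem y hy => exact ⟨y, Submodule.subset_span hy, 0, zero_mem _, by simp⟩
    | zero => exact ⟨0, zero_mem _, 0, zero_mem _, by simp⟩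
    | add a b _ _ ha hb =>
      obtain ⟨d, hd, d', hd', rfl⟩ := ha
      obtain ⟨c, hc, c', hc', rfl⟩ := hb
      exact ⟨d + c, add_mem hd hc, d' + c', add_mem hd' hc', by module⟩
    | smul t a _ ha =>
      obtain ⟨d, hd, d', hd', rfl⟩ := ha
      refine ⟨t.re • d - t.im • d', sub_mem (D.smul_mem _ hd) (D.smul_mem _ hd'),
        t.im • d + t.re • d', add_mem (D.smul_mem _ hd) (D.smul_mem _ hd'), ?_⟩
      conv_lhs => rw [← Complex.re_add_im t]
      simp only [hI]
      have h1 : (Complex.I * Complex.I + 1) • ((t.im : ℂ) • d') = 0 := by simp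
      linear_combination (norm := module) h1
  choose p hp q hq hpq using hex
  have key : ∀ d ∈ D, ∀ d' ∈ D, p (d + Complex.I • d') = d ∧ q (d + Complex.I • d') = d' := by
    intro d hd d' hd'
    have h1 := hpq (d + Complex.I • d')
    have h2 := huniq (p (d + Complex.I • d') - d) (sub_mem (hp _) hd)
      (q (d + Complex.I • d') - d') (sub_mem (hq _) hd')
      (by linear_combination (norm := module) -h1)
    exact ⟨sub_eq_zero.mp h2.1, sub_eq_zero.mp h2.2⟩
  have hval : ∀ d ∈ D, ∀ d' ∈ D, ∀ a, a = d + Complex.I • d' →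
      p a - Complex.I • q a = d - Complex.I • d' := by
    rintro d hd d' hd' a rfl
    rw [(key d hd d' hd').1, (key d hd d' hd').2]
  refine ⟨{ toFun := fun a => p a - Complex.I • q a, map_add' := ?_, map_smul' := ?_ },
    ?_, ?_, ?_⟩
  · intro a b
    rw [hval (p a + p b) (add_mem (hp a) (hp b)) (q a + q b) (add_mem (hq a) (hq b)) (a + b)
      (by linear_combination (norm := module) hpq a + hpq b)]
    module
  · intro t a
    rw [hval (t.re • p a - t.im • q a) (sub_mem (D.smul_mem _ (hp a)) (D.smul_mem _ (hq a)))
      (t.im • p a + t.re • q a) (add_mem (D.smul_mem _ (hp a)) (D.smul_mem _ (hq a)))]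
    · simp only [hI]
      rw [← Complex.re_add_im (conj t), Complex.conj_re, Complex.conj_im]
      have h1 : (Complex.I * Complex.I + 1) • ((t.im : ℂ) • q a) = 0 := by simp
      push_cast
      linear_combination (norm := module) -h1
    · simp only [hI]
      have h1 : (Complex.I * Complex.I + 1) • ((t.im : ℂ) • q a) = 0 := by simp
      have h2 : t • a = ((t.re : ℂ) + t.im * Complex.I) • (p a + Complex.I • q a) := by
        rw [Complex.re_add_im, ← hpq]
      rw [h2]
      linear_combination (norm := module) h1
  · intro y hy
    have := hval y (Submodule.subset_span hy) 0 (zero_mem _) y (by simp)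
    simpa using this
  · intro a
    change p (p a - Complex.I • q a) - Complex.I • q (p a - Complex.I • q a) = a
    rw [hval (p a) (hp a) (-q a) (neg_mem (hq a)) _ (by module)]
    conv_rhs => rw [hpq a]
    module
  · intro a b
    change B (p a - Complex.I • q a) (p b - Complex.I • q b) = _
    have hc : ∀ c ∈ D, ∀ d ∈ D, conj (B c d) = B c d := fun c hc d hd =>
      Complex.conj_eq_iff_im.mpr (him c hc d hd)
    conv_rhs => rw [hpq a, hpq b]
    simp [hc _ (hp a) _ (hp b), hc _ (hp a) _ (hq b), hc _ (hq a) _ (hp b), hc _ (hq a) _ (hq b)]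
    ring

end LieSuperalgebra

/-! ### The involution attached to a frame with real curvature -/

namespace LieSuperalgebra

set_option linter.unusedSectionVars false

open Matrix

variable {g : Type*} [AddCommGroup g] [Module ℂ g] [FiniteDimensional ℂ g] [LieSuperalgebra g]
  {B : g →ₗ[ℂ] g →ₗ[ℂ] ℂ} {e x f : g} (hg : IsMinimalDatum B e x f)
  {ι : Type*} [Fintype ι] [DecidableEq ι] {v : ι → g} (hv : IsFrame B e x v)

/-- Generators of the even part. -/
def evenFrame (B : g →ₗ[ℂ] g →ₗ[ℂ] ℂ) (e x f : g) (v : ι → g) : Set g :=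
  {e, x, f} ∪ Set.range fun p : ι × ι => moment B e x (v p.1) (v p.2)

/-- A basis of the odd part. -/
def oddFrame (e : g) (v : ι → g) : Set g := Set.range v ∪ Set.range fun i => br e (v i)

namespace IsMinimalDatum

include hg hv

lemma evenFrame_subset : evenFrame B e x f v ⊆ part (g := g) 0 := by
  rintro y ((rfl | rfl | rfl) | ⟨p, rfl⟩)
  exacts [hg.e_mem, hg.x_mem, hg.f_mem, hg.centralizer_le (hg.moment_mem (hv.mem _) (hv.mem _))]

lemma oddFrame_subset : oddFrame e v ⊆ part (g := g) 1 := by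
  rintro y (⟨i, rfl⟩ | ⟨i, rfl⟩)
  exacts [hg.odd_of_neg (hv.mem i), hg.odd_of_pos (hg.br_e_neg (hv.mem i))]

lemma span_oddFrame : Submodule.span ℂ (oddFrame e v) = part (g := g) 1 := by
  refine le_antisymm (Submodule.span_le.mpr (hg.oddFrame_subset hv)) fun y hy => ?_
  obtain ⟨u, hu, w, hw, rfl⟩ := hg.exists_odd_eq_add hy
  obtain ⟨z, hz, rfl⟩ := hg.exists_br_e_eq hw
  obtain ⟨c, rfl⟩ := hv.exists_frameSum hu
  obtain ⟨d, rfl⟩ := hv.exists_frameSum hz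
  simp only [frameSum, map_sum, map_smul]
  refine add_mem (Submodule.sum_mem _ fun i _ => Submodule.smul_mem _ _ ?_)
    (Submodule.sum_mem _ fun i _ => Submodule.smul_mem _ _ ?_)
  · exact Submodule.subset_span (Or.inl ⟨i, rfl⟩)
  · exact Submodule.subset_span (Or.inr ⟨i, rfl⟩)

/-- A functional vanishing on the set is (a|·) for some a. Pairing with the moments recovers the
matrix of the centralizer part of a, which vanishes by faithfulness; the rest of the functional is
then zero too. -/
lemma span_frame : Submodule.span ℂ (evenFrame B e x f v ∪ oddFrame e v) = ⊤ := by
  by_contra hne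
  obtain ⟨l, hl, hle⟩ := Submodule.exists_le_ker_of_lt_top _ (lt_top_iff_ne_top.mpr hne)
  have hsurj : Function.Surjective B := by
    refine (LinearMap.injective_iff_surjective_of_finrank_eq_finrank
      Subspace.dual_finrank_eq.symm).mp ?_
    refine (injective_iff_map_eq_zero B).mpr fun a ha => hg.form.nondeg a fun b => ?_
    rw [ha, LinearMap.zero_apply]
  obtain ⟨a, rfl⟩ := hsurj l
  refine hl ?_
  have hY : ∀ y ∈ evenFrame B e x f v ∪ oddFrame e v, B a y = 0 := fun y hy =>
    hle (Submodule.subset_span hy)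
  have hodd : ∀ y ∈ part (g := g) 1, B a y = 0 := by
    intro y hy
    rw [← hg.span_oddFrame hv] at hy
    exact (Submodule.span_mono Set.subset_union_right |>.trans hle) hy
  obtain ⟨a0, ha0, a1, ha1, rfl⟩ := exists_eq_add a
  rw [← hg.even_eq] at ha0
  obtain ⟨s, hs, c, hc, rfl⟩ := Submodule.mem_sup.mp ha0
  have hsc : ∀ k ∈ centralizer e x f, B s k = 0 := by
    intro k hk
    obtain ⟨p, q, r, rfl⟩ := Submodule.mem_span_triple.mp hs
    simp [hg.form_e_centralizer hk, hg.form_x_centralizer hk, hg.form_f_centralizer hk]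
  have hc0 : c = 0 := by
    refine hg.frameRep_injOn hv hc ?_
    ext i j
    have h1 := hg.moment_mem (hv.mem j) (hv.mem i)
    have h := hY _ (Or.inl (Or.inr ⟨(j, i), rfl⟩))
    rw [map_add, map_add, LinearMap.add_apply, LinearMap.add_apply, hsc _ h1,
      hg.form.odd_even ha1 (hg.centralizer_le h1), hg.form.symm_even (hg.centralizer_le hc),
      hg.form_moment_centralizer hc (hv.mem j) (hv.mem i),
      hg.pairing_comm (hg.br_centralizer_neg hc (hv.mem j)) (hv.mem i)] at h
    simpa [frameRep_apply] using h
  ext y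
  obtain ⟨y0, hy0, y1, hy1, rfl⟩ := exists_eq_add y
  rw [map_add, hodd y1 hy1, add_zero, LinearMap.zero_apply]
  rw [← hg.even_eq] at hy0
  obtain ⟨t, ht, k, hk, rfl⟩ := Submodule.mem_sup.mp hy0
  rw [map_add]
  have h1 : B (s + c + a1) k = 0 := by
    rw [hc0, add_zero, map_add, LinearMap.add_apply, hsc k hk,
      hg.form.odd_even ha1 (hg.centralizer_le hk), add_zero]
  rw [h1, add_zero]
  exact (Submodule.span_mono (Set.subset_union_left.trans Set.subset_union_left) |>.trans hle) ht

lemma span_evenFrame : Submodule.span ℂ (evenFrame B e x f v) = part (g := g) 0 := by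
  refine le_antisymm (Submodule.span_le.mpr (hg.evenFrame_subset hv)) fun y hy => ?_
  have h : y ∈ Submodule.span ℂ (evenFrame B e x f v ∪ oddFrame e v) :=
    hg.span_frame hv ▸ Submodule.mem_top
  rw [Submodule.span_union, hg.span_oddFrame hv] at h
  obtain ⟨a, ha, b, hb, rfl⟩ := Submodule.mem_sup.mp h
  have ha' := (Submodule.span_le.mpr (hg.evenFrame_subset hv)) ha
  have : b = 0 := eq_zero_of_mem_part (by simpa using sub_mem hy ha') hb
  rwa [this, add_zero]

/-- All products of generators are fixed by the normalization, except those of two moments; these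
are entries of the curvature operator. -/
lemma form_frame_im (hreal : ∀ i j k l, (frameRep B e v (moment B e x (v i) (v j)) k l).im = 0) :
    ∀ y ∈ evenFrame B e x f v ∪ oddFrame e v, ∀ z ∈ evenFrame B e x f v ∪ oddFrame e v,
      (B y z).im = 0 := by
  have hm (p : ι × ι) := hg.moment_mem (hv.mem p.1) (hv.mem p.2)
  have heven : ∀ y ∈ evenFrame B e x f v, ∀ z ∈ evenFrame B e x f v, (B y z).im = 0 := by
    have he : br x e = (1 : ℂ) • e := by rw [hg.br_x_e, one_smul]
    have hx : br x x = (0 : ℂ) • x := by rw [hg.br_x_self, zero_smul]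
    have hf : br x f = (-1 : ℂ) • f := by rw [hg.br_x_f, neg_one_smul]
    have key {a b : g} {i j : ℂ} (ha : br x a = i • a) (hb : br x b = j • b) (h : i + j ≠ 0) :
        (B a b).im = 0 := by
      rw [hg.form.grade_grade hg.x_mem ha hb h, Complex.zero_im]
    have hmc (p : ι × ι) {a : g} (ha : a ∈ part (g := g) 0)
        (h : B a (moment B e x (v p.1) (v p.2)) = 0) :
        (B (moment B e x (v p.1) (v p.2)) a).im = 0 := by
      rw [← hg.form.symm_even ha, h, Complex.zero_im]
    rintro y ((rfl | rfl | rfl) | ⟨p, rfl⟩) z ((rfl | rfl | rfl) | ⟨q, rfl⟩)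
    · exact key he he (by norm_num)
    · exact key he hx (by norm_num)
    · rw [hg.form_e_f]; norm_num
    · simp [hg.form_e_centralizer (hm q)]
    · exact key hx he (by norm_num)
    · rw [hg.normalized]; norm_num
    · exact key hx hf (by norm_num)
    · simp [hg.form_x_centralizer (hm q)]
    · rw [hg.form.symm_even hg.f_mem, hg.form_e_f]; norm_num
    · exact key hf hx (by norm_num)
    · exact key hf hf (by norm_num)
    · simp [hg.form_f_centralizer (hm q)]
    · exact hmc p hg.e_mem (hg.form_e_centralizer (hm p))
    · exact hmc p hg.x_mem (hg.form_x_centralizer (hm p))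
    · exact hmc p hg.f_mem (hg.form_f_centralizer (hm p))
    · simp only
      rw [hg.form_moment_centralizer (hm q) (hv.mem _) (hv.mem _),
        hg.pairing_comm (hg.br_centralizer_neg (hm q) (hv.mem _)) (hv.mem _)]
      exact hreal q.1 q.2 p.2 p.1
  have hpair (i j : ι) : (B (br e (v i)) (v j)).im = 0 := by
    rw [hg.form_br_e, hv.pairing]
    split_ifs <;> simp
  have hodd : ∀ y ∈ oddFrame e v, ∀ z ∈ oddFrame e v, (B y z).im = 0 := by
    have hn (i : ι) := Module.End.mem_eigenspace_iff.mp (hv.mem i)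
    have hp (i : ι) := Module.End.mem_eigenspace_iff.mp (hg.br_e_neg (hv.mem i))
    rintro y (⟨i, rfl⟩ | ⟨i, rfl⟩) z (⟨j, rfl⟩ | ⟨j, rfl⟩)
    · rw [hg.form.grade_grade hg.x_mem (hn i) (hn j) (by norm_num), Complex.zero_im]
    · rw [hg.form.skew_odd (hg.odd_of_neg (hv.mem i)) (hg.odd_of_pos (hg.br_e_neg (hv.mem j))),
        Complex.neg_im, hpair, neg_zero]
    · exact hpair i j
    · rw [hg.form.grade_grade hg.x_mem (hp i) (hp j) (by norm_num), Complex.zero_im]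
  rintro y (hy | hy) z (hz | hz)
  · exact heven y hy z hz
  · rw [hg.form.even y (hg.evenFrame_subset hv hy) z (hg.oddFrame_subset hv hz), Complex.zero_im]
  · rw [hg.form.odd_even (hg.oddFrame_subset hv hy) (hg.evenFrame_subset hv hz), Complex.zero_im]
  · exact hodd y hy z hz

/-- The conjugation that fixes a real orthonormal basis of `g_{-1/2}`. -/
lemma exists_isConjInvolution
    (hreal : ∀ i j k l, (frameRep B e v (moment B e x (v i) (v j)) k l).im = 0) :
    ∃ φ : g →ₗ⋆[ℂ] g, IsConjInvolution φ ∧ φ e = e ∧ φ x = x ∧ φ f = f ∧ (∀ i, φ (v i) = v i) ∧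
      ∀ a b, B (φ a) (φ b) = conj (B a b) := by
  obtain ⟨φ, hφ, hinv, hform⟩ := exists_conjugation B hg.form.nondeg _ (hg.span_frame hv)
    (hg.form_frame_im hv hreal)
  have h2 : conj (2 : ℂ) = 2 := Complex.conj_eq_iff_im.mpr rfl
  have he : φ e = e := hφ e (Or.inl (Or.inl (by simp)))
  have hx : φ x = x := hφ x (Or.inl (Or.inl (by simp)))
  have hf : φ f = f := hφ f (Or.inl (Or.inl (by simp)))
  have hφv (i : ι) : φ (v i) = v i := hφ _ (Or.inr (Or.inl ⟨i, rfl⟩))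
  have hφev (i : ι) : φ (br e (v i)) = br e (v i) := hφ _ (Or.inr (Or.inr ⟨i, rfl⟩))
  have hφm (p : ι × ι) : φ (moment B e x (v p.1) (v p.2)) = moment B e x (v p.1) (v p.2) :=
    hφ _ (Or.inl (Or.inr ⟨p, rfl⟩))
  have hm (p : ι × ι) := hg.moment_mem (hv.mem p.1) (hv.mem p.2)
  -- For φ to commute with ad y, the brackets of y with the fixed spanning set must be fixed. This
  -- is checked for e, f and v_i; the other generators are expressed through brackets of these.
  have hspan : ∀ y : g, (∀ z ∈ evenFrame B e x f v ∪ oddFrame e v, φ (br y z) = br y z) →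
      ∀ z, φ (br y z) = br y (φ z) := by
    intro y hy z
    have hz : z ∈ Submodule.span ℂ (evenFrame B e x f v ∪ oddFrame e v) :=
      hg.span_frame hv ▸ Submodule.mem_top
    induction hz using Submodule.span_induction with
    | mem z hz => rw [hy z hz, hφ z hz]
    | zero => simp
    | add a b _ _ ha hb => simp only [map_add, ha, hb]
    | smul t a _ ha => simp only [map_smul, map_smulₛₗ, ha]
  have hde : ∀ z, φ (br e z) = br e (φ z) := by
    refine hspan e ?_
    rintro z (((rfl | rfl | rfl) | ⟨p, rfl⟩) | (⟨i, rfl⟩ | ⟨i, rfl⟩))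
    · simp [hg.br_e_self]
    · rw [hg.br_e_x, map_neg, he]
    · rw [hg.br_e_f, hx]
    · simp [(hg.mem_centralizer.mp (hm p)).1]
    · exact hφev i
    · simp [hg.br_e_pos (hg.br_e_neg (hv.mem i))]
  have hdf : ∀ z, φ (br f z) = br f (φ z) := by
    refine hspan f ?_
    rintro z (((rfl | rfl | rfl) | ⟨p, rfl⟩) | (⟨i, rfl⟩ | ⟨i, rfl⟩))
    · rw [hg.br_f_e, map_neg, hx]
    · rw [hg.br_f_x, hf]
    · simp [hg.br_f_self]
    · simp [(hg.mem_centralizer.mp (hm p)).2.2]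
    · simp [hg.br_f_neg (hv.mem i)]
    · simp [hg.br_f_br_e (hv.mem i), hφv, h2]
  have hdv (i : ι) : ∀ z, φ (br (v i) z) = br (v i) (φ z) := by
    have hi := hg.odd_of_neg (hv.mem i)
    refine hspan (v i) ?_
    rintro z (((rfl | rfl | rfl) | ⟨p, rfl⟩) | (⟨j, rfl⟩ | ⟨j, rfl⟩))
    · rw [← neg_neg (br (v i) _), ← br_even_comm hg.e_mem, map_neg, hφev]
    · rw [hg.br_neg_x (hv.mem i), map_smulₛₗ, hφv]
      simp [h2]
    · simp [hg.br_neg_f (hv.mem i)]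
    · have h1 : br (v i) (moment B e x (v p.1) (v p.2)) =
          -∑ k, frameRep B e v (moment B e x (v p.1) (v p.2)) k i • v k := by
        rw [← hg.br_frame hv (hm p), br_even_comm (hg.centralizer_le (hm p)), neg_neg]
      simp only [h1, map_neg, map_sum, map_smulₛₗ, hφv,
        Complex.conj_eq_iff_im.mpr (hreal p.1 p.2 _ i)]
    · rw [hg.br_neg_neg (hv.mem i) (hv.mem j), map_smulₛₗ, hf, hv.pairing]
      split_ifs <;> simp [h2]
    · have h1 : br (v i) (br e (v j)) = moment B e x (v j) (v i) + B e (br (v j) (v i)) • x := by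
        rw [moment_apply, br_odd_comm hi (hg.odd_of_pos (hg.br_e_neg (hv.mem j)))]
        module
      simp only [h1, map_add, hφm (j, i), map_smulₛₗ, hx, hv.pairing]
      split_ifs <;> simp
  have hdeven {y z : g} (hy : y ∈ part (g := g) 0) (hyd : ∀ w, φ (br y w) = br y (φ w))
      (hzd : ∀ w, φ (br z w) = br z (φ w)) : ∀ w, φ (br (br y z) w) = br (br y z) (φ w) := by
    intro w
    have h1 (w : g) : br (br y z) w = br y (br z w) - br z (br y w) := by
      rw [br_even_br hy]; abel
    rw [h1, h1, map_sub, hyd, hzd, hzd, hyd]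
  have hdx : ∀ z, φ (br x z) = br x (φ z) := hg.br_e_f ▸ hdeven hg.e_mem hde hdf
  have hdev (i : ι) := hdeven hg.e_mem hde (hdv i)
  have hdm (p : ι × ι) : ∀ z, φ (br (moment B e x (v p.1) (v p.2)) z) =
      br (moment B e x (v p.1) (v p.2)) (φ z) := by
    intro z
    have h1 (z : g) : br (moment B e x (v p.1) (v p.2)) z =
        br (br e (v p.1)) (br (v p.2) z) + br (v p.2) (br (br e (v p.1)) z) -
          B e (br (v p.1) (v p.2)) • br x z := by
      rw [moment_apply, map_sub, map_smul, LinearMap.sub_apply, LinearMap.smul_apply,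
        br_odd_br (hg.odd_of_pos (hg.br_e_neg (hv.mem p.1))) (hg.odd_of_neg (hv.mem p.2))]
      abel
    rw [h1, h1, map_sub, map_add, hdev, hdv, hdv, hdev, map_smulₛₗ, hdx, hv.pairing]
    split_ifs <;> simp
  have hpart : ∀ (Y : Set g), (∀ y ∈ Y, φ y = y) →
      ∀ a ∈ Submodule.span ℂ Y, φ a ∈ Submodule.span ℂ Y := by
    intro Y hY a ha
    induction ha using Submodule.span_induction with
    | mem y hy => rw [hY y hy]; exact Submodule.subset_span hy
    | zero => simp
    | add a b _ _ ha hb => rw [map_add]; exact add_mem ha hb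
    | smul t a _ ha => rw [map_smulₛₗ]; exact Submodule.smul_mem _ _ ha
  refine ⟨φ, ⟨hinv, ?_, ?_⟩, he, hx, hf, hφv, hform⟩
  · intro p
    fin_cases p
    · have := hpart (evenFrame B e x f v) fun y hy => hφ y (Or.inl hy)
      rwa [hg.span_evenFrame hv] at this
    · have := hpart (oddFrame e v) fun y hy => hφ y (Or.inr hy)
      rwa [hg.span_oddFrame hv] at this
  · intro a b
    have ha : a ∈ Submodule.span ℂ (evenFrame B e x f v ∪ oddFrame e v) :=
      hg.span_frame hv ▸ Submodule.mem_top
    induction ha using Submodule.span_induction with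
    | mem y hy =>
      rw [hφ y hy]
      rcases hy with ((rfl | rfl | rfl) | ⟨p, rfl⟩) | (⟨j, rfl⟩ | ⟨j, rfl⟩)
      exacts [hde b, hdx b, hdf b, hdm p b, hdv j b, hdev j b]
    | zero => simp
    | add a c _ _ ha hc => simp only [map_add, LinearMap.add_apply, ha, hc]
    | smul t a _ ha => simp only [map_smul, map_smulₛₗ, LinearMap.smul_apply, ha]

/-- Fixed elements of the centralizer act by real skew matrices, on which -tr(ab) is the Euclidean
product of entries; definiteness is faithfulness of the action. -/
lemma isCompactLie_of_fixed {φ : g →ₗ⋆[ℂ] g} (hφ : IsConjInvolution φ) (he : φ e = e)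
    (hφv : ∀ i, φ (v i) = v i) (hform : ∀ a b, B (φ a) (φ b) = conj (B a b)) :
    IsCompactLie (realForm φ ⊓ (centralizer e x f).restrictScalars ℝ) := by
  let ρ := frameRep B e v
  have hreal {a : g} (ha : φ a = a) (k l : ι) : conj (ρ a k l) = ρ a k l := by
    rw [show ρ a k l = B e (br (v k) (br a (v l))) from rfl, ← hform, hφ.map_br, hφ.map_br, he,
      hφv, hφv, ha]
  refine ⟨LinearMap.mk₂ ℝ (fun a b => -(trace (ρ a * ρ b)).re) ?_ ?_ ?_ ?_, ?_, ?_, ?_⟩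
  · intro a b c
    rw [map_add, add_mul, trace_add, Complex.add_re]
    ring
  · intro r a b
    rw [← Complex.coe_smul, map_smul, smul_mul_assoc, trace_smul, smul_eq_mul, smul_eq_mul,
      Complex.re_ofReal_mul]
    ring
  · intro a b c
    rw [map_add, mul_add, trace_add, Complex.add_re]
    ring
  · intro r a b
    rw [← Complex.coe_smul, map_smul, mul_smul_comm, trace_smul, smul_eq_mul, smul_eq_mul,
      Complex.re_ofReal_mul]
    ring
  · intro a _ b _
    rw [LinearMap.mk₂_apply, LinearMap.mk₂_apply, trace_mul_comm]
  · rintro a ⟨ha, hc⟩ hne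
    rw [LinearMap.mk₂_apply]
    have h1 : -(trace (ρ a * ρ a)).re = ∑ i, ∑ j, Complex.normSq (ρ a i j) := by
      rw [← Complex.neg_re, ← trace_neg, ← mul_neg, ← hg.frameRep_transpose hv hc, trace,
        Complex.re_sum]
      refine Finset.sum_congr rfl fun i _ => ?_
      rw [diag_apply, mul_apply, Complex.re_sum]
      refine Finset.sum_congr rfl fun j _ => ?_
      rw [transpose_apply]
      have h : ρ a i j * ρ a i j = Complex.normSq (ρ a i j) := by
        rw [Complex.normSq_eq_conj_mul_self, hreal ha]
      rw [h, Complex.ofReal_re]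
    rw [h1]
    obtain ⟨i, j, hij⟩ : ∃ i j, ρ a i j ≠ 0 := by
      by_contra! h
      exact hne (hg.frameRep_injOn hv hc (Matrix.ext h))
    refine Finset.sum_pos' (fun i _ => Finset.sum_nonneg fun j _ => Complex.normSq_nonneg _)
      ⟨i, Finset.mem_univ i, ?_⟩
    exact Finset.sum_pos' (fun j _ => Complex.normSq_nonneg _)
      ⟨j, Finset.mem_univ j, Complex.normSq_pos.mpr hij⟩
  · rintro c ⟨_, hc⟩ a ⟨_, ha⟩ b ⟨_, hb⟩
    rw [LinearMap.mk₂_apply, LinearMap.mk₂_apply, ← neg_add, ← Complex.add_re, ← trace_add]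
    simp only [ρ]
    rw [hg.frameRep_br hv hc ha, hg.frameRep_br hv hc hb, sub_mul, mul_sub,
      ← mul_assoc (frameRep B e v a) (frameRep B e v b), trace_add, trace_sub, trace_sub,
      trace_mul_comm (frameRep B e v a * frameRep B e v b), ← mul_assoc, ← mul_assoc]
    simp

lemma isPosDefOnReal_of_fixed {φ : g →ₗ⋆[ℂ] g} (hφ : IsConjInvolution φ) (he : φ e = e)
    (hφv : ∀ i, φ (v i) = v i) (hform : ∀ a b, B (φ a) (φ b) = conj (B a b)) :
    IsPosDefOnReal (pairing B e) (realForm φ ⊓ (grade x (-1 / 2)).restrictScalars ℝ) := by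
  have hreal {a b : g} (ha : φ a = a) (hb : φ b = b) : conj (B e (br a b)) = B e (br a b) := by
    rw [← hform, he, hφ.map_br, ha, hb]
  refine ⟨fun a ha b hb => Complex.conj_eq_iff_im.mp (hreal ha.1 hb.1), ?_⟩
  rintro u ⟨hu, hmem⟩ hne
  have h1 (i : ι) := hreal (hφv i) hu
  have h2 : pairing B e u u = ∑ i, (Complex.normSq (B e (br (v i) u)) : ℂ) := by
    conv_lhs => rw [pairing, ← hv.sum_eq u hmem]
    change B e (br (frameSum v _) (frameSum v _)) = _
    rw [hv.pairing_frameSum]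
    refine Finset.sum_congr rfl fun i _ => ?_
    rw [Complex.normSq_eq_conj_mul_self, h1]
  rw [h2, Complex.re_sum]
  simp only [Complex.ofReal_re]
  obtain ⟨i, hi⟩ : ∃ i, B e (br (v i) u) ≠ 0 := by
    by_contra! h
    refine hne ?_
    rw [← hv.sum_eq u hmem]
    simp [h]
  exact Finset.sum_pos' (fun j _ => Complex.normSq_nonneg _)
    ⟨i, Finset.mem_univ i, Complex.normSq_pos.mpr hi⟩

/-- A real orthonormal basis gives an almost compact involution. -/
theorem exists_isAlmostCompact
    (hreal : ∀ i j k l, (frameRep B e v (moment B e x (v i) (v j)) k l).im = 0) :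
    ∃ φ : g →ₗ⋆[ℂ] g, IsAlmostCompact e x f φ ∧
      IsPosDefOnReal (pairing B e) (realForm φ ⊓ (grade x (-1 / 2)).restrictScalars ℝ) := by
  obtain ⟨φ, hφ, he, hx, hf, hφv, hform⟩ := hg.exists_isConjInvolution hv hreal
  exact ⟨φ, ⟨hφ, he, hx, hf, hg.isCompactLie_of_fixed hv hφ he hφv hform⟩,
    hg.isPosDefOnReal_of_fixed hv hφ he hφv hform⟩

end IsMinimalDatum
end LieSuperalgebra

/-! ### Change of frame and the Hermitian forms -/

namespace LieSuperalgebra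

set_option linter.unusedSectionVars false

open Matrix

section Change

variable {g : Type*} [AddCommGroup g] [Module ℂ g] [LieSuperalgebra g]
  {B : g →ₗ[ℂ] g →ₗ[ℂ] ℂ} {e x : g} {ι : Type*} [Fintype ι] [DecidableEq ι]

lemma frameSum_sum (v : ι → g) (c : ι → ℂ) (A : Matrix ι ι ℂ) :
    ∑ i, c i • frameSum v (A i) = frameSum v (c ᵥ* A) := by
  simp only [frameSum, vecMul, dotProduct, Finset.sum_smul, Finset.smul_sum, smul_smul]
  rw [Finset.sum_comm]

lemma IsFrame.change {v : ι → g} (hv : IsFrame B e x v) {A : Matrix ι ι ℂ} (hA : A * Aᵀ = 1) :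
    IsFrame B e x fun i => frameSum v (A i) where
  mem i := hv.frameSum_mem _
  pairing i j := by
    rw [hv.pairing_frameSum, ← Matrix.one_apply, ← hA]
    rfl
  sum_eq u hu := by
    obtain ⟨c, rfl⟩ := hv.exists_frameSum hu
    simp only [hv.pairing_frameSum]
    have h := frameSum_sum v (A *ᵥ c) A
    rw [← mulVec_transpose, mulVec_mulVec, mul_eq_one_comm.mp hA, one_mulVec] at h
    exact h

lemma frameRep_change (v : ι → g) (A : Matrix ι ι ℂ) (a : g) :
    frameRep B e (fun i => frameSum v (A i)) a = A * frameRep B e v a * Aᵀ := by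
  ext k l
  simp only [frameRep_apply, frameSum, map_sum, map_smul, LinearMap.sum_apply,
    LinearMap.smul_apply, mul_apply, transpose_apply, Finset.sum_mul, smul_eq_mul, Finset.mul_sum]
  refine Finset.sum_congr rfl fun i _ => Finset.sum_congr rfl fun j _ => ?_
  ring

lemma frameMoment_change (v : ι → g) (A X : Matrix ι ι ℂ) :
    frameMoment B e x (fun i => frameSum v (A i)) X = frameMoment B e x v (Aᵀ * X * A) := by
  simp only [frameMoment_apply (fun i => frameSum v (A i)), moment_frameSum, ← map_smul, ← map_sum]
  congr 1
  ext k l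
  simp only [Matrix.sum_apply, Matrix.smul_apply, vecMulVec_apply, mul_apply, transpose_apply, smul_eq_mul,
    Finset.sum_mul]
  rw [Finset.sum_comm]
  refine Finset.sum_congr rfl fun i _ => Finset.sum_congr rfl fun j _ => ?_
  ring

/-- Changing the frame moves the curvature operator along its orbit, so a real point of the orbit is
a frame with real curvature. -/
lemma frameCurv_change (v : ι → g) (A : Matrix ι ι ℂ) :
    frameCurv B e x (fun i => frameSum v (A i)) =
      CurvatureOperator.conjBy A (frameCurv B e x v) := by
  ext1 X
  rw [CurvatureOperator.conjBy_apply, frameCurv_apply, frameCurv_apply, frameMoment_change,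
    frameRep_change]

lemma frameRep_im_of_conjOp {v : ι → g}
    (h : CurvatureOperator.conjOp (frameCurv B e x v) = frameCurv B e x v) (i j k l : ι) :
    (frameRep B e v (moment B e x (v i) (v j)) k l).im = 0 := by
  have h1 := congr($h (CurvatureOperator.unit (i, j)) k l)
  rw [CurvatureOperator.conjOp_apply, CurvatureOperator.cj_unit, CurvatureOperator.cj_apply,
    frameCurv_apply, frameMoment_unit] at h1
  exact Complex.conj_eq_iff_im.mp h1

end Change

namespace IsMinimalDatum

variable {g : Type*} [AddCommGroup g] [Module ℂ g] [FiniteDimensional ℂ g] [LieSuperalgebra g]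
  {B : g →ₗ[ℂ] g →ₗ[ℂ] ℂ} {e x f : g} (hg : IsMinimalDatum B e x f)

include hg

lemma exists_isAlmostCompact_of_card_ne {ι : Type*} [Fintype ι] [DecidableEq ι] {v : ι → g}
    (hv : IsFrame B e x v) (hn : Fintype.card ι ≠ 4) :
    ∃ φ : g →ₗ⋆[ℂ] g, IsAlmostCompact e x f φ ∧
      IsPosDefOnReal (pairing B e) (realForm φ ⊓ (grade x (-1 / 2)).restrictScalars ℝ) := by
  obtain ⟨A, hA, h⟩ := (hg.frameCurv_isAdmissible hv).exists_conjOp_eq hn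
  rw [← frameCurv_change] at h
  exact hg.exists_isAlmostCompact (hv.change hA) (frameRep_im_of_conjOp h)

section Forms

variable {φ : g →ₗ⋆[ℂ] g} (hφ : IsAlmostCompact e x f φ)
  (hpos : IsPosDefOnReal (pairing B e) (realForm φ ⊓ (grade x (-1 / 2)).restrictScalars ℝ))

lemma map_grade_neg {u : g} (hφ : IsAlmostCompact e x f φ) (hu : u ∈ grade x (-1 / 2)) :
    φ u ∈ grade x (-1 / 2) := by
  rw [Module.End.mem_eigenspace_iff] at hu ⊢
  have h := congr_arg φ hu
  rw [hφ.conjInvolution.map_br, hφ.map_x, map_smulₛₗ,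
    Complex.conj_eq_iff_im.mpr (by norm_num : (-1 / 2 : ℂ).im = 0)] at h
  exact h

include hφ

lemma exists_fixed_add {u : g} (hu : u ∈ grade x (-1 / 2)) :
    ∃ a ∈ realForm φ ⊓ (grade x (-1 / 2)).restrictScalars ℝ,
      ∃ b ∈ realForm φ ⊓ (grade x (-1 / 2)).restrictScalars ℝ, u = a + Complex.I • b := by
  have hu' := hg.map_grade_neg hφ hu
  have hinv := hφ.conjInvolution.involutive u
  have h2 : conj (2 : ℂ) = 2 := Complex.conj_eq_iff_im.mpr rfl
  have hI : Complex.I * Complex.I = -1 := Complex.I_mul_I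
  refine ⟨(1 / 2 : ℂ) • (u + φ u), ⟨?_, ?_⟩, (-Complex.I / 2) • (u - φ u), ⟨?_, ?_⟩, ?_⟩
  · change φ _ = _
    rw [map_smulₛₗ, map_add, hinv, add_comm]
    simp [h2]
  · exact Submodule.smul_mem _ _ (add_mem hu hu')
  · change φ _ = _
    rw [map_smulₛₗ, map_sub, hinv]
    simp only [map_div₀, map_neg, Complex.conj_I, h2]
    module
  · exact Submodule.smul_mem _ _ (sub_mem hu hu')
  · rw [smul_smul, show Complex.I * (-Complex.I / 2) = 1 / 2 by linear_combination -hI / 2]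
    module

include hpos

/-- The involution is not asked to preserve B; the compatibility comes from reality of the pairing
on fixed vectors, extended by splitting into real and imaginary parts. -/
lemma conj_pairing {u v : g} (hu : u ∈ grade x (-1 / 2)) (hv : v ∈ grade x (-1 / 2)) :
    conj (B e (br u v)) = B e (br (φ u) (φ v)) := by
  obtain ⟨a, ha, b, hb, rfl⟩ := hg.exists_fixed_add hφ hu
  obtain ⟨c, hc, d, hd, rfl⟩ := hg.exists_fixed_add hφ hv
  have hreal {p q : g} (hp : p ∈ realForm φ ⊓ (grade x (-1 / 2)).restrictScalars ℝ)
      (hq : q ∈ realForm φ ⊓ (grade x (-1 / 2)).restrictScalars ℝ) :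
      conj (B e (br p q)) = B e (br p q) := Complex.conj_eq_iff_im.mpr (hpos.1 p hp q hq)
  have h1 : φ a = a := ha.1
  have h2 : φ b = b := hb.1
  have h3 : φ c = c := hc.1
  have h4 : φ d = d := hd.1
  simp only [map_add, map_smul, map_smulₛₗ, h1, h2, h3, h4, LinearMap.add_apply,
    LinearMap.smul_apply, smul_eq_mul, map_mul, hreal ha hc, hreal ha hd, hreal hb hc, hreal hb hd]

lemma isPosDefHermitianOn :
    IsPosDefHermitianOn (fun u v => pairing B e (φ u) v) (grade x (-1 / 2)) := by
  refine ⟨fun u hu v hv => ?_, fun u hu hne => ?_⟩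
  · change B e (br (φ v) u) = conj (B e (br (φ u) v))
    rw [hg.conj_pairing hφ hpos (hg.map_grade_neg hφ hu) hv, hφ.conjInvolution.involutive,
      hg.pairing_comm hu (hg.map_grade_neg hφ hv)]
  · obtain ⟨a, ha, b, hb, rfl⟩ := hg.exists_fixed_add hφ hu
    have h1 : φ a = a := ha.1
    have h2 : φ b = b := hb.1
    -- The cross terms cancel because the pairing is symmetric.
    have h3 : pairing B e (φ (a + Complex.I • b)) (a + Complex.I • b) =
        pairing B e a a + pairing B e b b := by
      simp only [pairing, map_add, map_smul, map_smulₛₗ, h1, h2, LinearMap.add_apply,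
        LinearMap.smul_apply, smul_eq_mul, hg.pairing_comm hb.2 ha.2, Complex.conj_I]
      linear_combination -B e (br b b) * Complex.I_mul_I
    simp only [h3, Complex.add_re]
    by_cases ha0 : a = 0
    · have hb0 : b ≠ 0 := by
        rintro rfl
        simp [ha0] at hne
      have := hpos.2 b hb hb0
      simpa [ha0, pairing] using this
    · have h4 := hpos.2 a ha ha0
      by_cases hb0 : b = 0
      · simpa [hb0, pairing] using h4
      · exact add_pos h4 (hpos.2 b hb hb0)

lemma isNegDefHermitianOn :
    IsNegDefHermitianOn (fun u v => pairing B f (φ u) v) (grade x (1 / 2)) := by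
  have hP := hg.isPosDefHermitianOn hφ hpos
  have key {u v : g} (hu : u ∈ grade x (-1 / 2)) (hv : v ∈ grade x (-1 / 2)) :
      pairing B f (φ (br e u)) (br e v) = -(1 / 2) * pairing B e (φ u) v := by
    rw [pairing, hφ.conjInvolution.map_br, hφ.map_e,
      hg.form_f_br_pos_pos (hg.map_grade_neg hφ hu) hv, pairing]
  refine ⟨fun u' hu' v' hv' => ?_, fun u' hu' hne => ?_⟩
  · obtain ⟨u, hu, rfl⟩ := hg.exists_br_e_eq hu'
    obtain ⟨v, hv, rfl⟩ := hg.exists_br_e_eq hv'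
    simp only [key hu hv, key hv hu, hP.1 u hu v hv, map_mul]
    rw [Complex.conj_eq_iff_im.mpr (by norm_num : (-(1 / 2) : ℂ).im = 0)]
  · obtain ⟨u, hu, rfl⟩ := hg.exists_br_e_eq hu'
    have h := hP.2 u hu (by rintro rfl; simp at hne)
    simp only [key hu hu]
    rw [show (-(1 / 2) : ℂ) = ((-(1 / 2) : ℝ) : ℂ) by push_cast; rfl, Complex.re_ofReal_mul]
    linarith

end Forms

end IsMinimalDatum
end LieSuperalgebra

/-! ### Four-forms in dimension four -/

namespace CurvatureOperator

attribute [local instance] LieRing.ofAssociativeRing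
set_option linter.unusedSectionVars false

open Matrix

variable {ι : Type*} [Fintype ι] [DecidableEq ι] {c : Matrix ι ι ℂ →ₗ[ℂ] Matrix ι ι ℂ}

namespace IsFourForm

lemma apply_eq_zero (hc : IsFourForm c) {i j k l : ι}
    (h : i = j ∨ i = k ∨ i = l ∨ j = k ∨ j = l ∨ k = l) : c (unit (i, j)) k l = 0 := by
  rcases h with rfl | rfl | rfl | rfl | rfl | rfl
  · have h := hc.swap_fst i i k l
    exact self_eq_neg.mp h
  · rw [hc.swap_snd, hc.apply_same_fst, neg_zero]
  · exact hc.apply_same_fst i k j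
  · rw [hc.swap_fst, hc.swap_snd, hc.apply_same_fst, neg_zero, neg_zero]
  · rw [hc.swap_fst, hc.apply_same_fst, neg_zero]
  · exact self_eq_neg.mp (hc.swap_snd _ k k)

/-- In dimension four, a four-form pairs complementary coordinate planes. -/
lemma apply_of_card_eq_four (hc : IsFourForm c) {i j k l : ι} (hij : i ≠ j) (hik : i ≠ k)
    (hil : i ≠ l) (hjk : j ≠ k) (hjl : j ≠ l) (hkl : k ≠ l)
    (huniv : (Finset.univ : Finset ι) = {i, j, k, l}) {a : Matrix ι ι ℂ} (ha : aᵀ = -a) :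
    c a k l = 2 * a i j * c (unit (i, j)) k l := by
  have hskew : a j i = -a i j := congr_fun (congr_fun ha i) j
  rw [apply_eq_sum, Fintype.sum_prod_type, huniv]
  have h0 {p q r s : ι} (h : p = q ∨ p = r ∨ p = s ∨ q = r ∨ q = s ∨ r = s) :
      c (unit (p, q)) r s = 0 := hc.apply_eq_zero h
  -- Only the index pairs (i, j) and (j, i) survive, with equal contributions; hence the factor 2.
  simp [Finset.sum_insert, hij, hik, hil, hjk, hjl, hkl, h0, hc.swap_fst j i, hskew]
  ring

/-- With m the coefficient on the right, c gives r·a_kl = 2m·a_ij and r·a_ij = 2m·a_kl, as the Hodge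
star swaps complementary planes. -/
lemma sq_eq_of_ne_zero (hc : IsFourForm c) {i j k l : ι} (hij : i ≠ j) (hik : i ≠ k)
    (hil : i ≠ l) (hjk : j ≠ k) (hjl : j ≠ l) (hkl : k ≠ l)
    (huniv : (Finset.univ : Finset ι) = {i, j, k, l}) {a : Matrix ι ι ℂ} (ha : aᵀ = -a) {r : ℂ}
    (hr : c a = r • a) (hne : a i j ≠ 0) : r ^ 2 = 4 * c (unit (i, j)) k l ^ 2 := by
  have h1 := hc.apply_of_card_eq_four hij hik hil hjk hjl hkl huniv ha
  have h2 := hc.apply_of_card_eq_four hkl hik.symm hjk.symm hil.symm hjl.symm hij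
    (by rw [huniv]; ext; simp; tauto) ha
  rw [hr, Matrix.smul_apply, smul_eq_mul] at h1 h2
  rw [hc.swap_pairs k l i j] at h2
  refine mul_right_cancel₀ hne ?_
  linear_combination r * h2 + 2 * c (unit (i, j)) k l * h1

/-- A four-form in dimension four with a real eigenvalue is real. -/
lemma im_eq_zero_of_card_eq_four (hc : IsFourForm c) (hn : Fintype.card ι = 4)
    {a : Matrix ι ι ℂ} (ha : aᵀ = -a) (ha0 : a ≠ 0) {r : ℝ} (hr : c a = (r : ℂ) • a)
    (i j k l : ι) : (c (unit (i, j)) k l).im = 0 := by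
  by_cases h : i = j ∨ i = k ∨ i = l ∨ j = k ∨ j = l ∨ k = l
  · rw [hc.apply_eq_zero h, Complex.zero_im]
  push Not at h
  obtain ⟨hij, hik, hil, hjk, hjl, hkl⟩ := h
  have huniv : (Finset.univ : Finset ι) = {i, j, k, l} := by
    refine (Finset.eq_univ_of_card _ ?_).symm
    rw [hn]
    simp [hij, hik, hil, hjk, hjl, hkl]
  suffices hsq : (r : ℂ) ^ 2 = 4 * c (unit (i, j)) k l ^ 2 by
    have h1 : (r - 2 * c (unit (i, j)) k l) * (r + 2 * c (unit (i, j)) k l) = 0 := by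
      linear_combination hsq
    rcases mul_eq_zero.mp h1 with h | h <;> simpa using congr_arg Complex.im h
  obtain ⟨p, q, hpq⟩ : ∃ p q, a p q ≠ 0 := by
    by_contra! h
    exact ha0 (Matrix.ext h)
  have hskew (p q : ι) : a p q = -a q p := congr_fun (congr_fun ha q) p
  have hdiag (p : ι) : a p p = 0 := self_eq_neg.mp (hskew p p)
  have hmem (m : ι) : m = i ∨ m = j ∨ m = k ∨ m = l := by
    have : m ∈ (Finset.univ : Finset ι) := Finset.mem_univ m
    rw [huniv] at this
    simpa using this
  have e1 (i j k l : ι) : c (unit (i, j)) k l ^ 2 = c (unit (j, i)) k l ^ 2 := by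
    rw [hc.swap_fst i j k l, neg_sq]
  have e2 (i j k l : ι) : c (unit (i, j)) k l ^ 2 = c (unit (i, j)) l k ^ 2 := by
    rw [hc.swap_snd _ k l, neg_sq]
  have e3 (i j k l : ι) : c (unit (i, j)) k l ^ 2 = c (unit (i, l)) k j ^ 2 := by
    rw [hc.swap_mid i j k l, neg_sq]
  have e4 (i j k l : ι) : c (unit (i, j)) k l ^ 2 = c (unit (k, l)) i j ^ 2 := by
    rw [hc.swap_pairs]
  -- A nonzero skew matrix is nonzero on one of the six coordinate planes; the square of the
  -- coefficient does not depend on the plane used.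
  have hp : (a i j ≠ 0 ∨ a k l ≠ 0) ∨ (a i l ≠ 0 ∨ a k j ≠ 0) ∨ (a i k ≠ 0 ∨ a j l ≠ 0) := by
    by_contra! h
    obtain ⟨⟨h1, h2⟩, ⟨h3, h4⟩, h5, h6⟩ := h
    apply hpq
    rcases hmem p with rfl | rfl | rfl | rfl <;> rcases hmem q with rfl | rfl | rfl | rfl <;>
      first
      | exact hdiag _
      | assumption
      | (rw [hskew, neg_eq_zero]; assumption)
  rcases hp with (h | h) | (h | h) | (h | h)
  · exact hc.sq_eq_of_ne_zero hij hik hil hjk hjl hkl huniv ha hr h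
  · rw [e4]
    exact hc.sq_eq_of_ne_zero hkl hik.symm hjk.symm hil.symm hjl.symm hij
      (by rw [huniv]; ext; simp; tauto) ha hr h
  · rw [e3]
    exact hc.sq_eq_of_ne_zero hil hik hij hkl.symm hjl.symm hjk.symm
      (by rw [huniv]; ext; simp; tauto) ha hr h
  · rw [e3, e4]
    exact hc.sq_eq_of_ne_zero hjk.symm hik.symm hkl hij.symm hjl hil
      (by rw [huniv]; ext; simp; tauto) ha hr h
  · rw [e2, e3, e2]
    exact hc.sq_eq_of_ne_zero hik hij hil hjk.symm hkl hjl
      (by rw [huniv]; ext; simp; tauto) ha hr h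
  · rw [e1, e3]
    exact hc.sq_eq_of_ne_zero hjl hjk hij.symm hkl.symm hil.symm hik.symm
      (by rw [huniv]; ext; simp; tauto) ha hr h

end IsFourForm

/-- In dimension four, an admissible operator with a real eigenvalue is real. -/
theorem IsAdmissible.conjOp_eq_of_card_eq_four {R : Matrix ι ι ℂ →ₗ[ℂ] Matrix ι ι ℂ}
    (hR : IsAdmissible R) (hn : Fintype.card ι = 4) {a : Matrix ι ι ℂ} (ha : aᵀ = -a)
    (ha0 : a ≠ 0) {r : ℂ} (hr : R a = r • a) (him : r.im = 0) :
    CurvatureOperator.conjOp R = R := by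
  have hc := hR.fourForm
  -- `constOp` is -1 on skew matrices.
  have h1 : (R - constOp ι) a = ((r.re + 1 : ℝ) : ℂ) • a := by
    have hre : (r.re : ℂ) = r := Complex.ext rfl him.symm
    rw [LinearMap.sub_apply, hr, constOp_skew ha, Complex.ofReal_add, hre, Complex.ofReal_one]
    module
  have h2 := hc.im_eq_zero_of_card_eq_four hn ha ha0 h1
  have h3 : CurvatureOperator.conjOp (R - constOp ι) = R - constOp ι := by
    ext1 X
    rw [CurvatureOperator.conjOp_apply]
    ext k l
    rw [cj_apply, IsFourForm.apply_eq_sum, map_sum, IsFourForm.apply_eq_sum]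
    refine Finset.sum_congr rfl fun p _ => ?_
    rw [map_mul, cj_apply, Complex.conj_conj, Complex.conj_eq_iff_im.mpr (h2 p.1 p.2 k l)]
  have h4 : CurvatureOperator.conjOp (R - constOp ι) =
      CurvatureOperator.conjOp R - CurvatureOperator.conjOp (constOp ι) := by
    ext1 X
    simp only [LinearMap.sub_apply, CurvatureOperator.conjOp_apply, cj_sub]
  rw [h4, conjOp_constOp] at h3
  exact sub_left_injective h3

end CurvatureOperator

/-! ### Reality of trace-form eigenvalues from weights -/

namespace CartanForm

open LieModule Module

variable {L : Type*} [LieRing L] [LieAlgebra ℂ L] [FiniteDimensional ℂ L]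
  {M : Type*} [AddCommGroup M] [Module ℂ M] [LieRingModule L M]
  [LieModule ℂ L M] {β : L →ₗ[ℂ] L →ₗ[ℂ] ℂ}
  (hinv : ∀ a b c, β ⁅a, b⁆ c = β a ⁅b, c⁆) (hsymm : ∀ a b, β a b = β b a)
  (hnd : ∀ a, (∀ b, β a b = 0) → a = 0) (H : LieSubalgebra ℂ L) [H.IsCartanSubalgebra]

include hnd

lemma surjective_of_nondeg : Function.Surjective β := by
  refine (LinearMap.injective_iff_surjective_of_finrank_eq_finrank
    Subspace.dual_finrank_eq.symm).mp ?_
  refine (injective_iff_map_eq_zero β).mpr fun a ha => hnd a fun b => ?_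
  rw [ha, LinearMap.zero_apply]

include hinv

/-- An invariant nondegenerate form is nondegenerate on a Cartan subalgebra. -/
lemma eq_zero_of_cartan {h : L} (hh : h ∈ H) (h0 : ∀ k ∈ H, β h k = 0) : h = 0 := by
  refine hnd h fun b => ?_
  -- The Fitting complement of H is orthogonal to H by invariance, so testing against H suffices.
  have hc := isCompl_genWeightSpace_zero_posFittingComp ℂ H L
  have hb : b ∈ genWeightSpace L (0 : H → ℂ) ⊔ posFittingComp ℂ H L :=
    hc.sup_eq_top ▸ LieSubmodule.mem_top b
  have hroot : LieAlgebra.rootSpace H (0 : H → ℂ) = H.toLieSubmodule :=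
    LieAlgebra.rootSpace_zero_eq ℂ L H
  obtain ⟨k, hk, p, hp, rfl⟩ := (LieSubmodule.mem_sup _ _ _).mp hb
  have hk' : k ∈ H := by
    have : k ∈ LieAlgebra.rootSpace H (0 : H → ℂ) := hk
    rwa [hroot] at this
  have hh' : h ∈ LieAlgebra.rootSpace H (0 : H → ℂ) := by rwa [hroot]
  rw [map_add, h0 k hk', zero_add]
  refine eq_zero_of_mem_genWeightSpace_mem_posFitting ℂ H L (B := β) (fun y m n => ?_) hh' hp
  change β ⁅(y : L), m⁆ n = -β m ⁅(y : L), n⁆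
  rw [← lie_skew, map_neg, LinearMap.neg_apply, hinv]

variable (M)

/-- An eigenvector of the trace form of a module with respect to an invariant form can be found in
a Cartan subalgebra. -/
lemma exists_mem_cartan {a : L} (ha0 : a ≠ 0) {s : ℂ}
    (ha : ∀ b, traceForm ℂ L M a b = s * β a b) :
    ∃ t ∈ H, t ≠ 0 ∧ ∀ b, traceForm ℂ L M t b = s * β t b := by
  by_contra! hcon
  have hsurj := surjective_of_nondeg hnd
  have hinj : Function.Injective β := (injective_iff_map_eq_zero β).mpr fun a ha => hnd a fun b => by
    rw [ha, LinearMap.zero_apply]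
  let E : L ≃ₗ[ℂ] (L →ₗ[ℂ] ℂ) := LinearEquiv.ofBijective β ⟨hinj, hsurj⟩
  -- S represents the trace form through β. It commutes with the adjoint action, hence preserves the
  -- Cartan subalgebra.
  let S : L →ₗ[ℂ] L := E.symm.toLinearMap ∘ₗ traceForm ℂ L M
  have hS (a b : L) : β (S a) b = traceForm ℂ L M a b :=
    congr($(E.apply_symm_apply (traceForm ℂ L M a)) b)
  have hSl (a b : L) : S ⁅a, b⁆ = ⁅S a, b⁆ := by
    refine hinj (LinearMap.ext fun c => ?_)
    rw [hS, hinv, hS, traceForm_apply_lie_apply]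
  have hSr (a b : L) : S ⁅a, b⁆ = ⁅a, S b⁆ := by
    rw [← lie_skew, map_neg, hSl, lie_skew]
  have hSH : ∀ h ∈ H, S h ∈ H := by
    intro h hh
    rw [← LieAlgebra.zeroRootSubalgebra_eq_of_is_cartan ℂ L H,
      LieAlgebra.mem_zeroRootSubalgebra]
    intro y
    obtain ⟨k, hk⟩ := (LieAlgebra.mem_zeroRootSubalgebra ℂ L H h).mp
      (LieAlgebra.le_zeroRootSubalgebra ℂ L H hh) y
    refine ⟨k, ?_⟩
    have hpow (k : ℕ) (z : L) : (toEnd ℂ H L y ^ k) (S z) = S ((toEnd ℂ H L y ^ k) z) := by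
      induction k with
      | zero => rfl
      | succ k ih =>
        rw [pow_succ', Module.End.mul_apply, Module.End.mul_apply, ih]
        exact (hSr (y : L) _).symm
    rw [hpow, hk, map_zero]
  let T : H →ₗ[ℂ] H :=
    { toFun := fun h => ⟨S h - s • h, sub_mem (hSH h h.2) (H.smul_mem s h.2)⟩
      map_add' := fun h k => by
        ext
        change S (h + k : L) - s • (h + k : L) = (S h - s • (h : L)) + (S k - s • (k : L))
        rw [map_add]
        module
      map_smul' := fun c h => by
        ext
        change S (c • (h : L)) - s • c • (h : L) = c • (S h - s • (h : L))
        rw [map_smul]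
        module }
  have hTinj : Function.Injective T := by
    refine (injective_iff_map_eq_zero T).mpr fun h hh => ?_
    have h1 : S h = s • (h : L) := sub_eq_zero.mp (congr_arg Subtype.val hh)
    by_contra hne
    obtain ⟨b, hb⟩ := hcon h h.2 (fun h0 => hne (Subtype.ext h0))
    rw [← hS, h1, map_smul] at hb
    exact hb rfl
  have hTsurj := LinearMap.injective_iff_surjective.mp hTinj
  have haS : S a = s • a := by
    refine hinj (LinearMap.ext fun b => ?_)
    rw [hS, ha, map_smul]
    rfl
  -- If s is not an eigenvalue on H, every h is (S - s)k, and [(S - s)k, a] = [k, (S - s)a] = 0. So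
  -- `a` normalizes H, hence lies in it, a contradiction.
  have haH : a ∈ H := by
    rw [← LieSubalgebra.IsCartanSubalgebra.self_normalizing (H := H),
      LieSubalgebra.mem_normalizer_iff']
    intro h hh
    obtain ⟨k, hk⟩ := hTsurj ⟨h, hh⟩
    have h1 : S k - s • (k : L) = h := congr_arg Subtype.val hk
    rw [← h1, sub_lie, smul_lie, ← hSl, hSr, haS, lie_smul, sub_self]
    exact zero_mem _
  obtain ⟨b, hb⟩ := hcon a haH ha0
  exact hb (ha b)

variable [FiniteDimensional ℂ M]

include hsymm

/-- If the inner products of the weights of a module are real, then so are the eigenvalues of its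
trace form. -/
theorem im_eq_zero_of_weights
    (hreal : ∀ t ∈ H, ∀ t' ∈ H, (∃ v : M, v ≠ 0 ∧ ∀ h ∈ H, ⁅h, v⁆ = β t h • v) →
      (∃ v : M, v ≠ 0 ∧ ∀ h ∈ H, ⁅h, v⁆ = β t' h • v) → (β t t').im = 0)
    {a : L} (ha0 : a ≠ 0) {s : ℂ} (ha : ∀ b, traceForm ℂ L M a b = s * β a b) : s.im = 0 := by
  obtain ⟨t, htH, ht0, ht⟩ := exists_mem_cartan M hinv hnd H ha0 ha
  have hrep : ∀ χ : Weight ℂ H M, ∃ c ∈ H, ∀ h : H, β c h = χ h := by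
    intro χ
    let γ : H →ₗ[ℂ] Module.Dual ℂ H := β.domRestrict₁₂ H.toSubmodule H.toSubmodule
    have hγ : Function.Injective γ := (injective_iff_map_eq_zero γ).mpr fun h hh =>
      Subtype.ext (eq_zero_of_cartan hinv hnd H h.2 fun k hk => congr($hh ⟨k, hk⟩))
    obtain ⟨c, hc⟩ := (LinearMap.injective_iff_surjective_of_finrank_eq_finrank
      Subspace.dual_finrank_eq.symm).mp hγ (Weight.toLinear ℂ H M χ)
    exact ⟨c, c.2, fun h => congr($hc h)⟩
  choose c hcH hc using hrep
  have hcr (χ ψ : Weight ℂ H M) : conj (β (c χ) (c ψ)) = β (c χ) (c ψ) := by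
    have hv (χ : Weight ℂ H M) : ∃ v : M, v ≠ 0 ∧ ∀ h ∈ H, ⁅h, v⁆ = β (c χ) h • v := by
      obtain ⟨v, hv, hv'⟩ := exists_forall_lie_eq_smul ℂ H M χ
      exact ⟨v, hv, fun h hh => by rw [hc χ ⟨h, hh⟩, ← hv' ⟨h, hh⟩]; rfl⟩
    exact Complex.conj_eq_iff_im.mpr (hreal _ (hcH χ) _ (hcH ψ) (hv χ) (hv ψ))
  let n : Weight ℂ H M → ℂ := fun χ => (finrank ℂ (genWeightSpace M χ) : ℂ)
  let τ : Weight ℂ H M → ℂ := fun χ => β (c χ) t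
  have hsum : ∀ h ∈ H, s * β t h = ∑ χ, n χ * (τ χ * β (c χ) h) := by
    intro h hh
    rw [← ht]
    have h1 := traceForm_eq_sum_finrank_nsmul_mul ℂ H M ⟨t, htH⟩ ⟨h, hh⟩
    have h2 : traceForm ℂ H M ⟨t, htH⟩ ⟨h, hh⟩ = traceForm ℂ L M t h := rfl
    rw [← h2, h1]
    refine Finset.sum_congr rfl fun χ _ => ?_
    rw [nsmul_eq_mul, ← hc χ, ← hc χ]
  -- P is the sum of |χ(t)|² over weights with multiplicity. The product sP is a Hermitian
  -- expression in the χ(t) with real symmetric matrix, so it is real.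
  let P : ℝ := ∑ χ : Weight ℂ H M, (finrank ℂ (genWeightSpace M χ) : ℝ) * Complex.normSq (τ χ)
  have hP : (P : ℂ) = ∑ χ, n χ * (conj (τ χ) * τ χ) := by
    simp only [P, n, Complex.ofReal_sum, Complex.ofReal_mul, Complex.normSq_eq_conj_mul_self,
      Complex.ofReal_natCast]
  have hsP : conj (s * P) = s * P := by
    have h1 : s * P = ∑ ψ, ∑ χ, n ψ * n χ * (conj (τ ψ) * τ χ * β (c χ) (c ψ)) := by
      rw [hP, Finset.mul_sum]
      refine Finset.sum_congr rfl fun ψ _ => ?_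
      have h2 := hsum (c ψ) (hcH ψ)
      rw [hsymm t] at h2
      rw [show s * (n ψ * (conj (τ ψ) * τ ψ)) = n ψ * conj (τ ψ) * (s * τ ψ) by ring, h2,
        Finset.mul_sum]
      exact Finset.sum_congr rfl fun χ _ => by ring
    rw [h1, map_sum, Finset.sum_comm]
    refine Finset.sum_congr rfl fun ψ _ => ?_
    rw [map_sum]
    refine Finset.sum_congr rfl fun χ _ => ?_
    simp only [map_mul, Complex.conj_conj, hcr, hsymm (c ψ) (c χ), n, map_natCast]
    ring
  -- If P = 0, every weight of positive multiplicity kills t, so s·β(t, ·) vanishes on H, where β is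
  -- nondegenerate and t is nonzero.
  have hP0 : P ≠ 0 ∨ s = 0 := by
    by_contra! h
    have h1 := (Finset.sum_eq_zero_iff_of_nonneg fun χ _ =>
      mul_nonneg (Nat.cast_nonneg _) (Complex.normSq_nonneg _)).mp h.1
    refine ht0 (eq_zero_of_cartan hinv hnd H htH fun k hk => ?_)
    have h2 := hsum k hk
    rw [Finset.sum_eq_zero] at h2
    · exact (mul_eq_zero.mp h2).resolve_left h.2
    · intro χ hχ
      rcases mul_eq_zero.mp (h1 χ hχ) with h3 | h3
      · have : n χ = 0 := by simpa [n] using h3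
        rw [this, zero_mul]
      · rw [Complex.normSq_eq_zero.mp h3, zero_mul, mul_zero]
  rcases hP0 with h | rfl
  · rw [map_mul, Complex.conj_ofReal] at hsP
    exact Complex.conj_eq_iff_im.mp (mul_right_cancel₀ (Complex.ofReal_ne_zero.mpr h) hsP)
  · rfl

end CartanForm

/-! ### A real curvature eigenvalue, and dimension four -/

namespace LieSuperalgebra

set_option linter.unusedSectionVars false

open Matrix

section OddModule

variable {g : Type*} [AddCommGroup g] [Module ℂ g] [LieSuperalgebra g]

/-- The odd part is a module over the even part. -/
instance instLieRingModuleOdd : LieRingModule (Even g) (part (g := g) 1) where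
  bracket a u := ⟨br (a : g) (u : g), br_mem_odd a.2 u.2⟩
  add_lie a b u := by ext; simp
  lie_add a u v := by ext; simp
  leibniz_lie a b u := by
    ext
    exact br_even_br a.2 (b : g) (u : g)

instance instLieModuleOdd : LieModule ℂ (Even g) (part (g := g) 1) where
  smul_lie t a u := by
    ext
    change br (t • (a : g)) (u : g) = t • br (a : g) (u : g)
    rw [map_smul, LinearMap.smul_apply]
  lie_smul t a u := by
    ext
    exact map_smul (br (a : g)) t (u : g)

end OddModule

namespace IsMinimalDatum

variable {g : Type*} [AddCommGroup g] [Module ℂ g] [FiniteDimensional ℂ g] [LieSuperalgebra g]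
  {B : g →ₗ[ℂ] g →ₗ[ℂ] ℂ} {e x f : g} (hg : IsMinimalDatum B e x f)
  {ι : Type*} [Fintype ι] [DecidableEq ι] {v : ι → g} (hv : IsFrame B e x v)

include hg

/-- An eigenvalue of the trace form of the odd part with respect to the invariant form is real. -/
lemma im_eq_zero_of_traceForm {a : Even g} (ha0 : a ≠ 0) {s : ℂ}
    (ha : ∀ b : Even g, LieModule.traceForm ℂ (Even g) (part (g := g) 1) a b =
      s * B (a : g) (b : g)) : s.im = 0 := by
  obtain ⟨H, hH, hreal⟩ := hg.real_roots
  let β : Even g →ₗ[ℂ] Even g →ₗ[ℂ] ℂ := B.domRestrict₁₂ (part 0) (part 0)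
  have hinv : ∀ a b c : Even g, β ⁅a, b⁆ c = β a ⁅b, c⁆ := fun a b c => hg.form.invariant _ _ _
  have hsymm : ∀ a b : Even g, β a b = β b a := fun a b => hg.form.symm_even a.2 _
  have hnd : ∀ a : Even g, (∀ b, β a b = 0) → a = 0 := by
    refine fun a h => Subtype.ext (hg.form.nondeg _ fun b => ?_)
    obtain ⟨c, hc, d, hd, rfl⟩ := exists_eq_add b
    rw [map_add, hg.form.even _ a.2 _ hd, add_zero]
    exact h ⟨c, hc⟩
  -- A weight of the odd part is zero or a root; the zero weight is harmless.
  have hroot : ∀ t ∈ H, (∃ w : part (g := g) 1, w ≠ 0 ∧ ∀ h ∈ H, ⁅h, w⁆ = β t h • w) →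
      t = 0 ∨ IsRootElement B H t := by
    rintro t ht ⟨w, hw, hw'⟩
    by_cases h0 : ∃ h ∈ H, B (t : g) (h : g) ≠ 0
    · exact Or.inr ⟨ht, h0, w, fun h => hw (Subtype.ext h),
        fun h hh => congr_arg Subtype.val (hw' h hh)⟩
    · push Not at h0
      exact Or.inl (CartanForm.eq_zero_of_cartan hinv hnd H ht h0)
  refine CartanForm.im_eq_zero_of_weights (part (g := g) 1) hinv hsymm hnd H ?_ ha0 ha
  intro t ht t' ht' hw hw'
  change (B (t : g) (t' : g)).im = 0
  rcases hroot t ht hw with rfl | h1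
  · simp
  rcases hroot t' ht' hw' with rfl | h2
  · simp
  exact hreal t t' h1 h2

include hv

/-- The vectors v_i and [e, v_i] form a basis of the odd part whose coordinates are B([e, v_i], ·)
and -B(v_i, ·); the sign is that of the form on odd elements. -/
lemma trace_odd (T : Module.End ℂ (part (g := g) 1)) : LinearMap.trace ℂ _ T =
    ∑ i, B (br e (v i)) (T ⟨v i, hg.odd_of_neg (hv.mem i)⟩) -
      ∑ i, B (v i) (T ⟨br e (v i), hg.odd_of_pos (hg.br_e_neg (hv.mem i))⟩) := by
  let b (i : ι) : part (g := g) 1 := ⟨v i, hg.odd_of_neg (hv.mem i)⟩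
  let b' (i : ι) : part (g := g) 1 := ⟨br e (v i), hg.odd_of_pos (hg.br_e_neg (hv.mem i))⟩
  let p (i : ι) : part (g := g) 1 →ₗ[ℂ] ℂ := B (br e (v i)) ∘ₗ (part (g := g) 1).subtype
  let q (i : ι) : part (g := g) 1 →ₗ[ℂ] ℂ := -B (v i) ∘ₗ (part (g := g) 1).subtype
  have hsum (w : part (g := g) 1) : ∑ i, p i w • b i + ∑ i, q i w • b' i = w := by
    obtain ⟨w, hw⟩ := w
    obtain ⟨u, hu, y, hy, rfl⟩ := hg.exists_odd_eq_add hw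
    obtain ⟨z, hz, rfl⟩ := hg.exists_br_e_eq hy
    have hn {u : g} (hu : u ∈ grade x (-1 / 2)) := Module.End.mem_eigenspace_iff.mp hu
    have hp {u : g} (hu : u ∈ grade x (-1 / 2)) :=
      Module.End.mem_eigenspace_iff.mp (hg.br_e_neg hu)
    have h1 (i : ι) : B (br e (v i)) (u + br e z) = B e (br (v i) u) := by
      rw [map_add, hg.form.grade_grade hg.x_mem (hp (hv.mem i)) (hp hz) (by norm_num), add_zero,
        hg.form_br_e]
    have h2 (i : ι) : -B (v i) (u + br e z) = B e (br (v i) z) := by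
      rw [map_add, hg.form.grade_grade hg.x_mem (hn (hv.mem i)) (hn hu) (by norm_num), zero_add,
        ← hg.form.skew_odd (hg.odd_of_pos hy) (hg.odd_of_neg (hv.mem i)), hg.form_br_e,
        hg.pairing_comm hz (hv.mem i)]
    ext
    simp only [Submodule.coe_add, Submodule.coe_sum, Submodule.coe_smul]
    change ∑ i, B (br e (v i)) (u + br e z) • v i + ∑ i, (-B (v i) (u + br e z)) • br e (v i) = _
    simp only [h1, h2]
    rw [hv.sum_eq u hu]
    conv_rhs => rw [← hv.sum_eq z hz]
    simp only [map_sum, map_smul]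
  have hT : T = ∑ i, (p i ∘ₗ T).smulRight (b i) + ∑ i, (q i ∘ₗ T).smulRight (b' i) := by
    ext1 w
    rw [LinearMap.add_apply, LinearMap.sum_apply, LinearMap.sum_apply]
    exact (hsum (T w)).symm
  conv_lhs => rw [hT]
  simp only [map_add, map_sum, LinearMap.trace_smulRight]
  rw [sub_eq_add_neg, ← Finset.sum_neg_distrib]
  rfl

/-- As a module over the centralizer the odd part is two copies of g_{-1/2}, identified by ad e. -/
lemma traceForm_centralizer {a b : Even g} (ha : (a : g) ∈ centralizer e x f)
    (hb : (b : g) ∈ centralizer e x f) :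
    LieModule.traceForm ℂ (Even g) (part (g := g) 1) a b =
      2 * trace (frameRep B e v a * frameRep B e v b) := by
  rw [LieModule.traceForm_apply_apply, hg.trace_odd hv]
  have h1 (i : ι) : (frameRep B e v a * frameRep B e v b) i i =
      B e (br (v i) (br (a : g) (br (b : g) (v i)))) := by
    rw [hg.br_frame hv hb, mul_apply]
    simp [frameRep_apply, mul_comm]
  have hmem (i : ι) := hg.br_centralizer_neg ha (hg.br_centralizer_neg hb (hv.mem i))
  have h2 (i : ι) : B (v i) (br (a : g) (br (b : g) (br e (v i)))) =
      -B e (br (v i) (br (a : g) (br (b : g) (v i)))) := by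
    rw [hg.br_centralizer_br_e hb, hg.br_centralizer_br_e ha,
      hg.form.skew_odd (hg.odd_of_neg (hv.mem i)) (hg.odd_of_pos (hg.br_e_neg (hmem i))),
      hg.form_br_e, hg.pairing_comm (hmem i) (hv.mem i)]
  change ∑ i, B (br e (v i)) (br (a : g) (br (b : g) (v i))) -
    ∑ i, B (v i) (br (a : g) (br (b : g) (br e (v i)))) = _
  simp only [hg.form_br_e, h2, trace, diag_apply, h1, Finset.sum_neg_distrib]
  ring

/-- The curvature operator has an eigenvector in the centralizer, with a real eigenvalue. -/
lemma exists_real_eigenvalue : ∃ a ∈ centralizer e x f, a ≠ 0 ∧ ∃ r : ℂ, r.im = 0 ∧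
    frameCurv B e x v (frameRep B e v a) = r • frameRep B e v a := by
  -- By duality of μ and the action, B(Fa, b) is the trace form of g_{-1/2}; an eigenvalue r of F is
  -- thus a ratio of two invariant forms.
  let F : Module.End ℂ (centralizer e x f) :=
    { toFun := fun a => ⟨frameMoment B e x v (frameRep B e v a), hg.frameMoment_mem hv _⟩
      map_add' := fun a b => by ext; simp
      map_smul' := fun t a => by ext; simp }
  have : Nontrivial (centralizer e x f) := by
    obtain ⟨a, ha, b, hb, hab⟩ := hg.not_abelian
    refine ⟨⟨a, ha⟩, 0, fun h => hab ?_⟩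
    rw [show a = 0 from congr_arg Subtype.val h, map_zero, LinearMap.zero_apply]
  obtain ⟨r, hr⟩ := Module.End.exists_eigenvalue F
  obtain ⟨⟨a, ha⟩, hmem, hne⟩ := hr.exists_hasEigenvector
  have ha0 : a ≠ 0 := fun h => hne (Subtype.ext h)
  have hFa : frameMoment B e x v (frameRep B e v a) = r • a :=
    congr_arg Subtype.val (Module.End.mem_eigenspace_iff.mp hmem)
  refine ⟨a, ha, ha0, r, ?_, by rw [frameCurv_apply, hFa, map_smul]⟩
  have hk {b : g} (hb : b ∈ centralizer e x f) :
      trace (frameRep B e v a * frameRep B e v b) = r * B a b := by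
    rw [← hg.form_frameMoment hv hb, hFa, map_smul, LinearMap.smul_apply, smul_eq_mul]
  let a' : Even g := ⟨a, hg.centralizer_le ha⟩
  let e' : Even g := ⟨e, hg.e_mem⟩
  let x' : Even g := ⟨x, hg.x_mem⟩
  let f' : Even g := ⟨f, hg.f_mem⟩
  let τ := LieModule.traceForm ℂ (Even g) (part (g := g) 1) a'
  -- The span of the triple is its own derived algebra and commutes with a, so the trace form pairs
  -- it to zero with a, as B does. Proportionality then holds on the whole even part, with ratio 2r.
  have hτ {y z : Even g} (h : ⁅a', y⁆ = 0) : τ ⁅y, z⁆ = 0 := by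
    rw [← LieModule.traceForm_apply_lie_apply, h, map_zero, LinearMap.zero_apply]
  have hae : ⁅a', e'⁆ = 0 := Subtype.ext (hg.br_centralizer_e ha)
  have hax : ⁅a', x'⁆ = 0 := Subtype.ext (hg.br_centralizer_x ha)
  have hτe : τ e' = 0 := by
    rw [← hτ (z := e') hax]
    exact congr_arg τ (Subtype.ext hg.br_x_e.symm)
  have hτx : τ x' = 0 := by
    rw [← hτ (z := f') hae]
    exact congr_arg τ (Subtype.ext hg.br_e_f.symm)
  have hτf : τ f' = 0 := by
    rw [← neg_eq_zero, ← map_neg, ← hτ (z := f') hax]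
    exact congr_arg τ (Subtype.ext hg.br_x_f.symm)
  have key := hg.im_eq_zero_of_traceForm (a := a') (s := 2 * r)
    (fun h => ha0 (congr_arg Subtype.val h)) ?_
  · simpa using key
  rintro ⟨b, hb⟩
  have hb' := hb
  rw [← hg.even_eq] at hb'
  obtain ⟨s, hs, c, hc, rfl⟩ := Submodule.mem_sup.mp hb'
  obtain ⟨p, q, m, rfl⟩ := Submodule.mem_span_triple.mp hs
  have h1 : (⟨p • e + q • x + m • f + c, hb⟩ : Even g) =
      p • e' + q • x' + m • f' + ⟨c, hg.centralizer_le hc⟩ := rfl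
  have h2 : B a (p • e + q • x + m • f + c) = B a c := by
    rw [hg.form.symm_even (hg.centralizer_le ha), hg.form.symm_even (hg.centralizer_le ha)]
    simp [hg.form_e_centralizer ha, hg.form_x_centralizer ha, hg.form_f_centralizer ha]
  change τ _ = 2 * r * B a (p • e + q • x + m • f + c)
  rw [h1, h2, map_add, map_add, map_add, map_smul, map_smul, map_smul, hτe, hτx, hτf]
  have h3 := hg.traceForm_centralizer hv (a := a') (b := ⟨c, hg.centralizer_le hc⟩) ha hc
  rw [hk hc] at h3
  change _ + τ ⟨c, _⟩ = _
  rw [h3]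
  simp [mul_assoc]

lemma exists_isAlmostCompact_of_card_eq (hn : Fintype.card ι = 4) :
    ∃ φ : g →ₗ⋆[ℂ] g, IsAlmostCompact e x f φ ∧
      IsPosDefOnReal (pairing B e) (realForm φ ⊓ (grade x (-1 / 2)).restrictScalars ℝ) := by
  obtain ⟨a, ha, ha0, r, hr, h⟩ := hg.exists_real_eigenvalue hv
  have hconj := (hg.frameCurv_isAdmissible hv).conjOp_eq_of_card_eq_four hn
    (hg.frameRep_transpose hv ha) (fun h0 => ha0 (hg.frameRep_injOn hv ha h0)) h hr
  exact hg.exists_isAlmostCompact hv (frameRep_im_of_conjOp hconj)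

end IsMinimalDatum
end LieSuperalgebra

theorem mainTheorem10 {g : Type*} [AddCommGroup g] [Module ℂ g] [FiniteDimensional ℂ g]
    [LieSuperalgebra g] (B : g →ₗ[ℂ] g →ₗ[ℂ] ℂ) (e x f : g)
    (hg : LieSuperalgebra.IsMinimalDatum B e x f) :
    (∃ φ : g →ₗ⋆[ℂ] g, LieSuperalgebra.IsAlmostCompact e x f φ ∧
      LieSuperalgebra.IsPosDefOnReal (LieSuperalgebra.pairing B e)
        (LieSuperalgebra.realForm φ ⊓
          (LieSuperalgebra.grade x (-1 / 2)).restrictScalars ℝ)) ∧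
    ∀ φ : g →ₗ⋆[ℂ] g, LieSuperalgebra.IsAlmostCompact e x f φ →
      LieSuperalgebra.IsPosDefOnReal (LieSuperalgebra.pairing B e)
        (LieSuperalgebra.realForm φ ⊓
          (LieSuperalgebra.grade x (-1 / 2)).restrictScalars ℝ) →
      LieSuperalgebra.IsPosDefHermitianOn
        (fun u v => LieSuperalgebra.pairing B e (φ u) v) (LieSuperalgebra.grade x (-1 / 2)) ∧
      LieSuperalgebra.IsNegDefHermitianOn
        (fun u v => LieSuperalgebra.pairing B f (φ u) v) (LieSuperalgebra.grade x (1 / 2)) := by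
  refine ⟨?_, fun φ hφ hpos => ⟨hg.isPosDefHermitianOn hφ hpos, hg.isNegDefHermitianOn hφ hpos⟩⟩
  obtain ⟨n, v, hv⟩ := hg.exists_isFrame
  by_cases hn : Fintype.card (Fin n) = 4
  · exact hg.exists_isAlmostCompact_of_card_eq hv hn
  · exact hg.exists_isAlmostCompact_of_card_ne hv hn
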